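/- Let $d\ge 1$ and $\rho,\beta_0>0$. Let $V:\mathbb R^d\to\mathbb R$ with $V_\pm=\max(\pm V,0)$ satisfy $V_-\in L^{d/2}(\mathbb R^d)\cap L^{1+d/2}(\mathbb R^d)$, $V_+\in L^1_{\rm loc}(\mathbb R^d)$ and $\int_{\mathbb R^d}e^{-\beta_0V_+(x)}\,dx<\infty$, and let $A\in L^1_{\rm loc}(\mathbb R^d,\mathbb R^d)$. Let $w$ be real and even, with $w\in L^{1+d/2}(\mathbb R^d)+L^\infty_\varepsilon(\mathbb R^d)+\mathbb R_+\delta_0$; that is, $w=w_{\rm r}+a\delta_0$ with $a\ge 0$ and, for every $\varepsilon>0$, $w_{\rm r}=w_1+w_2$ with $w_1\in L^{1+d/2}(\mathbb R^d)$ and $\|w_2\|_{L^\infty}\le\varepsilon$. Let $s(t)=t\log t+(1-t)\log(1-t)$ (with $s(0)=s(1)=0$). For $m\in L^1(\mathbb R^{2d})$ with $0\le m\le 1$ put $\rho_m(x)=(2\pi)^{-d}\int_{\mathbb R^d}m(x,p)\,dp$ and, for $\rho'>0$, $$\mathcal E^{\beta,\rho'}(m)=\frac1{(2\pi)^d}\iint\big(|p+A(x)|^2+V(x)\big)m(x,p)\,dx\,dp+\frac1{2\rho'}\iint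 w(x-y)\rho_m(x)\rho_m(y)\,dx\,dy+\frac1{(2\pi)^d\beta}\iint s(m(x,p))\,dx\,dp,$$ with $\mathcal E^{\beta,\rho'}(m)=+\infty$ if one of the terms is not finite (the $\delta_0$ part of $w$ contributes $\frac{a}{2\rho'}\int\rho_m^2$, and $w*\rho_m=w_{\rm r}*\rho_m+a\rho_m$). For $r>0$ let $$F^\beta(r,\rho')=\inf\Big\{\mathcal E^{\beta,\rho'}(m):\ m\in L^1(\mathbb R^{2d}),\ 0\le m\le1,\ (2\pi)^{-d}\iint m=r\Big\},\qquad e^\beta(\rho)=F^\beta(\rho,\rho).$$ Then for all $\beta>\beta_0$: (i) The problem $e^\beta(\rho)$ has a minimizer. (ii) For every minimizer $m_0$ there is a $\mu\in\mathbb R$ such that, for almost every $(x,p)$, $$m_0(x,p)=\frac1{1+\exp\big(\beta(|p+A(x)|^2+V(x)+\rho^{-1}w*\rho_{m_0}(x)-\mu)\big)}.\qquad(*)$$ (iii) If $m_0$ is a minimizer and $(*)$ holds with $\mu$, then all the integrals below and in $\mathcal E^{\beta,\rho}(m_0)$ converge absolutely and $$e^\beta(\rho)=-\frac1{(2\pi)^d\beta}\iint\log\Big(1+e^{-\beta(|p|^2+V(x)+\rho^{-1}w*\rho_{m_0}(x)-\mu)}\Big)dx\,dp+\mu\rho-\frac1{2\rho}\iint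 w(x-y)\rho_{m_0}(x)\rho_{m_0}(y)\,dx\,dy.$$ (iv) Suppose moreover that $\widehat w\ge0$ in the sense of tempered distributions. Then $\mathcal E^{\beta,\rho}$ is strictly convex where it is finite (functions that agree almost everywhere being identified), and the minimizer is unique up to almost everywhere equality. For every $\rho'>0$ the function $F^\beta(\cdot,\rho')$ is finite and $C^1$ on $(0,\infty)$. If $m_0$ is the minimizer and $(*)$ holds with $\mu$, then $\mu=\frac{\partial F^\beta}{\partial r}(r,\rho')\big|_{r=\rho'=\rho}$. -/

import Mathlib

open MeasureTheory Filter Set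
open scoped ENNReal FourierTransform SchwartzMap ComplexOrder

/-- Position space (and momentum space) `ℝ^d` with its Euclidean norm. -/
abbrev Pos (d : ℕ) : Type := EuclideanSpace ℝ (Fin d)

/-- Phase space `ℝ^d × ℝ^d`, with points `(x, p)` and Lebesgue measure as its volume. -/
abbrev Phase (d : ℕ) : Type := Pos d × Pos d

/-- The fermionic entropy `s(t) = t log t + (1 - t) log (1 - t)`, with `s(0) = s(1) = 0`. -/
noncomputable def fermiEntropy (t : ℝ) : ℝ :=
  t * Real.log t + (1 - t) * Real.log (1 - t)

/-- The spatial density `ρ_m(x) = (2π)^{-d} ∫ m(x,p) dp`. -/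
noncomputable def spatialDensity {d : ℕ} (m : Phase d → ℝ) (x : Pos d) : ℝ :=
  ((2 * Real.pi) ^ d)⁻¹ * ∫ p : Pos d, m (x, p)

/-- Integrable phase space densities satisfying the Pauli principle `0 ≤ m ≤ 1`. -/
def IsPauliDensity {d : ℕ} (m : Phase d → ℝ) : Prop :=
  Integrable m ∧ ∀ᵐ z : Phase d, 0 ≤ m z ∧ m z ≤ 1

/-- The densities over which one minimizes: `0 ≤ m ≤ 1` and `(2π)^{-d} ∬ m = ρ`. -/
def IsAdmissible {d : ℕ} (ρ : ℝ) (m : Phase d → ℝ) : Prop :=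
  IsPauliDensity m ∧ ((2 * Real.pi) ^ d)⁻¹ * ∫ z : Phase d, m z = ρ

/-- The space `L^q + L^∞_ε`: for every `ε > 0` the function splits into a part in `L^q` and a
bounded part of sup norm at most `ε`. -/
def InLpPlusLinftyEps {d : ℕ} (q : ℝ≥0∞) (w : Pos d → ℝ) : Prop :=
  ∀ ε : ℝ, 0 < ε → ∃ w₁ w₂ : Pos d → ℝ,
    MemLp w₁ q ∧ AEStronglyMeasurable w₂ ∧ eLpNorm w₂ ⊤ ≤ ENNReal.ofReal ε ∧
      w =ᵐ[volume] fun x => w₁ x + w₂ x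

/-! In all that follows the interaction is the distribution `w + a δ₀`, with `w` a function and
`a` a number. -/

/-- The Fourier transform of `w + a δ₀`, as a tempered distribution, is nonnegative: it takes
nonnegative values on nonnegative Schwartz functions. -/
def HasNonnegFourier {d : ℕ} (w : Pos d → ℝ) (a : ℝ) : Prop :=
  ∀ φ : 𝓢(Pos d, ℂ), (∀ ξ, 0 ≤ φ ξ) →
    0 ≤ (∫ x : Pos d, (w x : ℂ) * (𝓕 φ : 𝓢(Pos d, ℂ)) x) + (a : ℂ) * (𝓕 φ : 𝓢(Pos d, ℂ)) 0

/-- The convolution `(w + a δ₀) * ν`. -/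
noncomputable def meanField {d : ℕ} (w : Pos d → ℝ) (a : ℝ) (ν : Pos d → ℝ) (x : Pos d) : ℝ :=
  (∫ y : Pos d, w (x - y) * ν y) + a * ν x

/-- The double integral of `(w + a δ₀)(x - y) ν(x) ν(y)`. -/
noncomputable def interactionIntegral {d : ℕ} (w : Pos d → ℝ) (a : ℝ) (ν : Pos d → ℝ) : ℝ :=
  (∫ z : Pos d × Pos d, w (z.1 - z.2) * ν z.1 * ν z.2) + ∫ x : Pos d, a * ν x ^ 2

/-- All the integrals in the Vlasov functional converge absolutely. -/
def HasFiniteTerms {d : ℕ} (V : Pos d → ℝ) (A : Pos d → Pos d) (w : Pos d → ℝ) (a : ℝ)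
    (m : Phase d → ℝ) : Prop :=
  Integrable (fun z : Phase d => (‖z.2 + A z.1‖ ^ 2 + V z.1) * m z) ∧
  Integrable (fun z : Phase d => fermiEntropy (m z)) ∧
  Integrable (fun z : Pos d × Pos d =>
    w (z.1 - z.2) * spatialDensity m z.1 * spatialDensity m z.2) ∧
  Integrable (fun x : Pos d => a * spatialDensity m x ^ 2)

open Classical in
/-- The Vlasov functional, with inverse temperature `β` and with the factor `1 / (2 ρ')` in front
of the interaction. It takes the value `+∞` when its terms are not all finite. (For `0 ≤ m ≤ 1`,
`m ∈ L¹`, and under the assumptions made on `V` and `w`, the second and third integral converge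
as soon as the first one does; when the first one diverges it equals `+∞`, and then so does its
sum with the entropy term.) -/
noncomputable def vlasovEnergy {d : ℕ} (V : Pos d → ℝ) (A : Pos d → Pos d) (w : Pos d → ℝ)
    (a β ρ' : ℝ) (m : Phase d → ℝ) : EReal :=
  if HasFiniteTerms V A w a m then
    ((((2 * Real.pi) ^ d)⁻¹ * (∫ z : Phase d, (‖z.2 + A z.1‖ ^ 2 + V z.1) * m z)
      + (2 * ρ')⁻¹ * interactionIntegral w a (spatialDensity m)
      + ((2 * Real.pi) ^ d * β)⁻¹ * ∫ z : Phase d, fermiEntropy (m z) : ℝ) : EReal)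
  else ⊤

/-- `F(ρ, ρ')`: the infimum over densities of mass `ρ` of the Vlasov functional with
parameter `ρ'`. -/
noncomputable def vlasovInf {d : ℕ} (V : Pos d → ℝ) (A : Pos d → Pos d) (w : Pos d → ℝ)
    (a β ρ ρ' : ℝ) : EReal :=
  ⨅ (m : Phase d → ℝ) (_ : IsAdmissible ρ m), vlasovEnergy V A w a β ρ' m

/-- The Vlasov minimum free energy `e(ρ)`. -/
noncomputable def vlasovMin {d : ℕ} (V : Pos d → ℝ) (A : Pos d → Pos d) (w : Pos d → ℝ)
    (a β ρ : ℝ) : EReal :=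
  vlasovInf V A w a β ρ ρ

/-- `m` is a minimizer for the Vlasov problem at mass `ρ`. -/
def IsVlasovMinimizer {d : ℕ} (V : Pos d → ℝ) (A : Pos d → Pos d) (w : Pos d → ℝ)
    (a β ρ : ℝ) (m : Phase d → ℝ) : Prop :=
  IsAdmissible ρ m ∧ vlasovEnergy V A w a β ρ m = vlasovMin V A w a β ρ

/-- The nonlinear equation
`m(x,p) = 1 / (1 + exp (β (|p + A(x)|² + V(x) + ρ⁻¹ ((w + a δ₀) * ρ_m)(x) - μ)))`, almost
everywhere, the convolution being absolutely convergent. -/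
def SolvesFermiDirac {d : ℕ} (V : Pos d → ℝ) (A : Pos d → Pos d) (w : Pos d → ℝ)
    (a β ρ μ : ℝ) (m : Phase d → ℝ) : Prop :=
  (∀ᵐ x : Pos d, Integrable fun y : Pos d => w (x - y) * spatialDensity m y) ∧
  ∀ᵐ z : Phase d, m z = 1 / (1 + Real.exp (β *
    (‖z.2 + A z.1‖ ^ 2 + V z.1 + ρ⁻¹ * meanField w a (spatialDensity m) z.1 - μ)))

/-!
The minimizer is found by the direct method, the nonlinear equation by Gibbs' variational principle,
and the derivative of the minimal free energy by a parabola that touches it from above.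

Everything is measured against the confinement `T = |p + A|² + V₊`. If `g ∈ L^{1+d/2}(ℝ^d)`, then the
part of `|g(x)|` that exceeds `δ T(x, p)` is integrable over phase space (`integrable_excess`), and
because `∬ e^{-β₀ T}` is finite the same holds for constants (`integrable_sublevel`). As `0 ≤ m ≤ 1`,
it follows that the energy in `V₋` and the interaction potential generated by `m` are controlled by an
arbitrarily small multiple of `∬ T m` plus a constant (`FormSmall`, `exists_convolution_bound`). On the
other hand `T t + s(t) / β₀ ≥ -e^{-β₀ T} / β₀` (`neg_exp_le_energy`), and since `β > β₀` a fraction of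
`∬ T m` is left over to dominate these errors (`exists_coercive`).

Along a minimizing sequence `∬ T m` is therefore bounded. A subsequence converges weakly in `L²`, and
bounded `∬ T m` allows testing with all functions that are infinitesimally small relative to `T`
(`WeaklyConverges.tendsto_of_formSmall`), among them constants, so that no mass is lost, `V₋`, and all
translates of `w`. The interaction converges (`tendsto_kernel`); its contact part and the sum of `T m`
and the entropy are convex, hence weakly lower semicontinuous. The limit is a minimizer
(`exists_minimizer`).

A minimizer `m₀` also minimizes the functional linearized in the interaction (`linearizedEnergy_le`),
which is the free energy of independent modes with energies
`h = |p + A|² + V + ρ⁻¹ (w + a δ₀) * ρ_{m₀}`. For a single mode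
the Fermi-Dirac occupation number is the only minimizer of `(h - μ) t + s(t) / β`. Comparing `m₀` with
the Fermi-Dirac distribution of the same mass, over sets of positions on which `V₋` is bounded, gives
the nonlinear equation (`exists_solvesFermiDirac`). Inserting it into the functional, and removing `A`
by the shear `p ↦ p + A(x)`, gives the value of the minimum (`vlasovReal_eq_grandPotential`).

If the Fourier transform of the interaction is nonnegative, the interaction is a positive semidefinite
quadratic form. For smooth compactly supported functions this is the hypothesis, applied to the inverse
Fourier transform of an autocorrelation; mollification and truncation give the general case
(`form_nonneg`). Together with the strict convexity of the entropy this yields strict convexity and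
uniqueness, and it makes the minimal free energy `F` convex in the mass. Varying a minimizer by
`t m₀ (1 - m₀)`, with `t` of either sign, bounds `F` near the given mass by a parabola of slope `μ`
(`exists_quadratic_bound`). A convex function with such a bound is differentiable with derivative `μ`,
and a differentiable convex function is continuously differentiable.
-/

/-! ### The fermionic entropy -/

theorem fermiEntropy_eq_neg_binEntropy (t : ℝ) : fermiEntropy t = -Real.binEntropy t := by
  simp only [fermiEntropy, Real.binEntropy, Real.log_inv]; ring

theorem continuous_fermiEntropy : Continuous fermiEntropy := by
  have : fermiEntropy = fun t => -Real.binEntropy t := funext fermiEntropy_eq_neg_binEntropy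
  rw [this]; fun_prop

theorem strictConvexOn_fermiEntropy : StrictConvexOn ℝ (Icc 0 1) fermiEntropy := by
  have : fermiEntropy = fun t => -Real.binEntropy t := funext fermiEntropy_eq_neg_binEntropy
  rw [this]; exact Real.strictConcave_binEntropy.neg

theorem fermiEntropy_nonpos {t : ℝ} (h0 : 0 ≤ t) (h1 : t ≤ 1) : fermiEntropy t ≤ 0 := by
  rw [fermiEntropy_eq_neg_binEntropy]; simpa using Real.binEntropy_nonneg h0 h1

/-- The elementary inequality behind the nonnegativity of relative entropies. -/
theorem mul_log_sub_log_le {t u : ℝ} (ht : 0 ≤ t) (hu : 0 < u) :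
    t * (Real.log u - Real.log t) ≤ u - t := by
  rcases ht.eq_or_lt with rfl | ht
  · simpa using hu.le
  · rw [← Real.log_div hu.ne' ht.ne']
    have := Real.log_le_sub_one_of_pos (div_pos hu ht)
    calc t * Real.log (u / t) ≤ t * (u / t - 1) := by gcongr
      _ = u - t := by field_simp

/-- The entropy lies above its tangents. -/
theorem fermiEntropy_tangent_le {t u : ℝ} (h0 : 0 ≤ t) (h1 : t ≤ 1) (hu0 : 0 < u) (hu1 : u < 1) :
    fermiEntropy u + (t - u) * (Real.log u - Real.log (1 - u)) ≤ fermiEntropy t := by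
  have e1 := mul_log_sub_log_le h0 hu0
  have e2 := mul_log_sub_log_le (sub_nonneg.2 h1) (sub_pos.2 hu1)
  simp only [fermiEntropy]
  nlinarith

/-- The Fermi-Dirac occupation number at energy `h` and inverse temperature `b`. -/
noncomputable def fermiDirac (b h : ℝ) : ℝ := 1 / (1 + Real.exp (b * h))

theorem fermiDirac_pos (b h : ℝ) : 0 < fermiDirac b h := by unfold fermiDirac; positivity

theorem fermiDirac_lt_one (b h : ℝ) : fermiDirac b h < 1 := by
  unfold fermiDirac
  rw [div_lt_one (by positivity)]
  linarith [Real.exp_pos (b * h)]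

theorem one_sub_fermiDirac (b h : ℝ) :
    1 - fermiDirac b h = Real.exp (b * h) * fermiDirac b h := by
  unfold fermiDirac
  have : 1 + Real.exp (b * h) ≠ 0 := by positivity
  field_simp; ring

theorem log_fermiDirac_sub (b h : ℝ) :
    Real.log (fermiDirac b h) - Real.log (1 - fermiDirac b h) = -(b * h) := by
  rw [one_sub_fermiDirac, Real.log_mul (Real.exp_ne_zero _) (fermiDirac_pos b h).ne',
    Real.log_exp]
  ring

theorem log_one_sub_fermiDirac (b h : ℝ) :
    Real.log (1 - fermiDirac b h) = -Real.log (1 + Real.exp (-b * h)) := by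
  rw [← Real.log_inv]
  congr 1
  rw [one_sub_fermiDirac, fermiDirac, neg_mul, Real.exp_neg]
  have := Real.exp_pos (b * h)
  field_simp
  ring

/-- The value of the free energy of one mode at the Fermi-Dirac distribution. -/
theorem fermiDirac_energy {b : ℝ} (hb : 0 < b) (h : ℝ) :
    h * fermiDirac b h + b⁻¹ * fermiEntropy (fermiDirac b h)
      = -(b⁻¹ * Real.log (1 + Real.exp (-b * h))) := by
  have e1 := log_fermiDirac_sub b h
  have e2 := log_one_sub_fermiDirac b h
  set f := fermiDirac b h
  have : fermiEntropy f = Real.log (1 - f) - f * (b * h) := by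
    simp only [fermiEntropy]; linear_combination f * e1
  rw [this, e2]; field_simp; ring

/-- Gibbs' variational principle for one mode. -/
theorem fermiDirac_energy_le {b : ℝ} (hb : 0 < b) (h : ℝ) {t : ℝ} (h0 : 0 ≤ t) (h1 : t ≤ 1) :
    h * fermiDirac b h + b⁻¹ * fermiEntropy (fermiDirac b h) ≤ h * t + b⁻¹ * fermiEntropy t := by
  have e := fermiEntropy_tangent_le h0 h1 (fermiDirac_pos b h) (fermiDirac_lt_one b h)
  rw [log_fermiDirac_sub] at e
  have := mul_le_mul_of_nonneg_left e (inv_pos.2 hb).le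
  have e3 : b⁻¹ * ((t - fermiDirac b h) * -(b * h)) = -(t - fermiDirac b h) * h := by
    field_simp
  rw [mul_add, e3] at this
  linarith

theorem eq_fermiDirac_of_energy_le {b : ℝ} (hb : 0 < b) (h : ℝ) {t : ℝ} (h0 : 0 ≤ t) (h1 : t ≤ 1)
    (hle : h * t + b⁻¹ * fermiEntropy t
      ≤ h * fermiDirac b h + b⁻¹ * fermiEntropy (fermiDirac b h)) : t = fermiDirac b h := by
  by_contra hne
  set f := fermiDirac b h with hf
  have hf0 := (fermiDirac_pos b h).le
  have hf1 := (fermiDirac_lt_one b h).le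
  rw [← hf] at hf0 hf1
  have hs := strictConvexOn_fermiEntropy.2 ⟨h0, h1⟩ ⟨hf0, hf1⟩ hne
    (show (0 : ℝ) < 1 / 2 by norm_num) (show (0 : ℝ) < 1 / 2 by norm_num) (by norm_num)
  simp only [smul_eq_mul] at hs
  have hm := fermiDirac_energy_le hb h (t := 1 / 2 * t + 1 / 2 * f) (by linarith) (by linarith)
  rw [← hf] at hm
  have := mul_lt_mul_of_pos_left hs (inv_pos.2 hb)
  nlinarith

/-- The free energy of one mode is bounded below by minus the free energy of a classical
(Boltzmann) mode; this bound is integrable over phase space. -/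
theorem neg_exp_le_energy {b : ℝ} (hb : 0 < b) (h : ℝ) {t : ℝ} (h0 : 0 ≤ t) (h1 : t ≤ 1) :
    -(b⁻¹ * Real.exp (-b * h)) ≤ h * t + b⁻¹ * fermiEntropy t := by
  refine le_trans ?_ (fermiDirac_energy_le hb h h0 h1)
  rw [fermiDirac_energy hb]
  have := Real.log_le_sub_one_of_pos (show 0 < 1 + Real.exp (-b * h) by positivity)
  gcongr
  linarith

/-- Second order upper bound on the entropy along the variation `f + t f (1 - f)` of the
Fermi-Dirac distribution. -/
theorem fermiEntropy_variation_le (b h : ℝ) {t : ℝ} (ht : |t| ≤ 1 / 2) :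
    fermiEntropy (fermiDirac b h + t * (fermiDirac b h * (1 - fermiDirac b h)))
      ≤ fermiEntropy (fermiDirac b h) - t * (fermiDirac b h * (1 - fermiDirac b h)) * (b * h)
        + 2 * t ^ 2 * fermiDirac b h := by
  rw [abs_le] at ht
  have e1 := log_fermiDirac_sub b h
  have hf0 := fermiDirac_pos b h
  have hf1 := fermiDirac_lt_one b h
  set f := fermiDirac b h
  have p1 : 0 < 1 + t * (1 - f) := by nlinarith
  have p2 : 0 < 1 - t * f := by nlinarith
  have hu : f + t * (f * (1 - f)) = f * (1 + t * (1 - f)) := by ring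
  have hu' : 1 - (f + t * (f * (1 - f))) = (1 - f) * (1 - t * f) := by ring
  have hu0 : 0 < f + t * (f * (1 - f)) := by rw [hu]; positivity
  have hu1 : f + t * (f * (1 - f)) < 1 := by
    have : 0 < (1 - f) * (1 - t * f) := mul_pos (by linarith) p2
    linarith
  have e := fermiEntropy_tangent_le hf0.le hf1.le hu0 hu1
  rw [hu', hu, Real.log_mul hf0.ne' p1.ne', Real.log_mul (by linarith) p2.ne', ← hu] at e
  -- the two logarithms differ by at most `2 |t|`, with the sign of `t`
  have key : t * (Real.log (1 + t * (1 - f)) - Real.log (1 - t * f)) ≤ 2 * t ^ 2 := by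
    rcases le_total 0 t with h0 | h0
    · have a1 := Real.log_le_sub_one_of_pos p1
      have a2 := Real.one_sub_inv_le_log_of_pos p2
      have a3 : (1 - t * f)⁻¹ ≤ 1 + 2 * t * f := by
        rw [inv_le_comm₀ p2 (by nlinarith), inv_le_iff_one_le_mul₀ (by nlinarith)]
        have := mul_nonneg (mul_nonneg h0 hf0.le) (show 0 ≤ 1 - 2 * (t * f) by nlinarith)
        nlinarith
      have : Real.log (1 + t * (1 - f)) - Real.log (1 - t * f) ≤ 2 * t := by nlinarith
      nlinarith
    · have a1 := Real.log_le_sub_one_of_pos p2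
      have a2 := Real.one_sub_inv_le_log_of_pos p1
      have a3 : (1 + t * (1 - f))⁻¹ ≤ 1 - 2 * t * (1 - f) := by
        rw [inv_le_comm₀ p1 (by nlinarith), inv_le_iff_one_le_mul₀ (by nlinarith)]
        have := mul_nonneg (mul_nonneg (neg_nonneg.2 h0) (sub_pos.2 hf1).le)
          (show 0 ≤ 1 + 2 * (t * (1 - f)) by nlinarith)
        nlinarith
      have : 2 * t ≤ Real.log (1 + t * (1 - f)) - Real.log (1 - t * f) := by nlinarith
      nlinarith
  have hη : 0 ≤ f * (1 - f) := mul_nonneg hf0.le (by linarith)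
  have hη' : f * (1 - f) ≤ f := by nlinarith
  have k2 : f * (1 - f) * (t * (Real.log (1 + t * (1 - f)) - Real.log (1 - t * f)))
      ≤ 2 * t ^ 2 * f := by
    calc _ ≤ f * (1 - f) * (2 * t ^ 2) := by gcongr
      _ ≤ f * (2 * t ^ 2) := by gcongr
      _ = _ := by ring
  have k3 : (f - (f + t * (f * (1 - f)))) * (Real.log f + Real.log (1 + t * (1 - f))
      - (Real.log (1 - f) + Real.log (1 - t * f)))
      = t * (f * (1 - f)) * (b * h)
        - f * (1 - f) * (t * (Real.log (1 + t * (1 - f)) - Real.log (1 - t * f))) := by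
    linear_combination (-(t * (f * (1 - f)))) * e1
  rw [k3] at e
  linarith

/-! ### Phase space estimates -/

/-- The hypotheses on the potentials that the proof uses, in the form in which it uses them.

Of the splitting of the interaction only one bounded part is needed: Pauli densities of bounded
confinement energy have no mass at infinity, so a bounded interaction is already harmless. -/
structure VlasovAssumptions {d : ℕ} (β₀ : ℝ) (V : Pos d → ℝ) (A : Pos d → Pos d) (w : Pos d → ℝ)
    (a : ℝ) : Prop where
  dim_pos : 0 < d
  beta_pos : 0 < β₀
  memLp_neg : MemLp (fun x => max (-V x) 0) (1 + (d : ℝ≥0∞) / 2)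
  meas_pos : AEStronglyMeasurable fun x => max (V x) 0
  meas_A : AEStronglyMeasurable A
  integrable_exp : Integrable fun x => Real.exp (-β₀ * max (V x) 0)
  meas_w : AEStronglyMeasurable w
  split_w : ∃ w₁ : Pos d → ℝ, ∃ C : ℝ, MemLp w₁ (1 + (d : ℝ≥0∞) / 2) ∧ 0 ≤ C ∧
    ∀ᵐ x, |w x| ≤ |w₁ x| + C
  even_w : ∀ᵐ x : Pos d, w (-x) = w x
  a_nonneg : 0 ≤ a

/-- The kinetic energy plus the positive part of the potential. All other energies are controlled
by this nonnegative function. -/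
noncomputable def confinement {d : ℕ} (V : Pos d → ℝ) (A : Pos d → Pos d) (z : Phase d) : ℝ :=
  ‖z.2 + A z.1‖ ^ 2 + max (V z.1) 0

theorem confinement_nonneg {d : ℕ} (V : Pos d → ℝ) (A : Pos d → Pos d) (z : Phase d) :
    0 ≤ confinement V A z := by unfold confinement; positivity

/-- The gauge transformation `(x, p) ↦ (x, p + A x)` agrees almost everywhere with a
measure preserving bijection of phase space. -/
theorem exists_shear {d : ℕ} {A : Pos d → Pos d} (hA : AEStronglyMeasurable A) :
    ∃ S : Phase d ≃ᵐ Phase d, MeasurePreserving S volume volume ∧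
      ∀ᵐ z : Phase d, S z = (z.1, z.2 + A z.1) := by
  have hm : Measurable (hA.mk A) := hA.stronglyMeasurable_mk.measurable
  let S : Phase d ≃ᵐ Phase d :=
    { toFun := fun z => (z.1, z.2 + hA.mk A z.1)
      invFun := fun z => (z.1, z.2 - hA.mk A z.1)
      left_inv := fun z => by simp
      right_inv := fun z => by simp
      measurable_toFun := by
        change Measurable fun z : Phase d => (z.1, z.2 + hA.mk A z.1)
        fun_prop
      measurable_invFun := by
        change Measurable fun z : Phase d => (z.1, z.2 - hA.mk A z.1)
        fun_prop }
  refine ⟨S, ?_, ?_⟩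
  · refine (MeasurePreserving.id (volume : Measure (Pos d))).skew_product
      (g := fun x p => p + hA.mk A x) (by fun_prop) ?_
    exact Eventually.of_forall fun x => map_add_right_eq_self volume (hA.mk A x)
  · have h := Measure.quasiMeasurePreserving_fst.ae (μa := (volume : Measure (Phase d)))
      (μb := (volume : Measure (Pos d))) hA.ae_eq_mk
    filter_upwards [h] with z hz
    simp [S, hz]

/-- Gauge invariance: a function of `(x, p + A x)` is integrable iff the function without `A` is,
and the integrals agree. -/
theorem integrable_shear_iff {d : ℕ} {A : Pos d → Pos d} (hA : AEStronglyMeasurable A)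
    (f : Phase d → ℝ) :
    (Integrable (fun z : Phase d => f (z.1, z.2 + A z.1)) ↔ Integrable f) ∧
      ∫ z : Phase d, f (z.1, z.2 + A z.1) = ∫ z, f z := by
  obtain ⟨S, hS, hS'⟩ := exists_shear hA
  have he : (fun z : Phase d => f (z.1, z.2 + A z.1)) =ᵐ[volume] fun z => f (S z) := by
    filter_upwards [hS'] with z hz
    rw [hz]
  exact ⟨(integrable_congr he).trans (hS.integrable_comp_emb S.measurableEmbedding),
    (integral_congr_ae he).trans (hS.integral_comp S.measurableEmbedding f)⟩

theorem ae_fst {d : ℕ} {P : Pos d → Prop} (h : ∀ᵐ x, P x) : ∀ᵐ z : Phase d, P z.1 :=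
  Measure.quasiMeasurePreserving_fst.ae h

/-- The integral of the part of `|g|` that exceeds `δ |p|²` is a multiple of `∫ |g|^{1+d/2}`. It
is for this identity that the exponent `1 + d/2` is needed, and it takes the place of the
Lieb-Thirring inequality `∫ ρ_m^{1+2/d} ≤ C ∬ |p|² m`. -/
theorem integrable_excess {d : ℕ} (hd : 0 < d) {A : Pos d → Pos d}
    (hA : AEStronglyMeasurable A) {g : Pos d → ℝ} (hg : MemLp g (1 + (d : ℝ≥0∞) / 2))
    {δ : ℝ} (hδ : 0 < δ) :
    Integrable (fun z : Phase d =>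
      if δ * ‖z.2 + A z.1‖ ^ 2 < |g z.1| then |g z.1| else 0) ∧
    ∫ z : Phase d, (if δ * ‖z.2 + A z.1‖ ^ 2 < |g z.1| then |g z.1| else 0)
      = δ⁻¹ ^ ((d : ℝ) / 2) * volume.real (Metric.ball (0 : Pos d) 1)
        * ∫ x, |g x| ^ (1 + (d : ℝ) / 2) := by
  have : Nonempty (Fin d) := ⟨⟨0, hd⟩⟩
  set f : Phase d → ℝ := fun z => if δ * ‖z.2‖ ^ 2 < |g z.1| then |g z.1| else 0 with hf
  have hq : (1 + (d : ℝ≥0∞) / 2).toReal = 1 + (d : ℝ) / 2 := by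
    rw [ENNReal.toReal_add (by simp) (by finiteness)]; simp
  have hgi : Integrable fun x => |g x| ^ (1 + (d : ℝ) / 2) := by
    have := hg.integrable_norm_rpow (by simp) (by finiteness)
    rw [hq] at this
    simpa using this
  have hball : ∀ x, {p : Pos d | δ * ‖p‖ ^ 2 < |g x|}
      = Metric.ball (0 : Pos d) (Real.sqrt (|g x| / δ)) := by
    intro x
    ext p
    simp only [mem_ofPred_eq, mem_ball_zero_iff]
    rw [Real.lt_sqrt (norm_nonneg _), lt_div_iff₀' hδ]
  have hfi : ∀ x, (fun p : Pos d => f (x, p))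
      = (Metric.ball (0 : Pos d) (Real.sqrt (|g x| / δ))).indicator fun _ => |g x| := by
    intro x
    rw [← hball]
    ext p
    simp [hf, indicator_apply]
  have hint : ∀ x, ∫ p : Pos d, f (x, p) = δ⁻¹ ^ ((d : ℝ) / 2)
      * volume.real (Metric.ball (0 : Pos d) 1) * |g x| ^ (1 + (d : ℝ) / 2) := by
    intro x
    rw [hfi, integral_indicator_const _ Metric.isOpen_ball.measurableSet, measureReal_def,
      Measure.addHaar_ball _ _ (Real.sqrt_nonneg _), ENNReal.toReal_mul,
      ENNReal.toReal_ofReal (by positivity), finrank_euclideanSpace_fin, smul_eq_mul,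
      ← measureReal_def, Real.sqrt_eq_rpow, ← Real.rpow_natCast, ← Real.rpow_mul (by positivity),
      div_eq_mul_inv, Real.mul_rpow (by positivity) (by positivity),
      Real.rpow_add' (by positivity) (by positivity), Real.rpow_one,
      show (1 / 2 * (d : ℝ)) = d / 2 by ring]
    ring
  have hmeas : AEStronglyMeasurable f := by
    have h1 : AEMeasurable (fun z : Phase d => g z.1) :=
      (hg.aestronglyMeasurable.aemeasurable).comp_quasiMeasurePreserving
        Measure.quasiMeasurePreserving_fst
    have h2 : Measurable fun u : ℝ × ℝ => if δ * u.2 ^ 2 < |u.1| then |u.1| else 0 := by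
      refine Measurable.ite (measurableSet_lt (by fun_prop) (by fun_prop)) (by fun_prop)
        measurable_const
    exact (h2.comp_aemeasurable (h1.prodMk
      (measurable_snd.norm.aemeasurable))).aestronglyMeasurable
  have hfint : Integrable f := by
    refine (integrable_prod_iff hmeas).2 ⟨Eventually.of_forall fun x => ?_, ?_⟩
    · rw [hfi]
      exact (integrable_indicator_iff Metric.isOpen_ball.measurableSet).2
        (integrableOn_const measure_ball_lt_top.ne)
    · have : (fun x => ∫ p : Pos d, ‖f (x, p)‖) = fun x => δ⁻¹ ^ ((d : ℝ) / 2)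
          * volume.real (Metric.ball (0 : Pos d) 1) * |g x| ^ (1 + (d : ℝ) / 2) := by
        ext x
        rw [← hint]
        refine integral_congr_ae (Eventually.of_forall fun p => ?_)
        simp only [hf]
        split_ifs <;> simp
      rw [this]
      exact hgi.const_mul _
  have hs := integrable_shear_iff hA f
  refine ⟨hs.1.2 hfint, hs.2.trans ?_⟩
  rw [Measure.volume_eq_prod, integral_prod _ (by rwa [← Measure.volume_eq_prod])]
  simp_rw [hint]
  rw [integral_const_mul]

namespace VlasovAssumptions

variable {d : ℕ} {β₀ : ℝ} {V : Pos d → ℝ} {A : Pos d → Pos d} {w : Pos d → ℝ} {a : ℝ}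

theorem aestronglyMeasurable_V (H : VlasovAssumptions β₀ V A w a) : AEStronglyMeasurable V := by
  have : V = fun x => max (V x) 0 - max (-V x) 0 := by
    ext x; rcases le_total 0 (V x) with h | h <;> simp [h]
  rw [this]
  exact H.meas_pos.sub H.memLp_neg.1

theorem aestronglyMeasurable_kinetic (H : VlasovAssumptions β₀ V A w a) :
    AEStronglyMeasurable fun z : Phase d => ‖z.2 + A z.1‖ ^ 2 := by
  have h1 : AEStronglyMeasurable fun z : Phase d => A z.1 :=
    H.meas_A.comp_quasiMeasurePreserving Measure.quasiMeasurePreserving_fst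
  exact ((measurable_snd.aestronglyMeasurable.add h1).norm.pow 2)

theorem aestronglyMeasurable_confinement (H : VlasovAssumptions β₀ V A w a) :
    AEStronglyMeasurable (confinement V A) :=
  H.aestronglyMeasurable_kinetic.add
    (H.meas_pos.comp_quasiMeasurePreserving Measure.quasiMeasurePreserving_fst)

theorem integrable_exp_confinement (H : VlasovAssumptions β₀ V A w a) :
    Integrable fun z : Phase d => Real.exp (-β₀ * confinement V A z) := by
  have h1 : Integrable fun p : Pos d => Real.exp (-β₀ * ‖p‖ ^ 2) := by
    have := GaussianFourier.integrable_cexp_neg_mul_sq_norm_add (V := Pos d) (b := (β₀ : ℂ))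
      (by simpa using H.beta_pos) 0 0
    refine this.norm.congr (Eventually.of_forall fun p => ?_)
    simp only [Complex.norm_exp]
    congr 1
    norm_num [← Complex.ofReal_pow, ← Complex.ofReal_mul, ← Complex.ofReal_neg]
  have h2 := H.integrable_exp.mul_prod h1
  refine ((integrable_shear_iff H.meas_A _).1.2 h2).congr (Eventually.of_forall fun z => ?_)
  simp only [confinement, ← Real.exp_add]
  congr 1
  ring

/-- The sublevel sets of the confinement have finite volume. -/
theorem integrable_sublevel (H : VlasovAssumptions β₀ V A w a) (R : ℝ) :
    Integrable fun z : Phase d => if confinement V A z ≤ R then (1 : ℝ) else 0 := by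
  refine (H.integrable_exp_confinement.const_mul (Real.exp (β₀ * R))).mono' ?_ ?_
  · exact ((Measurable.ite measurableSet_Iic measurable_const measurable_const).comp_aemeasurable
      H.aestronglyMeasurable_confinement.aemeasurable).aestronglyMeasurable
  · refine Eventually.of_forall fun z => ?_
    split_ifs with h
    · rw [← Real.exp_add, norm_one]
      refine Real.one_le_exp ?_
      nlinarith [H.beta_pos]
    · simp; positivity

end VlasovAssumptions

/-- The semiclassical constant `(2π)^{-d}`. -/
notation "κ[" d "]" => (((2 : ℝ) * Real.pi) ^ d)⁻¹

theorem semiclassical_pos (d : ℕ) : 0 < κ[d] := by positivity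

/-- `h` is infinitesimally small relative to `T`, up to integrable functions. For functions `m` with
`0 ≤ m ≤ 1`, an integrable function has a finite integral against `m`, so that `∫ h m` is then
controlled by an arbitrarily small multiple of `∫ T m`. -/
def FormSmall {α : Type*} [MeasurableSpace α] (ν : Measure α) (T h : α → ℝ) : Prop :=
  AEStronglyMeasurable h ν ∧
    ∀ δ : ℝ, 0 < δ → ∃ k, Integrable k ν ∧ ∀ᵐ z ∂ν, |h z| ≤ δ * T z + k z

theorem FormSmall.integrable_mul {α : Type*} [MeasurableSpace α] {ν : Measure α} {T h m : α → ℝ}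
    (hh : FormSmall ν T h) (hm : AEStronglyMeasurable m ν) (h01 : ∀ᵐ z ∂ν, 0 ≤ m z ∧ m z ≤ 1)
    (hT : Integrable (fun z => T z * m z) ν) : Integrable (fun z => h z * m z) ν := by
  obtain ⟨k, hk, hle⟩ := hh.2 1 one_pos
  refine (hT.add hk.norm).mono' (hh.1.mul hm) ?_
  filter_upwards [hle, h01] with z h1 h2
  rw [norm_mul, Real.norm_eq_abs, Real.norm_eq_abs, abs_of_nonneg h2.1]
  have : |h z| * m z ≤ (1 * T z + k z) * m z := by gcongr; exact h2.1
  have h3 : k z * m z ≤ |k z| := by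
    have := mul_le_mul (le_abs_self (k z)) h2.2 h2.1 (abs_nonneg _)
    simpa using this
  simp only [Pi.add_apply, Real.norm_eq_abs]
  linarith

theorem FormSmall.of_bound {α : Type*} [MeasurableSpace α] {ν : Measure α} {T h : α → ℝ}
    (h1 : FormSmall ν T fun _ => (1 : ℝ)) (hm : AEStronglyMeasurable h ν) {C : ℝ}
    (hle : ∀ᵐ z ∂ν, |h z| ≤ C) : FormSmall ν T h := by
  refine ⟨hm, fun δ hδ => ?_⟩
  obtain ⟨k, hk, hle'⟩ := h1.2 (δ / (|C| + 1)) (by positivity)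
  refine ⟨fun z => (|C| + 1) * k z, hk.const_mul _, ?_⟩
  filter_upwards [hle, hle'] with z a1 a2
  rw [abs_one] at a2
  calc |h z| ≤ (|C| + 1) * 1 := by linarith [le_abs_self C]
    _ ≤ (|C| + 1) * (δ / (|C| + 1) * T z + k z) := by gcongr
    _ = _ := by field_simp

theorem le_confinement_add {d : ℕ} (V : Pos d → ℝ) (A : Pos d → Pos d) {δ C : ℝ} (hδ : 0 < δ)
    (z : Phase d) :
    C ≤ δ * confinement V A z + C * (if confinement V A z ≤ C / δ then (1 : ℝ) else 0) := by
  have := confinement_nonneg V A z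
  split_ifs with h
  · have : 0 ≤ δ * confinement V A z := by positivity
    linarith
  · rw [not_le, div_lt_iff₀ hδ] at h
    linarith

theorem le_confinement_add_excess {d : ℕ} (V : Pos d → ℝ) (A : Pos d → Pos d) {δ : ℝ}
    (hδ : 0 < δ) (g : ℝ) (z : Phase d) :
    |g| ≤ δ * confinement V A z + (if δ * ‖z.2 + A z.1‖ ^ 2 < |g| then |g| else 0) := by
  have h0 := confinement_nonneg V A z
  split_ifs with h
  · have : 0 ≤ δ * confinement V A z := by positivity
    linarith
  · have : δ * ‖z.2 + A z.1‖ ^ 2 ≤ δ * confinement V A z := by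
      unfold confinement
      gcongr
      simp
    linarith

namespace VlasovAssumptions

variable {d : ℕ} {β₀ : ℝ} {V : Pos d → ℝ} {A : Pos d → Pos d} {w : Pos d → ℝ} {a : ℝ}

/-- The sublevel sets of the confinement have arbitrarily large volume. -/
theorem exists_sublevel_mass (H : VlasovAssumptions β₀ V A w a) (M : ℝ) :
    ∃ R, M ≤ ∫ z : Phase d, if confinement V A z ≤ R then (1 : ℝ) else 0 := by
  have hd := H.dim_pos
  have : Nonempty (Fin d) := ⟨⟨0, hd⟩⟩
  have hmono : Monotone fun n : ℕ => {z : Phase d | confinement V A z ≤ n} :=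
    fun n k hnk z hz => by
      have hz' : confinement V A z ≤ n := hz
      exact hz'.trans (by exact_mod_cast hnk : (n : ℝ) ≤ k)
  have hU : ⋃ n : ℕ, {z : Phase d | confinement V A z ≤ n} = univ :=
    eq_univ_of_forall fun z => mem_iUnion.2 (exists_nat_ge (confinement V A z))
  have ht := tendsto_measure_iUnion_atTop (μ := (volume : Measure (Phase d))) hmono
  rw [hU, show (volume : Measure (Phase d)) univ = ⊤ by
    rw [Measure.volume_eq_prod, ← univ_prod_univ, Measure.prod_prod]; simp] at ht
  have hev := ht.eventually (lt_mem_nhds (ENNReal.ofReal_lt_top (r := M)))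
  obtain ⟨n, hn⟩ := hev.exists
  refine ⟨n, ?_⟩
  have hnull : NullMeasurableSet {z : Phase d | confinement V A z ≤ n} :=
    nullMeasurableSet_le H.aestronglyMeasurable_confinement.aemeasurable aemeasurable_const
  have hi := H.integrable_sublevel n
  have he : (fun z : Phase d => if confinement V A z ≤ n then (1 : ℝ) else 0)
      = indicator {z : Phase d | confinement V A z ≤ n} fun _ => (1 : ℝ) := by
    ext z; simp [indicator_apply]
  have hne : volume {z : Phase d | confinement V A z ≤ n} ≠ ⊤ := by
    refine ne_top_of_le_ne_top (hi.measure_norm_ge_lt_top one_pos).ne (measure_mono fun z hz => ?_)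
    have hz' : confinement V A z ≤ n := hz
    simp [hz']
  rw [he]
  rw [integral_indicator₀ hnull, setIntegral_const, smul_eq_mul, mul_one, measureReal_def]
  exact (ENNReal.ofReal_le_iff_le_toReal hne).1 hn.le

theorem formSmall_one (H : VlasovAssumptions β₀ V A w a) :
    FormSmall volume (confinement V A) fun _ => (1 : ℝ) := by
  refine ⟨aestronglyMeasurable_const, fun δ hδ => ⟨_, H.integrable_sublevel (1 / δ),
    Eventually.of_forall fun z => ?_⟩⟩
  simpa using le_confinement_add V A (C := 1) hδ z

theorem formSmall_neg (H : VlasovAssumptions β₀ V A w a) :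
    FormSmall volume (confinement V A) fun z => max (-V z.1) 0 := by
  refine ⟨H.memLp_neg.1.comp_quasiMeasurePreserving Measure.quasiMeasurePreserving_fst,
    fun δ hδ => ⟨_, (integrable_excess H.dim_pos H.meas_A H.memLp_neg hδ).1,
      Eventually.of_forall fun z => ?_⟩⟩
  exact le_confinement_add_excess V A hδ _ z

/-- The interaction potential seen from any point is infinitesimally small relative to the
confinement, uniformly in the point. -/
theorem exists_translate_bound (H : VlasovAssumptions β₀ V A w a) {δ : ℝ} (hδ : 0 < δ) :
    ∃ C : ℝ, ∀ x : Pos d, ∃ k : Phase d → ℝ, Integrable k ∧ (∀ z, 0 ≤ k z) ∧ ∫ z, k z ≤ C ∧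
      ∀ᵐ z : Phase d, |w (x - z.1)| ≤ δ * confinement V A z + k z := by
  obtain ⟨w₁, C, hw₁, hC, hle⟩ := H.split_w
  have hδ2 : 0 < δ / 2 := by positivity
  refine ⟨(δ / 2)⁻¹ ^ ((d : ℝ) / 2) * volume.real (Metric.ball (0 : Pos d) 1)
        * (∫ x, |w₁ x| ^ (1 + (d : ℝ) / 2))
      + C * ∫ z : Phase d, (if confinement V A z ≤ C / (δ / 2) then (1 : ℝ) else 0), fun x => ?_⟩
  have hmp := Measure.measurePreserving_sub_left (volume : Measure (Pos d)) x
  obtain ⟨e1, e2⟩ := integrable_excess H.dim_pos H.meas_A (hw₁.comp_measurePreserving hmp) hδ2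
  rw [show (∫ y, |(w₁ ∘ fun t => x - t) y| ^ (1 + (d : ℝ) / 2))
      = ∫ x, |w₁ x| ^ (1 + (d : ℝ) / 2) from
      integral_sub_left_eq_self (fun y => |w₁ y| ^ (1 + (d : ℝ) / 2)) volume x] at e2
  have e3 := (H.integrable_sublevel (C / (δ / 2))).const_mul C
  refine ⟨_, e1.add e3, fun z => ?_, le_of_eq ?_, ?_⟩
  · refine add_nonneg ?_ (mul_nonneg hC ?_) <;> beta_reduce <;> split_ifs <;> simp
  · rw [integral_add' e1 e3, e2, integral_const_mul]
  · filter_upwards [ae_fst (hmp.quasiMeasurePreserving.ae hle)] with z hz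
    have i1 := le_confinement_add_excess V A hδ2 (w₁ (x - z.1)) z
    have i2 := le_confinement_add V A (C := C) hδ2 z
    simp only [Pi.add_apply, Function.comp_apply]
    linarith

theorem aestronglyMeasurable_translate (H : VlasovAssumptions β₀ V A w a) (x : Pos d) :
    AEStronglyMeasurable fun y => w (x - y) :=
  H.meas_w.comp_quasiMeasurePreserving
    (Measure.measurePreserving_sub_left volume x).quasiMeasurePreserving

theorem formSmall_translate (H : VlasovAssumptions β₀ V A w a) (x : Pos d) :
    FormSmall volume (confinement V A) fun z => w (x - z.1) := by
  refine ⟨(H.aestronglyMeasurable_translate x).comp_quasiMeasurePreserving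
    Measure.quasiMeasurePreserving_fst, fun δ hδ => ?_⟩
  obtain ⟨C, hC⟩ := H.exists_translate_bound hδ
  obtain ⟨k, hk, -, -, hle⟩ := hC x
  exact ⟨k, hk, hle⟩

end VlasovAssumptions

/-! ### Densities with finite confinement energy -/

/-- Pauli densities with finite kinetic energy and finite energy in the positive part of the
potential. -/
structure Confined {d : ℕ} (V : Pos d → ℝ) (A : Pos d → Pos d) (m : Phase d → ℝ) : Prop where
  pauli : IsPauliDensity m
  conf : Integrable fun z => confinement V A z * m z

theorem integrable_mul_spatialDensity {d : ℕ} {m : Phase d → ℝ} {g : Pos d → ℝ}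
    (h : Integrable fun z : Phase d => g z.1 * m z) :
    Integrable (fun x => g x * spatialDensity m x) ∧
      ∫ x, g x * spatialDensity m x = κ[d] * ∫ z : Phase d, g z.1 * m z := by
  rw [Measure.volume_eq_prod] at h
  have he : (fun x => g x * spatialDensity m x)
      = fun x => κ[d] * ∫ p, g x * m (x, p) := by
    ext x
    rw [integral_const_mul, spatialDensity]
    ring
  rw [he, integral_const_mul, Measure.volume_eq_prod, integral_prod _ h]
  exact ⟨h.integral_prod_left.const_mul _, rfl⟩

theorem IsPauliDensity.spatialDensity_nonneg {d : ℕ} {m : Phase d → ℝ} (hm : IsPauliDensity m) :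
    ∀ᵐ x, 0 ≤ spatialDensity m x := by
  have h := hm.2
  rw [Measure.volume_eq_prod] at h
  filter_upwards [Measure.ae_ae_of_ae_prod h] with x hx
  exact mul_nonneg (semiclassical_pos d).le (integral_nonneg_of_ae (hx.mono fun p hp => hp.1))

theorem IsPauliDensity.integrable_spatialDensity {d : ℕ} {m : Phase d → ℝ}
    (hm : IsPauliDensity m) : Integrable (spatialDensity m) ∧
      ∫ x, spatialDensity m x = κ[d] * ∫ z : Phase d, m z := by
  have := integrable_mul_spatialDensity (m := m) (g := fun _ => 1) (by simpa using hm.1)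
  simpa using this

theorem spatialDensity_linear {d : ℕ} {m₁ m₂ : Phase d → ℝ} (h₁ : Integrable m₁)
    (h₂ : Integrable m₂) (s t : ℝ) :
    ∀ᵐ x, spatialDensity (fun z => s * m₁ z + t * m₂ z) x
      = s * spatialDensity m₁ x + t * spatialDensity m₂ x := by
  rw [Measure.volume_eq_prod] at h₁ h₂
  filter_upwards [h₁.prod_right_ae, h₂.prod_right_ae] with x i1 i2
  simp only [spatialDensity]
  rw [integral_add (i1.const_mul s) (i2.const_mul t), integral_const_mul, integral_const_mul]
  ring

theorem Confined.integrable_mul {d : ℕ} {V : Pos d → ℝ} {A : Pos d → Pos d} {m : Phase d → ℝ}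
    (hm : Confined V A m) {h : Phase d → ℝ} (hh : FormSmall volume (confinement V A) h) :
    Integrable fun z => h z * m z :=
  hh.integrable_mul hm.pauli.1.1 hm.pauli.2 hm.conf

theorem Confined.nonneg_integral {d : ℕ} {V : Pos d → ℝ} {A : Pos d → Pos d} {m : Phase d → ℝ}
    (hm : Confined V A m) : 0 ≤ ∫ z, confinement V A z * m z :=
  integral_nonneg_of_ae (hm.pauli.2.mono fun z hz => mul_nonneg (confinement_nonneg V A z) hz.1)

theorem IsPauliDensity.convex {d : ℕ} {m₁ m₂ : Phase d → ℝ} (h₁ : IsPauliDensity m₁)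
    (h₂ : IsPauliDensity m₂) {t : ℝ} (h0 : 0 ≤ t) (h1 : t ≤ 1) :
    IsPauliDensity fun z => t * m₁ z + (1 - t) * m₂ z := by
  refine ⟨(h₁.1.const_mul t).add (h₂.1.const_mul _), ?_⟩
  filter_upwards [h₁.2, h₂.2] with z a1 a2
  have : 0 ≤ 1 - t := by linarith
  constructor
  · nlinarith [mul_nonneg h0 a1.1, mul_nonneg this a2.1]
  · nlinarith [mul_le_mul_of_nonneg_left a1.2 h0, mul_le_mul_of_nonneg_left a2.2 this]

theorem IsAdmissible.convex {d : ℕ} {m₁ m₂ : Phase d → ℝ} {r₁ r₂ : ℝ} (h₁ : IsAdmissible r₁ m₁)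
    (h₂ : IsAdmissible r₂ m₂) {t : ℝ} (h0 : 0 ≤ t) (h1 : t ≤ 1) :
    IsAdmissible (t * r₁ + (1 - t) * r₂) fun z => t * m₁ z + (1 - t) * m₂ z := by
  refine ⟨h₁.1.convex h₂.1 h0 h1, ?_⟩
  rw [integral_add (h₁.1.1.const_mul t) (h₂.1.1.const_mul _), integral_const_mul,
    integral_const_mul]
  linear_combination t * h₁.2 + (1 - t) * h₂.2

theorem Confined.convex {d : ℕ} {V : Pos d → ℝ} {A : Pos d → Pos d} {m₁ m₂ : Phase d → ℝ}
    (h₁ : Confined V A m₁) (h₂ : Confined V A m₂) {t : ℝ} (h0 : 0 ≤ t) (h1 : t ≤ 1) :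
    Confined V A fun z => t * m₁ z + (1 - t) * m₂ z := by
  refine ⟨h₁.pauli.convex h₂.pauli h0 h1, ?_⟩
  refine ((h₁.conf.const_mul t).add (h₂.conf.const_mul (1 - t))).congr
    (Eventually.of_forall fun z => ?_)
  simp only [Pi.add_apply]; ring

namespace VlasovAssumptions

variable {d : ℕ} {β₀ : ℝ} {V : Pos d → ℝ} {A : Pos d → Pos d} {w : Pos d → ℝ} {a : ℝ}
  {m : Phase d → ℝ}

theorem energy_eq (V : Pos d → ℝ) (A : Pos d → Pos d) (z : Phase d) :
    ‖z.2 + A z.1‖ ^ 2 + V z.1 = confinement V A z - max (-V z.1) 0 := by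
  unfold confinement
  rcases le_total 0 (V z.1) with h | h <;> simp [h]

theorem integrable_potential (H : VlasovAssumptions β₀ V A w a) (hm : Confined V A m) :
    Integrable fun z : Phase d => (‖z.2 + A z.1‖ ^ 2 + V z.1) * m z := by
  refine (hm.conf.sub (hm.integrable_mul H.formSmall_neg)).congr
    (Eventually.of_forall fun z => ?_)
  simp only [energy_eq, Pi.sub_apply]; ring

theorem confined_of_integrable (H : VlasovAssumptions β₀ V A w a) (hm : IsPauliDensity m)
    (hi : Integrable fun z : Phase d => (‖z.2 + A z.1‖ ^ 2 + V z.1) * m z) : Confined V A m := by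
  refine ⟨hm, ?_⟩
  obtain ⟨k, hk, hle⟩ := H.formSmall_neg.2 (1 / 2) (by norm_num)
  refine ((hi.norm.const_mul 2).add (hk.norm.const_mul 2)).mono'
    (H.aestronglyMeasurable_confinement.mul hm.1.1) ?_
  filter_upwards [hle, hm.2] with z h1 h2
  have hT := confinement_nonneg V A z
  simp only [Pi.add_apply, Real.norm_eq_abs, energy_eq]
  rw [abs_of_nonneg (mul_nonneg hT h2.1)]
  have i1 := le_abs_self ((confinement V A z - max (-V z.1) 0) * m z)
  have i2 : max (-V z.1) 0 * m z ≤ (1 / 2 * confinement V A z + |k z|) * m z :=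
    mul_le_mul_of_nonneg_right
      ((le_abs_self _).trans (h1.trans (by linarith [le_abs_self (k z)]))) h2.1
  have i3 : |k z| * m z ≤ |k z| := mul_le_of_le_one_right (abs_nonneg _) h2.2
  nlinarith

theorem integrable_fermiEntropy (H : VlasovAssumptions β₀ V A w a) (hm : Confined V A m) :
    Integrable fun z => fermiEntropy (m z) := by
  refine ((hm.conf.const_mul β₀).add H.integrable_exp_confinement).mono'
    (continuous_fermiEntropy.comp_aestronglyMeasurable hm.pauli.1.1) ?_
  filter_upwards [hm.pauli.2] with z h
  have hb := H.beta_pos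
  have h1 := neg_exp_le_energy hb (confinement V A z) h.1 h.2
  have h2 := mul_le_mul_of_nonneg_left h1 hb.le
  rw [Real.norm_eq_abs, abs_of_nonpos (fermiEntropy_nonpos h.1 h.2)]
  simp only [Pi.add_apply]
  rw [mul_neg, mul_add, mul_inv_cancel_left₀ hb.ne', mul_inv_cancel_left₀ hb.ne'] at h2
  linarith

theorem integrable_translate_mul (H : VlasovAssumptions β₀ V A w a) (hm : Confined V A m)
    (x : Pos d) : Integrable fun y => w (x - y) * spatialDensity m y :=
  (integrable_mul_spatialDensity (g := fun y => w (x - y))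
    (hm.integrable_mul (H.formSmall_translate x))).1

theorem integral_translate_mul (H : VlasovAssumptions β₀ V A w a) (hm : Confined V A m)
    (x : Pos d) : ∫ y, w (x - y) * spatialDensity m y
      = κ[d] * ∫ z : Phase d, w (x - z.1) * m z :=
  (integrable_mul_spatialDensity (g := fun y => w (x - y))
    (hm.integrable_mul (H.formSmall_translate x))).2

/-- The interaction potential generated by a confined density is bounded, by an arbitrarily small
multiple of the confinement energy plus a universal constant. -/
theorem exists_convolution_bound (H : VlasovAssumptions β₀ V A w a) {δ : ℝ} (hδ : 0 < δ) :
    ∃ C : ℝ, 0 ≤ C ∧ ∀ m : Phase d → ℝ, Confined V A m → ∀ x : Pos d,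
      ∫ y, |w (x - y) * spatialDensity m y|
        ≤ κ[d] * (δ * (∫ z, confinement V A z * m z) + C) := by
  obtain ⟨C, hC⟩ := H.exists_translate_bound hδ
  refine ⟨C, ?_, fun m hm x => ?_⟩
  · obtain ⟨k, -, hk0, hkC, -⟩ := hC 0
    exact (integral_nonneg hk0).trans hkC
  obtain ⟨k, hk, hk0, hkC, hle⟩ := hC x
  have hi := hm.integrable_mul (H.formSmall_translate x)
  have hi' : Integrable fun z : Phase d => |w (x - z.1)| * m z := by
    refine hi.norm.congr ?_
    filter_upwards [hm.pauli.2] with z hz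
    rw [norm_mul, Real.norm_eq_abs, Real.norm_eq_abs, abs_of_nonneg hz.1]
  have he : ∫ y, |w (x - y) * spatialDensity m y| = ∫ y, |w (x - y)| * spatialDensity m y := by
    refine integral_congr_ae ?_
    filter_upwards [hm.pauli.spatialDensity_nonneg] with y hy
    rw [abs_mul, abs_of_nonneg hy]
  rw [he, (integrable_mul_spatialDensity (g := fun y => |w (x - y)|) hi').2]
  refine mul_le_mul_of_nonneg_left ?_ (semiclassical_pos d).le
  calc ∫ z : Phase d, |w (x - z.1)| * m z
      ≤ ∫ z : Phase d, (δ * (confinement V A z * m z) + k z) := by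
        refine integral_mono_ae hi' ((hm.conf.const_mul δ).add hk) ?_
        filter_upwards [hle, hm.pauli.2] with z h1 h2
        have i1 : |w (x - z.1)| * m z ≤ (δ * confinement V A z + k z) * m z :=
          mul_le_mul_of_nonneg_right h1 h2.1
        have i2 : k z * m z ≤ k z := mul_le_of_le_one_right (hk0 z) h2.2
        nlinarith
    _ = δ * (∫ z, confinement V A z * m z) + ∫ z, k z := by
        rw [integral_add (hm.conf.const_mul δ) hk, integral_const_mul]
    _ ≤ _ := by linarith

end VlasovAssumptions

/-! ### The interaction as a bilinear form -/

/-- Densities on which the interaction is a well defined quadratic form: integrable functions that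
generate a bounded potential. -/
structure GoodDensity {d : ℕ} (w : Pos d → ℝ) (a : ℝ) (f : Pos d → ℝ) : Prop where
  integrable : Integrable f
  bounded : ∃ C : ℝ, ∀ x, Integrable (fun y => w (x - y) * f y) ∧ ∫ y, |w (x - y) * f y| ≤ C
  sq : Integrable fun x => a * f x ^ 2

/-- The bilinear form `∬ (w + a δ₀)(x - y) f(x) g(y)`. -/
noncomputable def interactionForm {d : ℕ} (w : Pos d → ℝ) (a : ℝ) (f g : Pos d → ℝ) : ℝ :=
  (∫ z : Pos d × Pos d, w (z.1 - z.2) * f z.1 * g z.2) + ∫ x : Pos d, a * (f x * g x)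

theorem interactionIntegral_eq_form {d : ℕ} (w : Pos d → ℝ) (a : ℝ) (f : Pos d → ℝ) :
    interactionIntegral w a f = interactionForm w a f f := by
  simp only [interactionIntegral, interactionForm, sq]

theorem interactionForm_congr {d : ℕ} (w : Pos d → ℝ) (a : ℝ) {f f' g g' : Pos d → ℝ}
    (hf : f =ᵐ[volume] f') (hg : g =ᵐ[volume] g') :
    interactionForm w a f g = interactionForm w a f' g' := by
  have h1 : ∀ᵐ z : Pos d × Pos d, f z.1 = f' z.1 := Measure.quasiMeasurePreserving_fst.ae hf
  have h2 : ∀ᵐ z : Pos d × Pos d, g z.2 = g' z.2 := Measure.quasiMeasurePreserving_snd.ae hg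
  unfold interactionForm
  congr 1
  · refine integral_congr_ae ?_
    filter_upwards [h1, h2] with z e1 e2
    rw [e1, e2]
  · refine integral_congr_ae ?_
    filter_upwards [hf, hg] with z e1 e2
    rw [e1, e2]

namespace GoodDensity

variable {d : ℕ} {w : Pos d → ℝ} {a : ℝ} {f g : Pos d → ℝ}

theorem integrable_mul (ha : 0 ≤ a) (hf : GoodDensity w a f) (hg : GoodDensity w a g) :
    Integrable fun x => a * (f x * g x) := by
  refine (hf.sq.add hg.sq).mono' ((hf.integrable.1.mul hg.integrable.1).const_mul a)
    (Eventually.of_forall fun x => ?_)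
  simp only [Pi.add_apply]
  rw [norm_mul, Real.norm_eq_abs, Real.norm_eq_abs, abs_of_nonneg ha, ← mul_add]
  refine mul_le_mul_of_nonneg_left ?_ ha
  rw [abs_le]
  constructor <;> nlinarith [sq_nonneg (f x + g x), sq_nonneg (f x - g x)]

theorem linear (ha : 0 ≤ a) (hf : GoodDensity w a f) (hg : GoodDensity w a g) (s t : ℝ) :
    GoodDensity w a fun x => s * f x + t * g x := by
  obtain ⟨C, hC⟩ := hf.bounded
  obtain ⟨D, hD⟩ := hg.bounded
  refine ⟨(hf.integrable.const_mul s).add (hg.integrable.const_mul t),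
    ⟨|s| * C + |t| * D, fun x => ?_⟩, ?_⟩
  · have he : (fun y => w (x - y) * (s * f y + t * g y))
        = fun y => s * (w (x - y) * f y) + t * (w (x - y) * g y) := by
      ext y; ring
    have i1 := (hC x).1.const_mul s
    have i2 := (hD x).1.const_mul t
    refine ⟨by rw [he]; exact i1.add i2, ?_⟩
    calc ∫ y, |w (x - y) * (s * f y + t * g y)|
        ≤ ∫ y, (|s| * |w (x - y) * f y| + |t| * |w (x - y) * g y|) := by
          refine integral_mono_of_nonneg (Eventually.of_forall fun y => abs_nonneg _)
            (((hC x).1.abs.const_mul _).add ((hD x).1.abs.const_mul _))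
            (Eventually.of_forall fun y => ?_)
          beta_reduce
          rw [← abs_mul, ← abs_mul]
          refine le_trans (le_of_eq ?_) (abs_add_le _ _)
          congr 1; ring
      _ = |s| * (∫ y, |w (x - y) * f y|) + |t| * ∫ y, |w (x - y) * g y| := by
          rw [integral_add ((hC x).1.abs.const_mul _) ((hD x).1.abs.const_mul _),
            integral_const_mul, integral_const_mul]
      _ ≤ _ := by gcongr; exacts [(hC x).2, (hD x).2]
  · have := ((hf.sq.const_mul (s ^ 2)).add (hg.sq.const_mul (t ^ 2))).add
      ((hf.integrable_mul ha hg).const_mul (2 * s * t))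
    refine this.congr (Eventually.of_forall fun x => ?_)
    simp only [Pi.add_apply]; ring

theorem aestronglyMeasurable_kernel (hw : AEStronglyMeasurable w) (hf : AEStronglyMeasurable f)
    (hg : AEStronglyMeasurable g) :
    AEStronglyMeasurable (fun z : Pos d × Pos d => w (z.1 - z.2) * f z.1 * g z.2)
      (volume.prod volume) :=
  ((hw.comp_quasiMeasurePreserving
    (quasiMeasurePreserving_sub_of_right_invariant volume volume)).mul
      hf.comp_fst).mul hg.comp_snd

theorem integrable_kernel (hw : AEStronglyMeasurable w) (hf : GoodDensity w a f)
    (hg : GoodDensity w a g) :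
    Integrable fun z : Pos d × Pos d => w (z.1 - z.2) * f z.1 * g z.2 := by
  obtain ⟨C, hC⟩ := hg.bounded
  have hm := aestronglyMeasurable_kernel hw hf.integrable.1 hg.integrable.1
  have he : ∀ x y, w (x - y) * f x * g y = f x * (w (x - y) * g y) := fun x y => by ring
  refine (integrable_prod_iff hm).2 ⟨Eventually.of_forall fun x => ?_, ?_⟩
  · simp only [he]
    exact (hC x).1.const_mul _
  · refine (hf.integrable.norm.const_mul C).mono' hm.norm.integral_prod_right'
      (Eventually.of_forall fun x => ?_)
    simp only [he, norm_mul (f x)]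
    rw [integral_const_mul, norm_mul, norm_norm, mul_comm, Real.norm_of_nonneg
      (integral_nonneg fun _ => norm_nonneg _)]
    exact mul_le_mul_of_nonneg_right (hC x).2 (norm_nonneg _)

theorem integral_kernel (hw : AEStronglyMeasurable w) (hf : GoodDensity w a f)
    (hg : GoodDensity w a g) :
    ∫ z : Pos d × Pos d, w (z.1 - z.2) * f z.1 * g z.2 = ∫ x, f x * ∫ y, w (x - y) * g y := by
  rw [Measure.volume_eq_prod, integral_prod _ (hf.integrable_kernel hw hg)]
  refine integral_congr_ae (Eventually.of_forall fun x => ?_)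
  beta_reduce
  rw [← integral_const_mul]
  refine integral_congr_ae (Eventually.of_forall fun y => ?_)
  beta_reduce
  ring

theorem aestronglyMeasurable_convolution (hw : AEStronglyMeasurable w)
    (hg : AEStronglyMeasurable g) : AEStronglyMeasurable fun x => ∫ y, w (x - y) * g y := by
  have := aestronglyMeasurable_kernel (f := fun _ => 1) hw aestronglyMeasurable_const hg
  simpa using this.integral_prod_right'

theorem integrable_mul_convolution (hw : AEStronglyMeasurable w) (hf : GoodDensity w a f)
    (hg : GoodDensity w a g) : Integrable fun x => f x * ∫ y, w (x - y) * g y := by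
  have := hf.integrable_kernel hw hg
  rw [Measure.volume_eq_prod] at this
  refine this.integral_prod_left.congr (Eventually.of_forall fun x => ?_)
  beta_reduce
  rw [← integral_const_mul]
  refine integral_congr_ae (Eventually.of_forall fun y => ?_)
  beta_reduce
  ring

/-- The interaction form is the integral of one density against the mean field of the other. -/
theorem form_eq_meanField (hw : AEStronglyMeasurable w) (ha : 0 ≤ a) (hf : GoodDensity w a f)
    (hg : GoodDensity w a g) :
    Integrable (fun x => f x * meanField w a g x) ∧
      interactionForm w a f g = ∫ x, f x * meanField w a g x := by
  have i1 := hf.integrable_mul_convolution hw hg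
  have i2 := hf.integrable_mul ha hg
  have he : (fun x => f x * meanField w a g x)
      = fun x => f x * (∫ y, w (x - y) * g y) + a * (f x * g x) := by
    ext x; simp only [meanField]; ring
  rw [he, integral_add i1 i2, interactionForm, hf.integral_kernel hw hg]
  exact ⟨i1.add i2, rfl⟩

theorem form_comm (heven : ∀ᵐ x : Pos d, w (-x) = w x) (f g : Pos d → ℝ) :
    interactionForm w a f g = interactionForm w a g f := by
  unfold interactionForm
  congr 1
  · rw [Measure.volume_eq_prod, ← integral_prod_swap]
    refine integral_congr_ae ?_
    filter_upwards [(quasiMeasurePreserving_sub_of_right_invariant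
      (volume : Measure (Pos d)) volume).ae heven] with z hz
    rw [neg_sub] at hz
    simp only [Prod.fst_swap, Prod.snd_swap, hz]
    ring
  · simp only [mul_comm (f _)]

theorem form_linear_left {h : Pos d → ℝ} (hw : AEStronglyMeasurable w) (ha : 0 ≤ a)
    (hf : GoodDensity w a f) (hg : GoodDensity w a g) (hh : GoodDensity w a h) (s t : ℝ) :
    interactionForm w a (fun x => s * f x + t * g x) h
      = s * interactionForm w a f h + t * interactionForm w a g h := by
  rw [((hf.linear ha hg s t).form_eq_meanField hw ha hh).2, (hf.form_eq_meanField hw ha hh).2,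
    (hg.form_eq_meanField hw ha hh).2, ← integral_const_mul, ← integral_const_mul,
    ← integral_add ((hf.form_eq_meanField hw ha hh).1.const_mul s)
      ((hg.form_eq_meanField hw ha hh).1.const_mul t)]
  refine integral_congr_ae (Eventually.of_forall fun x => ?_)
  beta_reduce
  ring

theorem form_quadratic (hw : AEStronglyMeasurable w) (ha : 0 ≤ a)
    (heven : ∀ᵐ x : Pos d, w (-x) = w x)
    (hf : GoodDensity w a f) (hg : GoodDensity w a g) (s t : ℝ) :
    interactionIntegral w a (fun x => s * f x + t * g x)
      = s ^ 2 * interactionIntegral w a f + 2 * s * t * interactionForm w a f g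
        + t ^ 2 * interactionIntegral w a g := by
  have hl := hf.linear ha hg s t
  simp only [interactionIntegral_eq_form]
  rw [hf.form_linear_left hw ha hg hl, form_comm heven f, form_comm heven g,
    hf.form_linear_left hw ha hg hf, hf.form_linear_left hw ha hg hg, form_comm heven g f]
  ring

theorem abs_integral_kernel_le (hw : AEStronglyMeasurable w) (hf : GoodDensity w a f)
    (hg : GoodDensity w a g) {C : ℝ} (hC : ∀ x, ∫ y, |w (x - y) * g y| ≤ C) :
    |∫ z : Pos d × Pos d, w (z.1 - z.2) * f z.1 * g z.2| ≤ C * ∫ x, |f x| := by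
  rw [hf.integral_kernel hw hg, ← integral_const_mul]
  refine (abs_integral_le_integral_abs).trans
    (integral_mono (hf.integrable_mul_convolution hw hg).abs (hf.integrable.abs.const_mul C)
      fun x => ?_)
  beta_reduce
  rw [abs_mul, mul_comm]
  exact mul_le_mul_of_nonneg_right (abs_integral_le_integral_abs.trans (hC x)) (abs_nonneg _)

end GoodDensity

/-! ### The Vlasov functional on densities of finite energy -/

/-- Densities at which the Vlasov functional is finite. The interaction with the function `w` and the
entropy need no condition, being controlled by the confinement energy. -/
structure FiniteEnergy {d : ℕ} (V : Pos d → ℝ) (A : Pos d → Pos d) (a : ℝ)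
    (m : Phase d → ℝ) : Prop extends Confined V A m where
  sq : Integrable fun x => a * spatialDensity m x ^ 2

/-- The real value of the Vlasov functional at a density of finite energy. -/
noncomputable def vlasovReal {d : ℕ} (V : Pos d → ℝ) (A : Pos d → Pos d) (w : Pos d → ℝ)
    (a β ρ' : ℝ) (m : Phase d → ℝ) : ℝ :=
  κ[d] * (∫ z : Phase d, (‖z.2 + A z.1‖ ^ 2 + V z.1) * m z)
      + (2 * ρ')⁻¹ * interactionIntegral w a (spatialDensity m)
      + ((2 * Real.pi) ^ d * β)⁻¹ * ∫ z : Phase d, fermiEntropy (m z)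

namespace VlasovAssumptions

variable {d : ℕ} {β₀ : ℝ} {V : Pos d → ℝ} {A : Pos d → Pos d} {w : Pos d → ℝ} {a : ℝ}
  {m : Phase d → ℝ}

theorem goodDensity (H : VlasovAssumptions β₀ V A w a) (hm : FiniteEnergy V A a m) :
    GoodDensity w a (spatialDensity m) := by
  obtain ⟨C, -, hC⟩ := H.exists_convolution_bound one_pos
  exact ⟨hm.pauli.integrable_spatialDensity.1,
    ⟨_, fun x => ⟨H.integrable_translate_mul hm.toConfined x, hC m hm.toConfined x⟩⟩, hm.sq⟩

theorem hasFiniteTerms_iff (H : VlasovAssumptions β₀ V A w a) (hm : IsPauliDensity m) :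
    HasFiniteTerms V A w a m ↔ FiniteEnergy V A a m := by
  constructor
  · rintro ⟨h1, -, -, h4⟩
    exact ⟨H.confined_of_integrable hm h1, h4⟩
  · intro h
    exact ⟨H.integrable_potential h.toConfined, H.integrable_fermiEntropy h.toConfined,
      (H.goodDensity h).integrable_kernel H.meas_w (H.goodDensity h), h.sq⟩

theorem vlasovEnergy_eq (H : VlasovAssumptions β₀ V A w a) (hm : FiniteEnergy V A a m)
    (β ρ' : ℝ) : vlasovEnergy V A w a β ρ' m = (vlasovReal V A w a β ρ' m : ℝ) := by
  rw [vlasovEnergy, if_pos ((H.hasFiniteTerms_iff hm.pauli).2 hm), vlasovReal]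

theorem finiteEnergy_of_lt_top (H : VlasovAssumptions β₀ V A w a) (hm : IsPauliDensity m)
    {β ρ' : ℝ} (h : vlasovEnergy V A w a β ρ' m < ⊤) : FiniteEnergy V A a m := by
  rw [← H.hasFiniteTerms_iff hm]
  by_contra hn
  rw [vlasovEnergy, if_neg hn] at h
  exact lt_irrefl _ h

theorem finiteEnergy_convex (H : VlasovAssumptions β₀ V A w a) {m₁ m₂ : Phase d → ℝ}
    (h₁ : FiniteEnergy V A a m₁) (h₂ : FiniteEnergy V A a m₂) {t : ℝ} (h0 : 0 ≤ t) (h1 : t ≤ 1) :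
    FiniteEnergy V A a fun z => t * m₁ z + (1 - t) * m₂ z := by
  refine ⟨h₁.toConfined.convex h₂.toConfined h0 h1, ?_⟩
  refine ((H.goodDensity h₁).linear H.a_nonneg (H.goodDensity h₂) t (1 - t)).sq.congr ?_
  filter_upwards [spatialDensity_linear h₁.pauli.1 h₂.pauli.1 t (1 - t)] with x hx
  rw [hx]

theorem vlasovReal_eq (H : VlasovAssumptions β₀ V A w a) (hm : Confined V A m) (β ρ' : ℝ) :
    vlasovReal V A w a β ρ' m =
      κ[d] * ((∫ z, (confinement V A z * m z + β⁻¹ * fermiEntropy (m z)))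
        - ∫ z : Phase d, max (-V z.1) 0 * m z)
      + (2 * ρ')⁻¹ * interactionIntegral w a (spatialDensity m) := by
  have i1 := H.integrable_fermiEntropy hm
  have i2 := hm.integrable_mul H.formSmall_neg
  rw [vlasovReal, integral_add hm.conf (i1.const_mul _), integral_const_mul, mul_inv]
  have : ∫ z : Phase d, (‖z.2 + A z.1‖ ^ 2 + V z.1) * m z
      = (∫ z, confinement V A z * m z) - ∫ z : Phase d, max (-V z.1) 0 * m z := by
    rw [← integral_sub hm.conf i2]
    refine integral_congr_ae (Eventually.of_forall fun z => ?_)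
    simp only [energy_eq]; ring
  rw [this]; ring

/-- The free energy density relative to the confinement is bounded below by an integrable
function, with a fraction of the confinement energy to spare. -/
theorem le_free_energy_density {β : ℝ} (H : VlasovAssumptions β₀ V A w a) (hβ : β₀ < β)
    {t : ℝ} (h0 : 0 ≤ t) (h1 : t ≤ 1) (z : Phase d) :
    (1 - β₀ / β) * (confinement V A z * t) - β⁻¹ * Real.exp (-β₀ * confinement V A z)
      ≤ confinement V A z * t + β⁻¹ * fermiEntropy t := by
  have hb := H.beta_pos
  have hβp : 0 < β := hb.trans hβ
  have e := neg_exp_le_energy hb (confinement V A z) h0 h1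
  have e2 := mul_le_mul_of_nonneg_left e (show 0 ≤ β₀ / β by positivity)
  have e3 : β₀ / β * -(β₀⁻¹ * Real.exp (-β₀ * confinement V A z))
      = -(β⁻¹ * Real.exp (-β₀ * confinement V A z)) := by field_simp
  have e4 : β₀ / β * (confinement V A z * t + β₀⁻¹ * fermiEntropy t)
      = β₀ / β * (confinement V A z * t) + β⁻¹ * fermiEntropy t := by field_simp
  rw [e3, e4] at e2
  linarith

/-- Coercivity: at fixed mass, the Vlasov functional controls the confinement energy. -/
theorem exists_coercive (H : VlasovAssumptions β₀ V A w a) {β ρ' : ℝ} (hβ : β₀ < β)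
    (hρ' : 0 < ρ') (r : ℝ) :
    ∃ C : ℝ, ∀ m : Phase d → ℝ, FiniteEnergy V A a m → κ[d] * ∫ z, m z = r →
      κ[d] * ((1 - β₀ / β) / 2) * (∫ z, confinement V A z * m z)
        ≤ vlasovReal V A w a β ρ' m + C := by
  have hb := H.beta_pos
  have hβp : 0 < β := hb.trans hβ
  set γ := 1 - β₀ / β with hγ
  have hγp : 0 < γ := by rw [hγ, sub_pos, div_lt_one hβp]; exact hβ
  have hκ := semiclassical_pos d
  obtain ⟨k, hk, hkle⟩ := H.formSmall_neg.2 (γ / 4) (by positivity)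
  set δ := γ * ρ' / (2 * (|r| + 1)) with hδ
  have hδp : 0 < δ := by positivity
  obtain ⟨D, hD0, hD⟩ := H.exists_convolution_bound hδp
  refine ⟨κ[d] * (β⁻¹ * (∫ z, Real.exp (-β₀ * confinement V A z)) + ∫ z, |k z|)
    + (2 * ρ')⁻¹ * (κ[d] * D * |r|), fun m hm hr => ?_⟩
  have hX := hm.toConfined.nonneg_integral
  have i1 := H.integrable_fermiEntropy hm.toConfined
  have i2 := hm.toConfined.integrable_mul H.formSmall_neg
  have hgood := H.goodDensity hm
  set X := ∫ z, confinement V A z * m z with hXdef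
  have b1 : γ * X - β⁻¹ * (∫ z, Real.exp (-β₀ * confinement V A z))
      ≤ ∫ z, (confinement V A z * m z + β⁻¹ * fermiEntropy (m z)) := by
    rw [hXdef, ← integral_const_mul, ← integral_const_mul,
      ← integral_sub (hm.conf.const_mul γ) (H.integrable_exp_confinement.const_mul _)]
    refine integral_mono_ae ((hm.conf.const_mul γ).sub (H.integrable_exp_confinement.const_mul _))
      (hm.conf.add (i1.const_mul _)) ?_
    filter_upwards [hm.pauli.2] with z hz
    exact H.le_free_energy_density hβ hz.1 hz.2 z
  have b2 : ∫ z : Phase d, max (-V z.1) 0 * m z ≤ γ / 4 * X + ∫ z, |k z| := by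
    rw [hXdef, ← integral_const_mul, ← integral_add (hm.conf.const_mul _) hk.abs]
    refine integral_mono_ae i2 ((hm.conf.const_mul _).add hk.abs) ?_
    filter_upwards [hm.pauli.2, hkle] with z hz h1
    have j1 : max (-V z.1) 0 * m z ≤ (γ / 4 * confinement V A z + |k z|) * m z :=
      mul_le_mul_of_nonneg_right
        ((le_abs_self _).trans (h1.trans (by linarith [le_abs_self (k z)]))) hz.1
    have j2 : |k z| * m z ≤ |k z| := mul_le_of_le_one_right (abs_nonneg _) hz.2
    linarith
  have b3 : -(κ[d] * (δ * X + D) * |r|) ≤ interactionIntegral w a (spatialDensity m) := by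
    have j := hgood.abs_integral_kernel_le H.meas_w hgood (hD m hm.toConfined)
    have j2 : ∫ x, |spatialDensity m x| = r := by
      rw [← hr, ← hm.pauli.integrable_spatialDensity.2]
      refine integral_congr_ae ?_
      filter_upwards [hm.pauli.spatialDensity_nonneg] with x hx
      exact abs_of_nonneg hx
    have j3 : 0 ≤ ∫ x, a * spatialDensity m x ^ 2 :=
      integral_nonneg fun x => mul_nonneg H.a_nonneg (sq_nonneg _)
    rw [j2] at j
    have j4 : κ[d] * (δ * X + D) * r ≤ κ[d] * (δ * X + D) * |r| := by
      gcongr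
      exact le_abs_self r
    have j5 := neg_abs_le (∫ z : Pos d × Pos d,
      w (z.1 - z.2) * spatialDensity m z.1 * spatialDensity m z.2)
    unfold interactionIntegral
    linarith
  have b4 : (2 * ρ')⁻¹ * (κ[d] * (δ * X) * |r|) ≤ κ[d] * (γ / 4) * X := by
    have : (2 * ρ')⁻¹ * (κ[d] * (δ * X) * |r|) = κ[d] * (γ / 4) * X * (|r| / (|r| + 1)) := by
      rw [hδ]; field_simp; ring
    rw [this]
    refine mul_le_of_le_one_right (by positivity) ?_
    rw [div_le_one (by positivity)]
    linarith
  rw [H.vlasovReal_eq hm.toConfined]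
  have b5 := mul_le_mul_of_nonneg_left b3 (show 0 ≤ (2 * ρ')⁻¹ by positivity)
  have b6 := mul_le_mul_of_nonneg_left (sub_le_sub b1 b2) hκ.le
  nlinarith

/-- A density dominated by a Gaussian in momentum plus a density with square integrable spatial
density has itself a square integrable spatial density. -/
theorem integrable_sq_of_le (ha : 0 ≤ a) {m₀ : Phase d → ℝ} (hm : IsPauliDensity m)
    (hm₀ : IsPauliDensity m₀) (hsq : Integrable fun x => a * spatialDensity m₀ x ^ 2) {b C : ℝ}
    (hb : 0 < b) (hle : ∀ᵐ z : Phase d, m z ≤ C * Real.exp (-b * ‖z.2 + A z.1‖ ^ 2) + m₀ z) :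
    Integrable fun x => a * spatialDensity m x ^ 2 := by
  have hg : Integrable fun p : Pos d => Real.exp (-b * ‖p‖ ^ 2) := by
    have := GaussianFourier.integrable_cexp_neg_mul_sq_norm_add (V := Pos d) (b := (b : ℂ))
      (by simpa using hb) 0 0
    refine this.norm.congr (Eventually.of_forall fun p => ?_)
    simp only [Complex.norm_exp]
    congr 1
    norm_num [← Complex.ofReal_pow, ← Complex.ofReal_mul, ← Complex.ofReal_neg]
  set D := κ[d] * (|C| * ∫ p : Pos d, Real.exp (-b * ‖p‖ ^ 2)) with hD
  have hρ : ∀ᵐ x, spatialDensity m x ≤ D + spatialDensity m₀ x := by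
    have h1 := hm.1
    have h2 := hm₀.1
    rw [Measure.volume_eq_prod] at h1 h2 hle
    filter_upwards [h1.prod_right_ae, h2.prod_right_ae, Measure.ae_ae_of_ae_prod hle]
      with x i1 i2 i3
    have i4 : Integrable fun p : Pos d => |C| * Real.exp (-b * ‖p + A x‖ ^ 2) :=
      (hg.comp_add_right (A x)).const_mul |C|
    rw [spatialDensity, spatialDensity, hD, ← mul_add]
    refine mul_le_mul_of_nonneg_left ?_ (semiclassical_pos d).le
    rw [← integral_add_right_eq_self (fun p : Pos d => Real.exp (-b * ‖p‖ ^ 2)) (A x),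
      ← integral_const_mul, ← integral_add i4 i2]
    refine integral_mono_ae i1 (i4.add i2) ?_
    filter_upwards [i3] with p hp
    refine hp.trans ?_
    gcongr
    exact le_abs_self C
  have j1 := hm.integrable_spatialDensity.1
  have j2 := hm₀.integrable_spatialDensity.1
  refine (((j1.const_mul (a * D)).add (j2.const_mul (a * D))).add hsq).mono'
    ((j1.1.pow 2).const_mul a) ?_
  have hD0 : 0 ≤ D := by
    have : 0 ≤ ∫ p : Pos d, Real.exp (-b * ‖p‖ ^ 2) := integral_nonneg fun p => (Real.exp_pos _).le
    positivity
  filter_upwards [hρ, hm.spatialDensity_nonneg, hm₀.spatialDensity_nonneg] with x k1 k2 k3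
  rw [Real.norm_of_nonneg (by positivity)]
  simp only [Pi.add_apply]
  have : spatialDensity m x ^ 2
      ≤ D * spatialDensity m x + D * spatialDensity m₀ x + spatialDensity m₀ x ^ 2 := by
    nlinarith [mul_le_mul_of_nonneg_left k1 k2, mul_le_mul_of_nonneg_left k1 k3]
  have := mul_le_mul_of_nonneg_left this ha
  linarith

/-- Every mass is attained by some density of finite energy. -/
theorem exists_finiteEnergy (H : VlasovAssumptions β₀ V A w a) {r : ℝ} (hr : 0 < r) :
    ∃ m : Phase d → ℝ, IsAdmissible r m ∧ FiniteEnergy V A a m := by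
  have hκ := semiclassical_pos d
  obtain ⟨R, hR⟩ := H.exists_sublevel_mass (κ[d]⁻¹ * r)
  have hi := H.integrable_sublevel R
  set M := ∫ z : Phase d, if confinement V A z ≤ R then (1 : ℝ) else 0
  have hM : 0 < M := lt_of_lt_of_le (by positivity) hR
  -- the uniform distribution on a sublevel set of volume at least that required by the mass
  set t := κ[d]⁻¹ * r / M with ht
  have ht0 : 0 < t := by positivity
  have ht1 : t ≤ 1 := (div_le_one hM).2 hR
  have hp : IsPauliDensity fun z : Phase d => t * if confinement V A z ≤ R then (1 : ℝ) else 0 := by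
    refine ⟨hi.const_mul t, Eventually.of_forall fun z => ?_⟩
    beta_reduce
    split_ifs
    · simpa using ⟨ht0.le, ht1⟩
    · simp
  refine ⟨_, ⟨hp, ?_⟩, ⟨hp, ?_⟩, ?_⟩
  · rw [integral_const_mul, ht]
    change κ[d] * (κ[d]⁻¹ * r / M * M) = r
    field_simp
  · refine (hp.1.const_mul |R|).mono' (H.aestronglyMeasurable_confinement.mul hp.1.1)
      (Eventually.of_forall fun z => ?_)
    have hT := confinement_nonneg V A z
    simp only [norm_mul, Real.norm_eq_abs, abs_of_nonneg hT, abs_of_nonneg ht0.le]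
    split_ifs with h
    · rw [abs_one]
      gcongr
      exact h.trans (le_abs_self R)
    · simp
  · refine integrable_sq_of_le (A := A) (m₀ := fun _ => 0) (b := 1) (C := Real.exp R) H.a_nonneg hp
      ⟨integrable_zero _ _ _, by simp⟩ (by simp [spatialDensity]) one_pos
      (Eventually.of_forall fun z => ?_)
    beta_reduce
    split_ifs with h
    · rw [mul_one, add_zero, ← Real.exp_add]
      refine ht1.trans (Real.one_le_exp ?_)
      have : ‖z.2 + A z.1‖ ^ 2 ≤ confinement V A z := by simp [confinement]
      linarith
    · simp; positivity

end VlasovAssumptions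

/-! ### Weak compactness and weak lower semicontinuity -/

section Hilbert

variable {E : Type*} [NormedAddCommGroup E] [InnerProductSpace ℝ E] [CompleteSpace E]

/-- Bounded sequences in a separable Hilbert space have weakly convergent subsequences. -/
theorem exists_weakly_convergent_subseq [TopologicalSpace.SeparableSpace E] (u : ℕ → E) (C : ℝ)
    (hu : ∀ n, ‖u n‖ ≤ C) :
    ∃ v : E, ∃ φ : ℕ → ℕ, StrictMono φ ∧
      ∀ g : E, Tendsto (fun n => inner ℝ (u (φ n)) g) atTop (nhds (inner ℝ v g)) := by
  have hs := WeakDual.isSeqCompact_closedBall ℝ E (0 : StrongDual ℝ E) C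
  let x : ℕ → WeakDual ℝ E := fun n =>
    StrongDual.toWeakDual (InnerProductSpace.toDual ℝ E (u n))
  have hx : ∀ n, x n ∈ WeakDual.toStrongDual ⁻¹' Metric.closedBall (0 : StrongDual ℝ E) C := by
    intro n
    rw [mem_preimage, mem_closedBall_zero_iff]
    change ‖InnerProductSpace.toDual ℝ E (u n)‖ ≤ C
    rw [LinearIsometryEquiv.norm_map]
    exact hu n
  obtain ⟨y, -, φ, hφ, hlim⟩ := hs hx
  refine ⟨(InnerProductSpace.toDual ℝ E).symm (WeakDual.toStrongDual y), φ, hφ, fun g => ?_⟩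
  rw [InnerProductSpace.toDual_symm_apply]
  exact ((WeakDual.eval_continuous g).tendsto y).comp hlim

/-- Closed convex sets are weakly sequentially closed. -/
theorem mem_of_weak_limit {s : Set E} (hc : Convex ℝ s) (hs : IsClosed s) {u : ℕ → E} {v : E}
    (hu : ∀ᶠ n in atTop, u n ∈ s)
    (hlim : ∀ g : E, Tendsto (fun n => inner ℝ (u n) g) atTop (nhds (inner ℝ v g))) : v ∈ s := by
  by_contra hv
  obtain ⟨f, c, hfv, hfs⟩ := geometric_hahn_banach_point_closed hc hs hv
  have h := hlim ((InnerProductSpace.toDual ℝ E).symm f)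
  simp only [real_inner_comm ((InnerProductSpace.toDual ℝ E).symm f),
    InnerProductSpace.toDual_symm_apply] at h
  exact absurd (ge_of_tendsto h (hu.mono fun n hn => (hfs _ hn).le)) (not_le.2 hfv)

end Hilbert

section MeasureSpace

variable {α : Type*} [MeasurableSpace α] {ν : Measure α}

/-- Fatou's lemma for real valued functions with bounded integrals. -/
theorem integrable_of_tendsto_of_integral_le {f : ℕ → α → ℝ} {g : α → ℝ} {B : ℝ}
    (hf : ∀ n, Integrable (f n) ν) (h0 : ∀ n, ∀ᵐ z ∂ν, 0 ≤ f n z)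
    (hlim : ∀ᵐ z ∂ν, Tendsto (fun n => f n z) atTop (nhds (g z))) (hB : ∀ n, ∫ z, f n z ∂ν ≤ B) :
    Integrable g ν ∧ ∫ z, g z ∂ν ≤ B := by
  have hg0 : ∀ᵐ z ∂ν, 0 ≤ g z := by
    filter_upwards [hlim, ae_all_iff.2 h0] with z h1 h2
    exact ge_of_tendsto' h1 h2
  have hgm : AEStronglyMeasurable g ν := aestronglyMeasurable_of_tendsto_ae _ (fun n => (hf n).1) hlim
  have hle : ∫⁻ z, ENNReal.ofReal (g z) ∂ν ≤ ENNReal.ofReal B := by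
    calc ∫⁻ z, ENNReal.ofReal (g z) ∂ν
        = ∫⁻ z, liminf (fun n => ENNReal.ofReal (f n z)) atTop ∂ν := by
          refine lintegral_congr_ae ?_
          filter_upwards [hlim] with z hz
          exact ((ENNReal.continuous_ofReal.tendsto _).comp hz).liminf_eq.symm
      _ ≤ liminf (fun n => ∫⁻ z, ENNReal.ofReal (f n z) ∂ν) atTop :=
          lintegral_liminf_le' fun n => (hf n).1.aemeasurable.ennreal_ofReal
      _ ≤ ENNReal.ofReal B := by
          refine liminf_le_of_le (by isBoundedDefault) fun b hb => ?_
          obtain ⟨n, hn⟩ := hb.exists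
          refine hn.trans ?_
          rw [← ofReal_integral_eq_lintegral_ofReal (hf n) (h0 n)]
          exact ENNReal.ofReal_le_ofReal (hB n)
  have hB0 : 0 ≤ B := (integral_nonneg_of_ae (h0 0)).trans (hB 0)
  refine ⟨⟨hgm, ?_⟩, ?_⟩
  · rw [hasFiniteIntegral_iff_ofReal hg0]
    exact hle.trans_lt ENNReal.ofReal_lt_top
  · rw [integral_eq_lintegral_of_nonneg_ae hg0 hgm]
    exact ENNReal.toReal_le_of_le_ofReal hB0 hle

/-- The sublevel sets of a convex integral functional on functions with values in `[0, 1]`. -/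
def convexSublevel (ν : Measure α) (Ψ : α → ℝ → ℝ) (B : ℝ) : Set (Lp ℝ 2 ν) :=
  {u | (∀ᵐ z ∂ν, 0 ≤ u z ∧ u z ≤ 1) ∧ Integrable (fun z => Ψ z (u z)) ν ∧
    ∫ z, Ψ z (u z) ∂ν ≤ B}

theorem convex_convexSublevel {Ψ : α → ℝ → ℝ} (hΨ : ∀ z, ConvexOn ℝ (Icc 0 1) (Ψ z))
    (h0 : ∀ z, ∀ t ∈ Icc (0 : ℝ) 1, 0 ≤ Ψ z t)
    (hm : ∀ u : α → ℝ, AEStronglyMeasurable u ν → AEStronglyMeasurable (fun z => Ψ z (u z)) ν)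
    (B : ℝ) : Convex ℝ (convexSublevel ν Ψ B) := by
  rintro u ⟨hu1, hu2, hu3⟩ v ⟨hv1, hv2, hv3⟩ s t hs ht hst
  have hc : (⇑(s • u + t • v) : α → ℝ) =ᵐ[ν] fun z => s * u z + t * v z := by
    filter_upwards [Lp.coeFn_add (s • u) (t • v), Lp.coeFn_smul s u, Lp.coeFn_smul t v]
      with z e1 e2 e3
    rw [e1, Pi.add_apply, e2, e3, Pi.smul_apply, Pi.smul_apply, smul_eq_mul, smul_eq_mul]
  have h01 : ∀ᵐ z ∂ν, 0 ≤ (s • u + t • v : Lp ℝ 2 ν) z ∧ (s • u + t • v : Lp ℝ 2 ν) z ≤ 1 := by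
    filter_upwards [hc, hu1, hv1] with z e a b
    rw [e]
    exact convex_Icc (0 : ℝ) 1 ⟨a.1, a.2⟩ ⟨b.1, b.2⟩ hs ht hst
  have hle : ∀ᵐ z ∂ν, Ψ z ((s • u + t • v : Lp ℝ 2 ν) z) ≤ s * Ψ z (u z) + t * Ψ z (v z) := by
    filter_upwards [hc, hu1, hv1] with z e a b
    rw [e]
    exact (hΨ z).2 ⟨a.1, a.2⟩ ⟨b.1, b.2⟩ hs ht hst
  have hi : Integrable (fun z => s * Ψ z (u z) + t * Ψ z (v z)) ν :=
    (hu2.const_mul s).add (hv2.const_mul t)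
  have hi' : Integrable (fun z => Ψ z ((s • u + t • v : Lp ℝ 2 ν) z)) ν := by
    refine hi.mono' (hm _ (Lp.aestronglyMeasurable _)) ?_
    filter_upwards [hle, h01] with z a b
    rwa [Real.norm_of_nonneg (h0 z _ ⟨b.1, b.2⟩)]
  refine ⟨h01, hi', (integral_mono_ae hi' hi hle).trans ?_⟩
  rw [integral_add (hu2.const_mul s) (hv2.const_mul t), integral_const_mul, integral_const_mul]
  have hts : t = 1 - s := by linarith
  subst hts
  nlinarith [mul_le_mul_of_nonneg_left hu3 hs, mul_le_mul_of_nonneg_left hv3 ht]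

theorem isClosed_convexSublevel {Ψ : α → ℝ → ℝ} (hΨ : ∀ z, Continuous (Ψ z))
    (h0 : ∀ z, ∀ t ∈ Icc (0 : ℝ) 1, 0 ≤ Ψ z t) (B : ℝ) : IsClosed (convexSublevel ν Ψ B) := by
  refine IsSeqClosed.isClosed fun u v hu hlim => ?_
  obtain ⟨φ, -, hφ⟩ := (tendstoInMeasure_of_tendsto_Lp hlim).exists_seq_tendsto_ae
  have h01 : ∀ᵐ z ∂ν, ∀ n, 0 ≤ u n z ∧ u n z ≤ 1 := ae_all_iff.2 fun n => (hu n).1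
  have hv : ∀ᵐ z ∂ν, 0 ≤ v z ∧ v z ≤ 1 := by
    filter_upwards [hφ, h01] with z h1 h2
    exact ⟨ge_of_tendsto' h1 fun n => (h2 _).1, le_of_tendsto' h1 fun n => (h2 _).2⟩
  refine ⟨hv, integrable_of_tendsto_of_integral_le (f := fun n z => Ψ z (u (φ n) z))
    (fun n => (hu (φ n)).2.1) (fun n => ?_) ?_ fun n => (hu (φ n)).2.2⟩
  · filter_upwards [h01] with z h
    exact h0 z _ ⟨(h _).1, (h _).2⟩
  · filter_upwards [hφ] with z h
    exact ((hΨ z).tendsto _).comp h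

/-- Weak convergence of a sequence of functions, tested against square integrable functions. -/
def WeaklyConverges (ν : Measure α) (m : ℕ → α → ℝ) (v : α → ℝ) : Prop :=
  ∀ g : α → ℝ, MemLp g 2 ν →
    Tendsto (fun n => ∫ z, g z * m n z ∂ν) atTop (nhds (∫ z, g z * v z ∂ν))

theorem WeaklyConverges.comp {m : ℕ → α → ℝ} {v : α → ℝ} (h : WeaklyConverges ν m v)
    {φ : ℕ → ℕ} (hφ : StrictMono φ) : WeaklyConverges ν (fun n => m (φ n)) v :=
  fun g hg => (h g hg).comp hφ.tendsto_atTop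

theorem memLp_two_of_bounded {m : α → ℝ} (hi : Integrable m ν)
    (h01 : ∀ᵐ z ∂ν, 0 ≤ m z ∧ m z ≤ 1) : MemLp m 2 ν := by
  rw [memLp_two_iff_integrable_sq hi.1]
  refine hi.mono' (hi.1.pow 2) ?_
  filter_upwards [h01] with z h
  rw [Real.norm_of_nonneg (sq_nonneg _)]
  nlinarith [h.1, h.2]

/-- Weak sequential compactness of sets of densities between `0` and `1` with bounded mass. The
limit is an element of `L²`; that it lies between `0` and `1` is part of
`WeaklyConverges.lowerSemicontinuous`. -/
theorem exists_weakly_convergent_density [TopologicalSpace.SeparableSpace (Lp ℝ 2 ν)]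
    {m : ℕ → α → ℝ} (hi : ∀ n, Integrable (m n) ν)
    (h01 : ∀ n, ∀ᵐ z ∂ν, 0 ≤ m n z ∧ m n z ≤ 1) {M : ℝ} (hM : ∀ n, ∫ z, m n z ∂ν ≤ M) :
    ∃ v : Lp ℝ 2 ν, ∃ φ : ℕ → ℕ, StrictMono φ ∧ WeaklyConverges ν (fun n => m (φ n)) v := by
  have hL : ∀ n, MemLp (m n) 2 ν := fun n => memLp_two_of_bounded (hi n) (h01 n)
  have hb : ∀ n, ‖(hL n).toLp (m n)‖ ≤ Real.sqrt M := by
    intro n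
    refine Real.le_sqrt_of_sq_le ?_
    rw [← real_inner_self_eq_norm_sq, L2.inner_def]
    refine le_trans (integral_mono_ae (L2.integrable_inner _ _) (hi n) ?_) (hM n)
    filter_upwards [(hL n).coeFn_toLp, h01 n] with z e h
    rw [e]
    change m n z * m n z ≤ m n z
    nlinarith [h.1, h.2]
  obtain ⟨v, φ, hφ, hlim⟩ := exists_weakly_convergent_subseq _ _ hb
  refine ⟨v, φ, hφ, fun g hg => ?_⟩
  have h := hlim (hg.toLp g)
  simp only [L2.inner_def] at h
  convert! h using 1
  · ext n
    refine integral_congr_ae ?_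
    filter_upwards [(hL (φ n)).coeFn_toLp, hg.coeFn_toLp] with z e1 e2
    rw [e1, e2]; rfl
  · congr 1
    refine integral_congr_ae ?_
    filter_upwards [hg.coeFn_toLp] with z e2
    rw [e2]; rfl

/-- Convex integral functionals are weakly lower semicontinuous. -/
theorem WeaklyConverges.lowerSemicontinuous {Ψ : α → ℝ → ℝ}
    (hΨ : ∀ z, ConvexOn ℝ (Icc 0 1) (Ψ z)) (hΨc : ∀ z, Continuous (Ψ z))
    (h0 : ∀ z, ∀ t ∈ Icc (0 : ℝ) 1, 0 ≤ Ψ z t)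
    (hm : ∀ u : α → ℝ, AEStronglyMeasurable u ν → AEStronglyMeasurable (fun z => Ψ z (u z)) ν)
    {m : ℕ → α → ℝ} {v : Lp ℝ 2 ν} (hlim : WeaklyConverges ν m v)
    (hi : ∀ n, Integrable (m n) ν) (h01 : ∀ n, ∀ᵐ z ∂ν, 0 ≤ m n z ∧ m n z ≤ 1)
    (hΨi : ∀ n, Integrable (fun z => Ψ z (m n z)) ν) {B : ℝ}
    (hB : Tendsto (fun n => ∫ z, Ψ z (m n z) ∂ν) atTop (nhds B)) :
    (∀ᵐ z ∂ν, 0 ≤ v z ∧ v z ≤ 1) ∧ Integrable (fun z => Ψ z (v z)) ν ∧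
      ∫ z, Ψ z (v z) ∂ν ≤ B := by
  have hL : ∀ n, MemLp (m n) 2 ν := fun n => memLp_two_of_bounded (hi n) (h01 n)
  have key : ∀ ε : ℝ, 0 < ε → v ∈ convexSublevel ν Ψ (B + ε) := by
    intro ε hε
    refine mem_of_weak_limit (u := fun n => (hL n).toLp (m n)) (convex_convexSublevel hΨ h0 hm _)
      (isClosed_convexSublevel hΨc h0 _) ?_ fun g => ?_
    · filter_upwards [hB.eventually (gt_mem_nhds (lt_add_of_pos_right B hε))] with n hn
      have e : (fun z => Ψ z ((hL n).toLp (m n) z)) =ᵐ[ν] fun z => Ψ z (m n z) := by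
        filter_upwards [(hL n).coeFn_toLp] with z hz
        rw [hz]
      refine ⟨?_, (integrable_congr e).2 (hΨi n), (integral_congr_ae e).le.trans hn.le⟩
      filter_upwards [(hL n).coeFn_toLp, h01 n] with z hz h
      rwa [hz]
    · have h := hlim g (Lp.memLp g)
      simp only [L2.inner_def]
      convert! h using 1
      ext n
      refine integral_congr_ae ?_
      filter_upwards [(hL n).coeFn_toLp] with z e1
      rw [e1]; rfl
  exact ⟨(key 1 one_pos).1, (key 1 one_pos).2.1,
    le_of_forall_pos_le_add fun ε hε => (key ε hε).2.2⟩

theorem WeaklyConverges.tendsto_of_integrable {m : ℕ → α → ℝ} {v : α → ℝ}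
    (hlim : WeaklyConverges ν m v) (hmm : ∀ n, AEStronglyMeasurable (m n) ν)
    (h01 : ∀ n, ∀ᵐ z ∂ν, 0 ≤ m n z ∧ m n z ≤ 1) (hvm : AEStronglyMeasurable v ν)
    (hv : ∀ᵐ z ∂ν, 0 ≤ v z ∧ v z ≤ 1) {h : α → ℝ} (hh : Integrable h ν) :
    Tendsto (fun n => ∫ z, h z * m n z ∂ν) atTop (nhds (∫ z, h z * v z ∂ν)) := by
  rw [Metric.tendsto_atTop]
  intro ε hε
  -- approximate `h` in `L¹` by a simple function, which is square integrable
  obtain ⟨g, hg1, hg2⟩ := (memLp_one_iff_integrable.2 hh).exists_simpleFunc_eLpNorm_sub_lt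
    (by simp) (ε := ENNReal.ofReal (ε / 3)) (by simpa using hε)
  have hg3 : Integrable g ν := memLp_one_iff_integrable.1 hg2
  have hg4 : MemLp g 2 ν := (SimpleFunc.memLp_iff_integrable (by simp) (by simp)).2 hg3
  have hd : ∫ z, |h z - g z| ∂ν < ε / 3 := by
    have : eLpNorm (h - ⇑g) 1 ν = ENNReal.ofReal (∫ z, |h z - g z| ∂ν) := by
      rw [eLpNorm_one_eq_lintegral_enorm,
        ofReal_integral_eq_lintegral_ofReal (f := fun z => |h z - g z|) (hh.sub hg3).abs
          (Eventually.of_forall fun z => abs_nonneg _)]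
      refine lintegral_congr fun z => ?_
      rw [← ofReal_norm]; rfl
    rw [this] at hg1
    exact (ENNReal.ofReal_lt_ofReal_iff (by positivity)).1 hg1
  have key : ∀ u : α → ℝ, AEStronglyMeasurable u ν → (∀ᵐ z ∂ν, 0 ≤ u z ∧ u z ≤ 1) →
      |(∫ z, h z * u z ∂ν) - ∫ z, g z * u z ∂ν| < ε / 3 := by
    intro u hum hu
    have hb : ∀ {f : α → ℝ}, Integrable f ν → Integrable (fun z => f z * u z) ν := by
      intro f hf
      refine hf.norm.mono' (hf.1.mul hum) ?_
      filter_upwards [hu] with z hz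
      rw [norm_mul, Real.norm_of_nonneg hz.1]
      exact mul_le_of_le_one_right (norm_nonneg _) hz.2
    rw [← integral_sub (hb hh) (hb hg3)]
    refine lt_of_le_of_lt (abs_integral_le_integral_abs.trans
      (integral_mono_ae ((hb hh).sub (hb hg3)).abs (hh.sub hg3).abs ?_)) hd
    filter_upwards [hu] with z hz
    simp only [Pi.sub_apply]
    rw [← sub_mul, abs_mul, abs_of_nonneg hz.1]
    exact mul_le_of_le_one_right (abs_nonneg _) hz.2
  obtain ⟨N, hN⟩ := Metric.tendsto_atTop.1 (hlim g hg4) (ε / 3) (by positivity)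
  refine ⟨N, fun n hn => ?_⟩
  have k1 := abs_lt.1 (key (m n) (hmm n) (h01 n))
  have k2 := abs_lt.1 (key v hvm hv)
  have k3 := hN n hn
  rw [Real.dist_eq] at k3 ⊢
  have k3 := abs_lt.1 k3
  rw [abs_lt]
  constructor <;> linarith [k1.1, k1.2, k2.1, k2.2, k3.1, k3.2]

/-- Weak convergence with a uniform bound on `∫ T m` can be tested against functions that are
infinitesimally small relative to `T`. -/
theorem WeaklyConverges.tendsto_of_formSmall {m : ℕ → α → ℝ} {v T : α → ℝ}
    (hlim : WeaklyConverges ν m v) (hmm : ∀ n, AEStronglyMeasurable (m n) ν)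
    (h01 : ∀ n, ∀ᵐ z ∂ν, 0 ≤ m n z ∧ m n z ≤ 1) (hvm : AEStronglyMeasurable v ν)
    (hv : ∀ᵐ z ∂ν, 0 ≤ v z ∧ v z ≤ 1) {X : ℝ}
    (hTm : ∀ n, Integrable (fun z => T z * m n z) ν) (hX : ∀ n, ∫ z, T z * m n z ∂ν ≤ X)
    (hTv : Integrable (fun z => T z * v z) ν) (hXv : ∫ z, T z * v z ∂ν ≤ X)
    (hT : ∀ z, 0 ≤ T z) {h : α → ℝ} (hh : FormSmall ν T h) :
    Tendsto (fun n => ∫ z, h z * m n z ∂ν) atTop (nhds (∫ z, h z * v z ∂ν)) := by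
  have hX0 : 0 ≤ X := by
    refine le_trans (integral_nonneg_of_ae ?_) hXv
    filter_upwards [hv] with z hz using mul_nonneg (hT z) hz.1
  rw [Metric.tendsto_atTop]
  intro ε hε
  obtain ⟨k, hk, hle⟩ := hh.2 (ε / (3 * (X + 1))) (by positivity)
  -- the truncation of `h` at height `|k|` is integrable
  set g : α → ℝ := fun z => max (-|k z|) (min (h z) |k z|) with hg
  have hgi : Integrable g ν := by
    refine hk.abs.mono' (hk.1.norm.neg.sup (hh.1.inf hk.1.norm)) (Eventually.of_forall fun z => ?_)
    rw [Real.norm_eq_abs, abs_le]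
    exact ⟨le_max_left _ _, max_le (by linarith [abs_nonneg (k z)]) (min_le_right _ _)⟩
  have hsub : ∀ᵐ z ∂ν, |h z - g z| ≤ ε / (3 * (X + 1)) * T z := by
    filter_upwards [hle] with z hz
    have hp : 0 ≤ ε / (3 * (X + 1)) * T z := mul_nonneg (by positivity) (hT z)
    have hz' := hz.trans (add_le_add_right (le_abs_self (k z)) _)
    rw [abs_le] at hz' ⊢
    simp only [hg]
    rcases le_total (h z) |k z| with a | a
    · rw [min_eq_left a]
      rcases le_total (-|k z|) (h z) with b | b
      · rw [max_eq_right b]; simpa using hp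
      · rw [max_eq_left b]; constructor <;> linarith [hz'.1]
    · rw [min_eq_right a, max_eq_right (by linarith [abs_nonneg (k z)])]
      constructor <;> linarith [hz'.2]
  have key : ∀ u : α → ℝ, AEStronglyMeasurable u ν → (∀ᵐ z ∂ν, 0 ≤ u z ∧ u z ≤ 1) →
      Integrable (fun z => T z * u z) ν → ∫ z, T z * u z ∂ν ≤ X →
      |(∫ z, h z * u z ∂ν) - ∫ z, g z * u z ∂ν| < ε / 3 := by
    intro u hum hu hTu hXu
    have i1 := hh.integrable_mul hum hu hTu
    have i2 : Integrable (fun z => g z * u z) ν := by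
      refine hgi.norm.mono' (hgi.1.mul hum) ?_
      filter_upwards [hu] with z hz
      rw [norm_mul, Real.norm_of_nonneg hz.1]
      exact mul_le_of_le_one_right (norm_nonneg _) hz.2
    rw [← integral_sub i1 i2]
    calc |∫ z, (h z * u z - g z * u z) ∂ν| ≤ ∫ z, |h z * u z - g z * u z| ∂ν :=
          abs_integral_le_integral_abs
      _ ≤ ∫ z, ε / (3 * (X + 1)) * (T z * u z) ∂ν := by
          refine integral_mono_ae (i1.sub i2).abs (hTu.const_mul _) ?_
          filter_upwards [hu, hsub] with z hz hs
          rw [← sub_mul, abs_mul, abs_of_nonneg hz.1, ← mul_assoc]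
          exact mul_le_mul_of_nonneg_right hs hz.1
      _ = ε / (3 * (X + 1)) * ∫ z, T z * u z ∂ν := integral_const_mul _ _
      _ ≤ ε / (3 * (X + 1)) * X := by gcongr
      _ = ε / 3 * (X / (X + 1)) := by field_simp
      _ < ε / 3 * 1 := by
          gcongr
          rw [div_lt_one (by positivity)]
          linarith
      _ = ε / 3 := mul_one _
  obtain ⟨N, hN⟩ := Metric.tendsto_atTop.1 (hlim.tendsto_of_integrable hmm h01 hvm hv hgi) (ε / 3)
    (by positivity)
  refine ⟨N, fun n hn => ?_⟩
  have k1 := abs_lt.1 (key (m n) (hmm n) (h01 n) (hTm n) (hX n))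
  have k2 := abs_lt.1 (key v hvm hv hTv hXv)
  have k3 := hN n hn
  rw [Real.dist_eq] at k3 ⊢
  have k3 := abs_lt.1 k3
  rw [abs_lt]
  constructor <;> linarith [k1.1, k1.2, k2.1, k2.2, k3.1, k3.2]

/-- Bounded functions that tend to zero pointwise tend to zero against densities with bounded
`∫ T m`, if constants are infinitesimally small relative to `T`. -/
theorem tendsto_integral_mul_zero {m f : ℕ → α → ℝ} {T : α → ℝ}
    (h01 : ∀ n, ∀ᵐ z ∂ν, 0 ≤ m n z ∧ m n z ≤ 1) {X : ℝ}
    (hTm : ∀ n, Integrable (fun z => T z * m n z) ν) (hX : ∀ n, ∫ z, T z * m n z ∂ν ≤ X)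
    (hT : ∀ z, 0 ≤ T z) (h1 : FormSmall ν T fun _ => (1 : ℝ))
    (hfm : ∀ n, AEStronglyMeasurable (f n) ν) {D : ℝ} (hD : ∀ n z, |f n z| ≤ D)
    (hlim : ∀ z, Tendsto (fun n => f n z) atTop (nhds 0)) :
    Tendsto (fun n => ∫ z, f n z * m n z ∂ν) atTop (nhds 0) := by
  have hX0 : 0 ≤ X := by
    refine le_trans (integral_nonneg_of_ae ?_) (hX 0)
    filter_upwards [h01 0] with z hz using mul_nonneg (hT z) hz.1
  rcases isEmpty_or_nonempty α with hα | ⟨⟨z₀⟩⟩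
  · simp [integral_of_isEmpty]
  have hD0 : 0 ≤ D := (abs_nonneg _).trans (hD 0 z₀)
  rw [Metric.tendsto_atTop]
  intro ε hε
  obtain ⟨k, hk, hle⟩ := h1.2 (ε / (2 * (D * X + 1))) (by positivity)
  have hfk : ∀ n, Integrable (fun z => f n z * k z) ν := fun n =>
    hk.bdd_mul (hfm n) (Eventually.of_forall fun z => hD n z)
  have hdom : Tendsto (fun n => ∫ z, |f n z * k z| ∂ν) atTop (nhds 0) := by
    have := tendsto_integral_of_dominated_convergence (F := fun n z => |f n z * k z|)
      (f := fun _ => (0 : ℝ)) (μ := ν) (fun z => D * |k z|) (fun n => (hfk n).abs.1)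
      (hk.abs.const_mul D) (fun n => Eventually.of_forall fun z => ?_)
      (Eventually.of_forall fun z => ?_)
    · simpa using this
    · rw [Real.norm_eq_abs, abs_abs, abs_mul]
      exact mul_le_mul_of_nonneg_right (hD n z) (abs_nonneg _)
    · simpa using ((hlim z).mul_const (k z)).abs
  obtain ⟨N, hN⟩ := Metric.tendsto_atTop.1 hdom (ε / 2) (by positivity)
  refine ⟨N, fun n hn => ?_⟩
  have hN' := hN n hn
  rw [dist_zero_right, Real.norm_of_nonneg (integral_nonneg fun z => abs_nonneg _)] at hN'
  rw [dist_zero_right]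
  have i2 : Integrable (fun z => ε / (2 * (D * X + 1)) * D * (T z * m n z) + |f n z * k z|) ν :=
    ((hTm n).const_mul _).add (hfk n).abs
  have hpt : ∀ᵐ z ∂ν, ‖f n z * m n z‖
      ≤ ε / (2 * (D * X + 1)) * D * (T z * m n z) + |f n z * k z| := by
    filter_upwards [h01 n, hle] with z hz h
    rw [abs_one] at h
    rw [norm_mul, Real.norm_eq_abs, Real.norm_of_nonneg hz.1, abs_mul]
    have j1 : |f n z| * m n z * 1
        ≤ |f n z| * m n z * (ε / (2 * (D * X + 1)) * T z + |k z|) :=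
      mul_le_mul_of_nonneg_left (h.trans (by linarith [le_abs_self (k z)]))
        (mul_nonneg (abs_nonneg _) hz.1)
    have j2 : |f n z| * (ε / (2 * (D * X + 1)) * (T z * m n z))
        ≤ D * (ε / (2 * (D * X + 1)) * (T z * m n z)) :=
      mul_le_mul_of_nonneg_right (hD n z)
        (mul_nonneg (by positivity) (mul_nonneg (hT z) hz.1))
    have j3 : |f n z| * |k z| * m n z ≤ |f n z| * |k z| :=
      mul_le_of_le_one_right (by positivity) hz.2
    nlinarith
  calc ‖∫ z, f n z * m n z ∂ν‖ ≤ ∫ z, ‖f n z * m n z‖ ∂ν := norm_integral_le_integral_norm _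
    _ ≤ ∫ z, (ε / (2 * (D * X + 1)) * D * (T z * m n z) + |f n z * k z|) ∂ν :=
        integral_mono_of_nonneg (Eventually.of_forall fun z => norm_nonneg _) i2 hpt
    _ = ε / (2 * (D * X + 1)) * D * (∫ z, T z * m n z ∂ν) + ∫ z, |f n z * k z| ∂ν := by
        rw [integral_add ((hTm n).const_mul _) (hfk n).abs, integral_const_mul]
    _ ≤ ε / (2 * (D * X + 1)) * D * X + ∫ z, |f n z * k z| ∂ν := by gcongr; exact hX n
    _ < ε / 2 + ε / 2 := by
        have : ε / (2 * (D * X + 1)) * D * X ≤ ε / 2 := by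
          have : ε / (2 * (D * X + 1)) * D * X = ε / 2 * (D * X / (D * X + 1)) := by field_simp
          rw [this]
          refine mul_le_of_le_one_right (by positivity) ?_
          rw [div_le_one (by positivity)]
          linarith
        linarith
    _ = ε := by ring

end MeasureSpace

/-! ### Existence of minimizers -/

namespace VlasovAssumptions

variable {d : ℕ} {β₀ : ℝ} {V : Pos d → ℝ} {A : Pos d → Pos d} {w : Pos d → ℝ} {a : ℝ}

/-- The interaction without its `δ₀` part is weakly continuous at bounded confinement energy. -/
theorem tendsto_kernel (H : VlasovAssumptions β₀ V A w a) {m : ℕ → Phase d → ℝ}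
    {v : Phase d → ℝ} (hm : ∀ n, Confined V A (m n)) (hv : Confined V A v) {X : ℝ}
    (hX : ∀ n, ∫ z, confinement V A z * m n z ≤ X) (hXv : ∫ z, confinement V A z * v z ≤ X)
    (hlim : WeaklyConverges volume m v) :
    Tendsto (fun n => ∫ z : Pos d × Pos d,
      w (z.1 - z.2) * spatialDensity (m n) z.1 * spatialDensity (m n) z.2) atTop
      (nhds (∫ z : Pos d × Pos d, w (z.1 - z.2) * spatialDensity v z.1 * spatialDensity v z.2)) := by
  -- the potentials `W` generated by the densities are uniformly bounded and converge pointwise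
  obtain ⟨C, hC0, hC⟩ := H.exists_convolution_bound one_pos
  set D := κ[d] * (1 * X + C) with hD
  have hκ := semiclassical_pos d
  let W : (Phase d → ℝ) → Pos d → ℝ := fun u x => ∫ y, w (x - y) * spatialDensity u y
  have hb : ∀ u, Confined V A u → ∫ z, confinement V A z * u z ≤ X → ∀ x,
      ∫ y, |w (x - y) * spatialDensity u y| ≤ D := by
    intro u hu hXu x
    refine (hC u hu x).trans ?_
    rw [hD]
    gcongr
  have hWb : ∀ u, Confined V A u → ∫ z, confinement V A z * u z ≤ X → ∀ x, |W u x| ≤ D :=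
    fun u hu hXu x => abs_integral_le_integral_abs.trans (hb u hu hXu x)
  have hWm : ∀ u, Confined V A u → AEStronglyMeasurable (W u) := fun u hu =>
    GoodDensity.aestronglyMeasurable_convolution H.meas_w hu.pauli.integrable_spatialDensity.1.1
  have hWm' : ∀ u, Confined V A u → AEStronglyMeasurable fun z : Phase d => W u z.1 :=
    fun u hu => (hWm u hu).comp_quasiMeasurePreserving Measure.quasiMeasurePreserving_fst
  have hWs : ∀ u, Confined V A u → ∫ z, confinement V A z * u z ≤ X →
      FormSmall volume (confinement V A) fun z : Phase d => W u z.1 := fun u hu hXu =>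
    FormSmall.of_bound H.formSmall_one (hWm' u hu) (Eventually.of_forall fun z => hWb u hu hXu z.1)
  have hgood : ∀ u, Confined V A u → ∫ z, confinement V A z * u z ≤ X →
      GoodDensity w 0 (spatialDensity u) := fun u hu hXu =>
    ⟨hu.pauli.integrable_spatialDensity.1,
      ⟨D, fun x => ⟨H.integrable_translate_mul hu x, hb u hu hXu x⟩⟩, by simp⟩
  have hform : ∀ u, Confined V A u → ∫ z, confinement V A z * u z ≤ X →
      ∫ z : Pos d × Pos d, w (z.1 - z.2) * spatialDensity u z.1 * spatialDensity u z.2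
        = κ[d] * ∫ z : Phase d, W u z.1 * u z := by
    intro u hu hXu
    rw [(hgood u hu hXu).integral_kernel H.meas_w (hgood u hu hXu),
      ← (integrable_mul_spatialDensity (g := W u) (hu.integrable_mul (hWs u hu hXu))).2]
    refine integral_congr_ae (Eventually.of_forall fun x => ?_)
    exact mul_comm _ _
  have hconv : ∀ {h : Phase d → ℝ}, FormSmall volume (confinement V A) h →
      Tendsto (fun n => ∫ z, h z * m n z) atTop (nhds (∫ z, h z * v z)) := fun hh =>
    hlim.tendsto_of_formSmall (fun n => (hm n).pauli.1.1) (fun n => (hm n).pauli.2) hv.pauli.1.1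
      hv.pauli.2 (fun n => (hm n).conf) hX hv.conf hXv (confinement_nonneg V A) hh
  have hpt : ∀ x, Tendsto (fun n => W (m n) x - W v x) atTop (nhds 0) := by
    intro x
    have h := ((hconv (H.formSmall_translate x)).const_mul κ[d]).sub_const (W v x)
    rw [← H.integral_translate_mul hv x] at h
    refine (h.congr fun n => ?_).trans (by simp [W])
    rw [← H.integral_translate_mul (hm n) x]
  have h1 := tendsto_integral_mul_zero (fun n => (hm n).pauli.2) (fun n => (hm n).conf) hX
    (confinement_nonneg V A) H.formSmall_one
    (fun n => (hWm' (m n) (hm n)).sub (hWm' v hv)) (D := D + D)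
    (fun n z => (abs_sub _ _).trans (add_le_add (hWb _ (hm n) (hX n) z.1) (hWb _ hv hXv z.1)))
    (fun z => hpt z.1)
  have h2 := ((h1.add (hconv (hWs v hv hXv))).const_mul κ[d])
  rw [zero_add, ← hform v hv hXv] at h2
  refine h2.congr fun n => ?_
  have i1 := (hm n).integrable_mul (hWs (m n) (hm n) (hX n))
  have i2 := (hm n).integrable_mul (hWs v hv hXv)
  rw [hform (m n) (hm n) (hX n), ← integral_add ?_ i2]
  · congr 2
    ext z
    simp only [Pi.sub_apply]
    ring
  · refine (i1.sub i2).congr (Eventually.of_forall fun z => ?_)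
    simp only [Pi.sub_apply]
    ring

/-- The `δ₀` part of the interaction is weakly lower semicontinuous. -/
theorem sq_lowerSemicontinuous (H : VlasovAssumptions β₀ V A w a) {m : ℕ → Phase d → ℝ}
    {v : Phase d → ℝ} (hm : ∀ n, FiniteEnergy V A a (m n)) (hv : Confined V A v) {X : ℝ}
    (hX : ∀ n, ∫ z, confinement V A z * m n z ≤ X) (hXv : ∫ z, confinement V A z * v z ≤ X)
    (hlim : WeaklyConverges volume m v) {b : ℝ}
    (hb : Tendsto (fun n => ∫ x, a * spatialDensity (m n) x ^ 2) atTop (nhds b)) :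
    Integrable (fun x => a * spatialDensity v x ^ 2) ∧ ∫ x, a * spatialDensity v x ^ 2 ≤ b := by
  have ha := H.a_nonneg
  -- test against truncations `g` of the limit density, using `ρ² ≥ 2 g ρ - g²`
  set g : ℕ → Pos d → ℝ := fun k x => min |spatialDensity v x| k with hg
  have iv := hv.pauli.integrable_spatialDensity.1
  have g0 : ∀ k x, 0 ≤ g k x := fun k x => le_min (abs_nonneg _) (Nat.cast_nonneg k)
  have gm : ∀ k, AEStronglyMeasurable (g k) := fun k => iv.1.norm.inf aestronglyMeasurable_const
  have gb : ∀ k x, |g k x| ≤ k := fun k x => by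
    rw [abs_of_nonneg (g0 k x)]; exact min_le_right _ _
  have gs : ∀ k, FormSmall volume (confinement V A) fun z : Phase d => g k z.1 := fun k =>
    FormSmall.of_bound H.formSmall_one
      ((gm k).comp_quasiMeasurePreserving Measure.quasiMeasurePreserving_fst)
      (Eventually.of_forall fun z => gb k z.1)
  have gi : ∀ k u, Confined V A u → Integrable fun x => g k x * spatialDensity u x :=
    fun k u hu => (integrable_mul_spatialDensity (g := g k) (hu.integrable_mul (gs k))).1
  have gsq : ∀ k, Integrable fun x => g k x ^ 2 := fun k => by
    refine (iv.abs.const_mul (k : ℝ)).mono' ((gm k).pow 2) (Eventually.of_forall fun x => ?_)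
    rw [Real.norm_of_nonneg (sq_nonneg _), sq]
    exact mul_le_mul (min_le_right _ _) (min_le_left _ _) (g0 k x) (Nat.cast_nonneg k)
  have key : ∀ k, ∫ x, a * g k x ^ 2 ≤ b := by
    intro k
    have h1 : Tendsto (fun n => ∫ x, g k x * spatialDensity (m n) x) atTop
        (nhds (∫ x, g k x * spatialDensity v x)) := by
      have h := (hlim.tendsto_of_formSmall (fun n => (hm n).pauli.1.1) (fun n => (hm n).pauli.2)
        hv.pauli.1.1 hv.pauli.2 (fun n => (hm n).conf) hX hv.conf hXv (confinement_nonneg V A)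
        (gs k)).const_mul κ[d]
      rw [← (integrable_mul_spatialDensity (g := g k) (hv.integrable_mul (gs k))).2] at h
      refine h.congr fun n => ?_
      rw [← (integrable_mul_spatialDensity (g := g k)
        ((hm n).toConfined.integrable_mul (gs k))).2]
    have h2 : 2 * a * (∫ x, g k x * spatialDensity v x) - a * ∫ x, g k x ^ 2 ≤ b := by
      refine le_of_tendsto_of_tendsto' ((h1.const_mul (2 * a)).sub_const _) hb fun n => ?_
      rw [← integral_const_mul, ← integral_const_mul,
        ← integral_sub ((gi k _ (hm n).toConfined).const_mul _) ((gsq k).const_mul _)]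
      refine integral_mono (((gi k _ (hm n).toConfined).const_mul _).sub ((gsq k).const_mul _))
        (hm n).sq fun x => ?_
      beta_reduce
      nlinarith [mul_nonneg ha (sq_nonneg (spatialDensity (m n) x - g k x))]
    refine le_trans ?_ h2
    rw [← integral_const_mul, ← integral_const_mul,
      ← integral_sub ((gi k _ hv).const_mul _) ((gsq k).const_mul _)]
    refine integral_mono_ae ((gsq k).const_mul _)
      (((gi k _ hv).const_mul _).sub ((gsq k).const_mul _)) ?_
    filter_upwards [hv.pauli.spatialDensity_nonneg] with x hx
    have : g k x ≤ spatialDensity v x := (min_le_left _ _).trans (abs_of_nonneg hx).le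
    have := mul_le_mul_of_nonneg_left this (g0 k x)
    nlinarith [mul_le_mul_of_nonneg_left this ha]
  refine integrable_of_tendsto_of_integral_le (f := fun k x => a * g k x ^ 2)
    (fun k => (gsq k).const_mul a)
    (fun k => Eventually.of_forall fun x => mul_nonneg ha (sq_nonneg _))
    (Eventually.of_forall fun x => ?_) key
  obtain ⟨N, hN⟩ := exists_nat_ge |spatialDensity v x|
  refine tendsto_const_nhds.congr' ?_
  filter_upwards [eventually_ge_atTop N] with k hk
  have : |spatialDensity v x| ≤ k := hN.trans (by exact_mod_cast hk)
  simp only [hg]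
  rw [min_eq_left this, sq_abs]

/-- The direct method: the confinement energy is bounded along a minimizing sequence, so no mass
is lost at infinity, and every term of the functional is weakly continuous or weakly lower
semicontinuous. -/
theorem exists_minimizer (H : VlasovAssumptions β₀ V A w a) {β ρ' r : ℝ} (hβ : β₀ < β)
    (hρ' : 0 < ρ') (hr : 0 < r) :
    ∃ m : Phase d → ℝ, IsAdmissible r m ∧ FiniteEnergy V A a m ∧
      ∀ m' : Phase d → ℝ, IsAdmissible r m' → FiniteEnergy V A a m' →
        vlasovReal V A w a β ρ' m ≤ vlasovReal V A w a β ρ' m' := by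
  have hb := H.beta_pos
  have hβp : 0 < β := hb.trans hβ
  have hκ := semiclassical_pos d
  have hγp : 0 < 1 - β₀ / β := by rw [sub_pos, div_lt_one hβp]; exact hβ
  obtain ⟨C, hC⟩ := H.exists_coercive hβ hρ' r
  set S : Set ℝ := {e | ∃ m : Phase d → ℝ, IsAdmissible r m ∧ FiniteEnergy V A a m ∧
    vlasovReal V A w a β ρ' m = e} with hS
  have hSne : S.Nonempty := by
    obtain ⟨m, h1, h2⟩ := H.exists_finiteEnergy hr
    exact ⟨_, m, h1, h2, rfl⟩
  have hSbdd : BddBelow S := by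
    refine ⟨-C, ?_⟩
    rintro e ⟨m, h1, h2, rfl⟩
    have := hC m h2 h1.2
    have h3 : 0 ≤ κ[d] * ((1 - β₀ / β) / 2) * ∫ z, confinement V A z * m z :=
      mul_nonneg (by positivity) h2.toConfined.nonneg_integral
    linarith
  obtain ⟨e, -, he, heS⟩ := exists_seq_tendsto_sInf hSne hSbdd
  choose m₁ hadm₁ hfin₁ hval₁ using heS
  -- the confinement energy is bounded along the minimizing sequence
  obtain ⟨B, hB⟩ := he.bddAbove_range
  have hX₁ : ∀ n, ∫ z, confinement V A z * m₁ n z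
      ≤ (B + C) / (κ[d] * ((1 - β₀ / β) / 2)) := by
    intro n
    rw [le_div_iff₀' (by positivity)]
    refine (hC _ (hfin₁ n) (hadm₁ n).2).trans ?_
    rw [hval₁ n]
    gcongr
    exact hB (mem_range_self n)
  have hmass : ∀ n, ∫ z, m₁ n z = κ[d]⁻¹ * r := fun n => by
    rw [← (hadm₁ n).2]; field_simp
  have : TopologicalSpace.SeparableSpace (Lp ℝ 2 (volume : Measure (Phase d))) := by
    have : Fact ((2 : ℝ≥0∞) ≠ ⊤) := ⟨by simp⟩
    have : MeasurableSpace.CountablyGenerated (Phase d) := inferInstance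
    have : MeasureTheory.IsSeparable (volume : Measure (Phase d)) := inferInstance
    have := Lp.SecondCountableTopology (μ := (volume : Measure (Phase d))) (E := ℝ) (p := 2)
    infer_instance
  obtain ⟨v, φ, hφ, hlim₁⟩ := exists_weakly_convergent_density (fun n => (hadm₁ n).1.1)
    (fun n => (hadm₁ n).1.2) (fun n => (hmass n).le)
  -- the nonnegative convex part of the functional
  set Ψ : Phase d → ℝ → ℝ := fun z t => confinement V A z * t + β⁻¹ * fermiEntropy t
    + β⁻¹ * Real.exp (-β₀ * confinement V A z) with hΨ
  have hΨconv : ∀ z, ConvexOn ℝ (Icc 0 1) (Ψ z) := by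
    intro z
    have h1 : ConvexOn ℝ (Icc (0 : ℝ) 1) fun t => confinement V A z * t := by
      simpa using (convexOn_id (convex_Icc (0 : ℝ) 1)).smul (confinement_nonneg V A z)
    have h2 := strictConvexOn_fermiEntropy.convexOn.smul (inv_pos.2 hβp).le
    exact (h1.add h2).add_const _
  have hΨcont : ∀ z, Continuous (Ψ z) := by
    intro z
    have := continuous_fermiEntropy
    simp only [hΨ]
    fun_prop
  have hΨlow : ∀ z, ∀ t ∈ Icc (0 : ℝ) 1, (1 - β₀ / β) * (confinement V A z * t) ≤ Ψ z t := by
    rintro z t ⟨h0, h1⟩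
    have := H.le_free_energy_density hβ h0 h1 z
    simp only [hΨ]
    linarith
  have hΨ0 : ∀ z, ∀ t ∈ Icc (0 : ℝ) 1, 0 ≤ Ψ z t := by
    rintro z t ht
    exact (mul_nonneg hγp.le (mul_nonneg (confinement_nonneg V A z) ht.1)).trans (hΨlow z t ht)
  have hTm := H.aestronglyMeasurable_confinement
  have hΨm : ∀ u : Phase d → ℝ, AEStronglyMeasurable u →
      AEStronglyMeasurable fun z => Ψ z (u z) := by
    intro u hu
    exact ((hTm.mul hu).add ((continuous_fermiEntropy.comp_aestronglyMeasurable hu).const_mul _)).add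
      (H.integrable_exp_confinement.1.const_mul _)
  have hΨi : ∀ u, Confined V A u → Integrable fun z => Ψ z (u z) := fun u hu =>
    (hu.conf.add ((H.integrable_fermiEntropy hu).const_mul _)).add
      (H.integrable_exp_confinement.const_mul _)
  set Q := ∫ z, Real.exp (-β₀ * confinement V A z) with hQ
  have hval : ∀ u, Confined V A u → vlasovReal V A w a β ρ' u
      = κ[d] * ((∫ z, Ψ z (u z)) - β⁻¹ * Q - ∫ z : Phase d, max (-V z.1) 0 * u z)
        + (2 * ρ')⁻¹ * ((∫ z : Pos d × Pos d,
          w (z.1 - z.2) * spatialDensity u z.1 * spatialDensity u z.2)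
          + ∫ x, a * spatialDensity u x ^ 2) := by
    intro u hu
    rw [H.vlasovReal_eq hu, interactionIntegral]
    have : ∫ z, Ψ z (u z)
        = (∫ z, (confinement V A z * u z + β⁻¹ * fermiEntropy (u z))) + β⁻¹ * Q := by
      have i1 : Integrable fun z => confinement V A z * u z + β⁻¹ * fermiEntropy (u z) :=
        hu.conf.add ((H.integrable_fermiEntropy hu).const_mul _)
      rw [hQ, ← integral_const_mul, ← integral_add i1
        (H.integrable_exp_confinement.const_mul _)]
    rw [this]
    ring
  -- the weak limit is an admissible confined density
  obtain ⟨hv01, hvi, -⟩ := hlim₁.lowerSemicontinuous (Ψ := fun _ t => t)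
    (fun _ => convexOn_id (convex_Icc 0 1)) (fun _ => continuous_id) (fun _ t ht => ht.1)
    (fun u hu => hu) (fun n => (hadm₁ (φ n)).1.1) (fun n => (hadm₁ (φ n)).1.2)
    (fun n => (hadm₁ (φ n)).1.1) (B := κ[d]⁻¹ * r)
    (tendsto_const_nhds.congr fun n => (hmass (φ n)).symm)
  have hJb : ∃ J, ∀ n, ∫ z, Ψ z (m₁ n z) ≤ J := by
    refine ⟨(B + C) / (κ[d] * ((1 - β₀ / β) / 2)) + β⁻¹ * Q, fun n => ?_⟩
    refine le_trans ?_ (add_le_add_left (hX₁ n) _)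
    rw [hQ, ← integral_const_mul, ← integral_add (hfin₁ n).conf
      (H.integrable_exp_confinement.const_mul _)]
    refine integral_mono_ae (hΨi _ (hfin₁ n).toConfined)
      ((hfin₁ n).conf.add (H.integrable_exp_confinement.const_mul _)) ?_
    filter_upwards [(hadm₁ n).1.2] with z hz
    have := mul_nonneg (inv_pos.2 hβp).le (neg_nonneg.2 (fermiEntropy_nonpos hz.1 hz.2))
    simp only [hΨ]
    linarith
  obtain ⟨J, hJ⟩ := hJb
  have hJ0 : ∀ n, 0 ≤ ∫ z, Ψ z (m₁ n z) := fun n => integral_nonneg_of_ae (by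
    filter_upwards [(hadm₁ n).1.2] with z hz using hΨ0 z _ ⟨hz.1, hz.2⟩)
  obtain ⟨j, -, ψ, hψ, hj⟩ := tendsto_subseq_of_bounded (Metric.isBounded_Icc (0 : ℝ) J)
    (x := fun n => ∫ z, Ψ z (m₁ (φ n) z)) fun n => ⟨hJ0 _, hJ _⟩
  set m : ℕ → Phase d → ℝ := fun n => m₁ (φ (ψ n)) with hm
  have hadm : ∀ n, IsAdmissible r (m n) := fun n => hadm₁ _
  have hfin : ∀ n, FiniteEnergy V A a (m n) := fun n => hfin₁ _
  have hlim : WeaklyConverges volume m v := hlim₁.comp hψ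
  have hj' : Tendsto (fun n => ∫ z, Ψ z (m n z)) atTop (nhds j) := hj
  obtain ⟨-, hvΨ, hvj⟩ := hlim.lowerSemicontinuous hΨconv hΨcont hΨ0 hΨm
    (fun n => (hadm n).1.1) (fun n => (hadm n).1.2) (fun n => hΨi _ (hfin n).toConfined) hj'
  have hvconf : Confined V A v := by
    refine ⟨⟨hvi, hv01⟩, (hvΨ.const_mul (1 - β₀ / β)⁻¹).mono' (hTm.mul hvi.1) ?_⟩
    filter_upwards [hv01] with z hz
    rw [Real.norm_of_nonneg (mul_nonneg (confinement_nonneg V A z) hz.1), inv_mul_eq_div,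
      le_div_iff₀' hγp]
    exact hΨlow z _ ⟨hz.1, hz.2⟩
  set X := max ((B + C) / (κ[d] * ((1 - β₀ / β) / 2))) (∫ z, confinement V A z * v z) with hXdef
  have hX : ∀ n, ∫ z, confinement V A z * m n z ≤ X := fun n =>
    (hX₁ _).trans (le_max_left _ _)
  have hXv : ∫ z, confinement V A z * v z ≤ X := le_max_right _ _
  have hconv : ∀ {h : Phase d → ℝ}, FormSmall volume (confinement V A) h →
      Tendsto (fun n => ∫ z, h z * m n z) atTop (nhds (∫ z, h z * v z)) := fun hh =>
    hlim.tendsto_of_formSmall (fun n => (hadm n).1.1.1) (fun n => (hadm n).1.2) hvi.1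
      hv01 (fun n => (hfin n).conf) hX hvconf.conf hXv (confinement_nonneg V A) hh
  have hvmass : κ[d] * ∫ z, v z = r := by
    have h := (hconv H.formSmall_one).const_mul κ[d]
    simp only [one_mul] at h
    refine tendsto_nhds_unique h (tendsto_const_nhds.congr fun n => ?_)
    exact ((hadm n).2).symm
  have hker := H.tendsto_kernel (fun n => (hfin n).toConfined) hvconf hX hXv hlim
  have hneg := hconv H.formSmall_neg
  have hen : Tendsto (fun n => vlasovReal V A w a β ρ' (m n)) atTop (nhds (sInf S)) := by
    refine (he.comp (hφ.comp hψ).tendsto_atTop).congr fun n => ?_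
    exact (hval₁ _).symm
  -- all other terms converge, hence so does the last one
  have hsq : Tendsto (fun n => ∫ x, a * spatialDensity (m n) x ^ 2) atTop
      (nhds (2 * ρ' * (sInf S - κ[d] * (j - β⁻¹ * Q - ∫ z : Phase d, max (-V z.1) 0 * v z))
        - ∫ z : Pos d × Pos d, w (z.1 - z.2) * spatialDensity v z.1 * spatialDensity v z.2)) := by
    refine (((hen.sub (((hj'.sub_const (β⁻¹ * Q)).sub hneg).const_mul κ[d])).const_mul
      (2 * ρ')).sub hker).congr fun n => ?_
    rw [hval _ (hfin n).toConfined]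
    field_simp
    ring
  obtain ⟨hvsq, hvle⟩ := H.sq_lowerSemicontinuous hfin hvconf hX hXv hlim hsq
  refine ⟨v, ⟨hvconf.pauli, hvmass⟩, ⟨hvconf, hvsq⟩, fun m' h1 h2 => ?_⟩
  refine le_trans ?_ (csInf_le hSbdd ⟨m', h1, h2, rfl⟩)
  rw [hval _ hvconf]
  have k1 := mul_le_mul_of_nonneg_left hvle (show 0 ≤ (2 * ρ')⁻¹ by positivity)
  have k2 := mul_le_mul_of_nonneg_left hvj hκ.le
  have k3 : (2 * ρ')⁻¹ * (2 * ρ' * (sInf S - κ[d] * (j - β⁻¹ * Q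
      - ∫ z : Phase d, max (-V z.1) 0 * v z))
        - ∫ z : Pos d × Pos d, w (z.1 - z.2) * spatialDensity v z.1 * spatialDensity v z.2)
      = (sInf S - κ[d] * (j - β⁻¹ * Q - ∫ z : Phase d, max (-V z.1) 0 * v z))
        - (2 * ρ')⁻¹ * ∫ z : Pos d × Pos d,
          w (z.1 - z.2) * spatialDensity v z.1 * spatialDensity v z.2 := by
    field_simp
  rw [k3] at k1
  nlinarith

end VlasovAssumptions

/-! ### The nonlinear equation -/

theorem fermiDirac_le_exp (b h : ℝ) : fermiDirac b h ≤ Real.exp (-(b * h)) := by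
  unfold fermiDirac
  rw [Real.exp_neg, one_div]
  exact inv_anti₀ (Real.exp_pos _) (by linarith)

theorem fermiDirac_anti {b : ℝ} (hb : 0 < b) : StrictAnti (fermiDirac b) := by
  intro x y hxy
  unfold fermiDirac
  gcongr

theorem continuous_fermiDirac (b : ℝ) : Continuous (fermiDirac b) := by
  unfold fermiDirac
  refine continuous_const.div (by fun_prop) fun x => ?_
  positivity

theorem tendsto_fermiDirac_atBot {b : ℝ} (hb : 0 < b) :
    Tendsto (fermiDirac b) atBot (nhds 1) := by
  have h : Tendsto (fun x => Real.exp (b * x)) atBot (nhds 0) :=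
    Real.tendsto_exp_atBot.comp (tendsto_id.const_mul_atBot hb)
  have := (h.const_add 1).inv₀ (by norm_num)
  have e : fermiDirac b = fun x => (1 + Real.exp (b * x))⁻¹ := by ext x; simp [fermiDirac]
  rw [e]
  simpa using this

theorem tendsto_fermiDirac_atTop {b : ℝ} (hb : 0 < b) :
    Tendsto (fermiDirac b) atTop (nhds 0) := by
  have h : Tendsto (fun x => 1 + Real.exp (b * x)) atTop atTop :=
    tendsto_atTop_add_const_left _ _
      (Real.tendsto_exp_atTop.comp (tendsto_id.const_mul_atTop hb))
  have e : fermiDirac b = (fun x => 1 + Real.exp (b * x))⁻¹ := by ext x; simp [fermiDirac]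
  rw [e]
  exact h.inv_tendsto_atTop

/-- On a set of infinite measure, the chemical potential of the Fermi-Dirac distribution can be
adjusted so as to reach any mass. -/
theorem exists_chemicalPotential {α : Type*} [MeasurableSpace α] {ν : Measure α} {b : ℝ}
    (hb : 0 < b) {h : α → ℝ} (hi : ∀ μ, Integrable (fun z => fermiDirac b (h z - μ)) ν)
    (hν : ν univ = ⊤) {M : ℝ} (hM : 0 < M) : ∃ μ, ∫ z, fermiDirac b (h z - μ) ∂ν = M := by
  have hmono : ∀ z, Monotone fun μ => fermiDirac b (h z - μ) := fun z x y hxy =>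
    (fermiDirac_anti hb).antitone (by linarith)
  have hnn : ∀ z μ, 0 ≤ fermiDirac b (h z - μ) := fun z μ => (fermiDirac_pos _ _).le
  have hcont : Continuous fun μ => ∫ z, fermiDirac b (h z - μ) ∂ν := by
    rw [continuous_iff_continuousAt]
    intro μ₀
    refine continuousAt_of_dominated (Eventually.of_forall fun μ => (hi μ).1)
      (bound := fun z => fermiDirac b (h z - (μ₀ + 1))) ?_ (hi _)
      (Eventually.of_forall fun z => ?_)
    · filter_upwards [Iic_mem_nhds (lt_add_one μ₀)] with μ hμ
      refine Eventually.of_forall fun z => ?_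
      rw [Real.norm_of_nonneg (hnn z μ)]
      exact hmono z hμ
    · exact ((continuous_fermiDirac b).comp (continuous_const.sub continuous_id)).continuousAt
  have hlow : ∃ μ, ∫ z, fermiDirac b (h z - μ) ∂ν ≤ M := by
    have : Tendsto (fun μ => ∫ z, fermiDirac b (h z - μ) ∂ν) atBot (nhds (∫ z : α, (0 : ℝ) ∂ν)) := by
      refine tendsto_integral_filter_of_dominated_convergence
        (fun z => fermiDirac b (h z - 0)) (Eventually.of_forall fun μ => (hi μ).1) ?_ (hi 0)
        (Eventually.of_forall fun z => ?_)
      · filter_upwards [Iic_mem_atBot (0 : ℝ)] with μ hμ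
        refine Eventually.of_forall fun z => ?_
        rw [Real.norm_of_nonneg (hnn z μ)]
        exact hmono z hμ
      · exact (tendsto_fermiDirac_atTop hb).comp
          (tendsto_atTop_add_const_left _ _ tendsto_neg_atBot_atTop)
    rw [integral_zero] at this
    obtain ⟨μ, hμ⟩ := (this.eventually (gt_mem_nhds hM)).exists
    exact ⟨μ, hμ.le⟩
  have hhigh : ∃ μ, M ≤ ∫ z, fermiDirac b (h z - μ) ∂ν := by
    by_contra! hcon
    have h1 := (integrable_of_tendsto_of_integral_le (g := fun _ => (1 : ℝ))
      (f := fun (n : ℕ) z => fermiDirac b (h z - n)) (fun n => hi n)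
      (fun n => Eventually.of_forall fun z => hnn z n)
      (Eventually.of_forall fun z => (tendsto_fermiDirac_atBot hb).comp
        (tendsto_atBot_add_const_left _ _
          (tendsto_neg_atTop_atBot.comp tendsto_natCast_atTop_atTop)))
      (fun n => (hcon n).le)).1
    rw [integrable_const_iff] at h1
    rcases h1 with h1 | h1
    · exact one_ne_zero h1
    · exact absurd h1.measure_univ_lt_top (by simp [hν])
  exact mem_range_of_exists_le_of_exists_ge hcont hlow hhigh

theorem integrable_phase_of_integrable {d : ℕ} {m : Phase d → ℝ} (hm : IsPauliDensity m)
    {g : Pos d → ℝ} (hg : AEStronglyMeasurable g)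
    (h : Integrable fun x => g x * spatialDensity m x) :
    Integrable fun z : Phase d => g z.1 * m z := by
  have hmi := hm.1
  have hm2 := hm.2
  rw [Measure.volume_eq_prod] at hmi hm2 ⊢
  refine (integrable_prod_iff (f := fun z : Phase d => g z.1 * m z)
    (hg.comp_fst.mul hmi.1)).2 ⟨?_, ?_⟩
  · filter_upwards [hmi.prod_right_ae] with x hx
    exact hx.const_mul _
  · refine (h.norm.const_mul (κ[d])⁻¹).congr ?_
    filter_upwards [Measure.ae_ae_of_ae_prod hm2] with x hx
    have : ∫ p, ‖g x * m (x, p)‖ = ‖g x‖ * ∫ p, m (x, p) := by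
      rw [← integral_const_mul]
      refine integral_congr_ae ?_
      filter_upwards [hx] with p hp
      rw [norm_mul, Real.norm_of_nonneg hp.1]
    have h0 : 0 ≤ ∫ p, m (x, p) := integral_nonneg_of_ae (hx.mono fun p hp => hp.1)
    rw [this, norm_mul, spatialDensity, norm_mul, Real.norm_of_nonneg h0,
      Real.norm_of_nonneg (semiclassical_pos d).le]
    have := (semiclassical_pos d).ne'
    field_simp

/-- The effective one-particle energy at the density `m₀`. -/
noncomputable def effectiveEnergy {d : ℕ} (V : Pos d → ℝ) (A : Pos d → Pos d) (w : Pos d → ℝ)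
    (a ρ' : ℝ) (m₀ : Phase d → ℝ) (z : Phase d) : ℝ :=
  ‖z.2 + A z.1‖ ^ 2 + V z.1 + ρ'⁻¹ * meanField w a (spatialDensity m₀) z.1

/-- The Vlasov functional linearized in the interaction around the density `m₀`. -/
noncomputable def linearizedEnergy {d : ℕ} (V : Pos d → ℝ) (A : Pos d → Pos d) (w : Pos d → ℝ)
    (a β ρ' : ℝ) (m₀ m : Phase d → ℝ) : ℝ :=
  ∫ z, (effectiveEnergy V A w a ρ' m₀ z * m z + β⁻¹ * fermiEntropy (m z))

namespace VlasovAssumptions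

variable {d : ℕ} {β₀ : ℝ} {V : Pos d → ℝ} {A : Pos d → Pos d} {w : Pos d → ℝ} {a : ℝ}
  {m m₀ : Phase d → ℝ}

theorem aestronglyMeasurable_meanField (H : VlasovAssumptions β₀ V A w a)
    (hm₀ : IsPauliDensity m₀) : AEStronglyMeasurable (meanField w a (spatialDensity m₀)) :=
  (GoodDensity.aestronglyMeasurable_convolution H.meas_w hm₀.integrable_spatialDensity.1.1).add
    (hm₀.integrable_spatialDensity.1.1.const_mul a)

theorem aestronglyMeasurable_effectiveEnergy (H : VlasovAssumptions β₀ V A w a)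
    (hm₀ : IsPauliDensity m₀) (ρ' : ℝ) :
    AEStronglyMeasurable (effectiveEnergy V A w a ρ' m₀) :=
  (H.aestronglyMeasurable_kinetic.add (H.aestronglyMeasurable_V.comp_quasiMeasurePreserving
    Measure.quasiMeasurePreserving_fst)).add
    (((H.aestronglyMeasurable_meanField hm₀).comp_quasiMeasurePreserving
      Measure.quasiMeasurePreserving_fst).const_mul _)

theorem integral_meanField_mul (H : VlasovAssumptions β₀ V A w a) (hm₀ : FiniteEnergy V A a m₀)
    (hm : FiniteEnergy V A a m) :
    Integrable (fun z : Phase d => meanField w a (spatialDensity m₀) z.1 * m z) ∧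
      κ[d] * ∫ z : Phase d, meanField w a (spatialDensity m₀) z.1 * m z
        = interactionForm w a (spatialDensity m) (spatialDensity m₀) := by
  obtain ⟨i, e⟩ := (H.goodDensity hm).form_eq_meanField H.meas_w H.a_nonneg (H.goodDensity hm₀)
  simp only [mul_comm (spatialDensity m _)] at i e
  have j := integrable_phase_of_integrable hm.pauli (H.aestronglyMeasurable_meanField hm₀.pauli) i
  exact ⟨j, by rw [e, ← (integrable_mul_spatialDensity j).2]⟩

theorem integrable_effectiveEnergy_mul (H : VlasovAssumptions β₀ V A w a)
    (hm₀ : FiniteEnergy V A a m₀) (hm : FiniteEnergy V A a m) (ρ' : ℝ) :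
    Integrable fun z => effectiveEnergy V A w a ρ' m₀ z * m z := by
  refine ((H.integrable_potential hm.toConfined).add
    ((H.integral_meanField_mul hm₀ hm).1.const_mul ρ'⁻¹)).congr (Eventually.of_forall fun z => ?_)
  simp only [effectiveEnergy, Pi.add_apply]; ring

theorem linearizedEnergy_eq (H : VlasovAssumptions β₀ V A w a)
    (hm₀ : FiniteEnergy V A a m₀) (hm : FiniteEnergy V A a m) (β ρ' : ℝ) :
    κ[d] * linearizedEnergy V A w a β ρ' m₀ m
      = κ[d] * (∫ z : Phase d, (‖z.2 + A z.1‖ ^ 2 + V z.1) * m z)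
        + ρ'⁻¹ * interactionForm w a (spatialDensity m) (spatialDensity m₀)
        + ((2 * Real.pi) ^ d * β)⁻¹ * ∫ z, fermiEntropy (m z) := by
  have i1 := H.integrable_potential hm.toConfined
  obtain ⟨i2, e2⟩ := H.integral_meanField_mul hm₀ hm
  have i3 := H.integrable_fermiEntropy hm.toConfined
  have e : (fun z => effectiveEnergy V A w a ρ' m₀ z * m z + β⁻¹ * fermiEntropy (m z))
      = fun z : Phase d => ((‖z.2 + A z.1‖ ^ 2 + V z.1) * m z
        + ρ'⁻¹ * (meanField w a (spatialDensity m₀) z.1 * m z)) + β⁻¹ * fermiEntropy (m z) := by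
    ext z
    simp only [effectiveEnergy]; ring
  have i12 : Integrable fun z : Phase d => (‖z.2 + A z.1‖ ^ 2 + V z.1) * m z
        + ρ'⁻¹ * (meanField w a (spatialDensity m₀) z.1 * m z) := i1.add (i2.const_mul _)
  rw [linearizedEnergy, e, integral_add i12 (i3.const_mul _), integral_add i1 (i2.const_mul _),
    integral_const_mul, integral_const_mul, ← e2, mul_inv]
  ring

theorem interactionIntegral_convex_comb (H : VlasovAssumptions β₀ V A w a)
    (hm : FiniteEnergy V A a m) (hm₀ : FiniteEnergy V A a m₀) (t : ℝ) :
    interactionIntegral w a (spatialDensity fun z => t * m z + (1 - t) * m₀ z)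
      = t ^ 2 * interactionIntegral w a (spatialDensity m)
        + 2 * t * (1 - t) * interactionForm w a (spatialDensity m) (spatialDensity m₀)
        + (1 - t) ^ 2 * interactionIntegral w a (spatialDensity m₀) := by
  have he := spatialDensity_linear hm.pauli.1 hm₀.pauli.1 t (1 - t)
  rw [← (H.goodDensity hm).form_quadratic H.meas_w H.a_nonneg H.even_w (H.goodDensity hm₀),
    interactionIntegral_eq_form, interactionIntegral_eq_form]
  exact interactionForm_congr w a he he

theorem integral_fermiEntropy_convex_comb_le (H : VlasovAssumptions β₀ V A w a)
    (hm : FiniteEnergy V A a m) (hm₀ : FiniteEnergy V A a m₀) {t : ℝ} (h0 : 0 ≤ t) (h1 : t ≤ 1) :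
    ∫ z, fermiEntropy (t * m z + (1 - t) * m₀ z)
      ≤ t * (∫ z, fermiEntropy (m z)) + (1 - t) * ∫ z, fermiEntropy (m₀ z) := by
  have hc := H.finiteEnergy_convex hm hm₀ h0 h1
  have j1 := H.integrable_fermiEntropy hm.toConfined
  have j2 := H.integrable_fermiEntropy hm₀.toConfined
  rw [← integral_const_mul, ← integral_const_mul,
    ← integral_add (j1.const_mul t) (j2.const_mul (1 - t))]
  refine integral_mono_ae (H.integrable_fermiEntropy hc.toConfined)
    ((j1.const_mul t).add (j2.const_mul (1 - t))) ?_
  filter_upwards [hm.pauli.2, hm₀.pauli.2] with z a1 a2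
  exact strictConvexOn_fermiEntropy.convexOn.2 ⟨a1.1, a1.2⟩ ⟨a2.1, a2.2⟩ h0 (by linarith)
    (by ring)

/-- The Vlasov functional along a segment: the deviation from linearity is due to the interaction
and to the entropy. -/
theorem vlasovReal_convex_comb (H : VlasovAssumptions β₀ V A w a)
    (hm : FiniteEnergy V A a m) (hm₀ : FiniteEnergy V A a m₀) (β ρ' t : ℝ) :
    vlasovReal V A w a β ρ' (fun z => t * m z + (1 - t) * m₀ z)
      = t * vlasovReal V A w a β ρ' m + (1 - t) * vlasovReal V A w a β ρ' m₀
        - t * (1 - t) * (2 * ρ')⁻¹ * (interactionIntegral w a (spatialDensity m)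
          - 2 * interactionForm w a (spatialDensity m) (spatialDensity m₀)
          + interactionIntegral w a (spatialDensity m₀))
        - ((2 * Real.pi) ^ d * β)⁻¹ * (t * (∫ z, fermiEntropy (m z))
          + (1 - t) * (∫ z, fermiEntropy (m₀ z))
          - ∫ z, fermiEntropy (t * m z + (1 - t) * m₀ z)) := by
  have i1 := H.integrable_potential hm.toConfined
  have i2 := H.integrable_potential hm₀.toConfined
  have e1 : ∫ z : Phase d, (‖z.2 + A z.1‖ ^ 2 + V z.1) * (t * m z + (1 - t) * m₀ z)
      = t * (∫ z : Phase d, (‖z.2 + A z.1‖ ^ 2 + V z.1) * m z)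
        + (1 - t) * ∫ z : Phase d, (‖z.2 + A z.1‖ ^ 2 + V z.1) * m₀ z := by
    rw [← integral_const_mul, ← integral_const_mul,
      ← integral_add (i1.const_mul t) (i2.const_mul (1 - t))]
    refine integral_congr_ae (Eventually.of_forall fun z => ?_)
    beta_reduce; ring
  rw [vlasovReal, vlasovReal, vlasovReal, e1, H.interactionIntegral_convex_comb hm hm₀]
  ring

theorem vlasovReal_convex_comb_le (H : VlasovAssumptions β₀ V A w a)
    (hm : FiniteEnergy V A a m) (hm₀ : FiniteEnergy V A a m₀) {β : ℝ} (hβ : 0 < β) (ρ' : ℝ)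
    {t : ℝ} (h0 : 0 ≤ t) (h1 : t ≤ 1) :
    vlasovReal V A w a β ρ' (fun z => t * m z + (1 - t) * m₀ z)
      ≤ t * vlasovReal V A w a β ρ' m + (1 - t) * vlasovReal V A w a β ρ' m₀
        - t * (1 - t) * (2 * ρ')⁻¹ * (interactionIntegral w a (spatialDensity m)
          - 2 * interactionForm w a (spatialDensity m) (spatialDensity m₀)
          + interactionIntegral w a (spatialDensity m₀)) := by
  rw [H.vlasovReal_convex_comb hm hm₀]
  refine sub_le_self _ (mul_nonneg (by positivity) (sub_nonneg.2 ?_))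
  exact H.integral_fermiEntropy_convex_comb_le hm hm₀ h0 h1

/-- A minimizer also minimizes the linearized functional: the first order condition along the
segment to a competitor, in which the entropy stays as it is. -/
theorem linearizedEnergy_le (H : VlasovAssumptions β₀ V A w a) {β ρ' r : ℝ} (hβ : 0 < β)
    (hm₀ : FiniteEnergy V A a m₀) (hadm₀ : IsAdmissible r m₀)
    (hmin : ∀ m' : Phase d → ℝ, IsAdmissible r m' → FiniteEnergy V A a m' →
        vlasovReal V A w a β ρ' m₀ ≤ vlasovReal V A w a β ρ' m')
    (hm : FiniteEnergy V A a m) (hadm : IsAdmissible r m) :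
    linearizedEnergy V A w a β ρ' m₀ m₀ ≤ linearizedEnergy V A w a β ρ' m₀ m := by
  set Q := (2 * ρ')⁻¹ * (interactionIntegral w a (spatialDensity m)
    - 2 * interactionForm w a (spatialDensity m) (spatialDensity m₀)
    + interactionIntegral w a (spatialDensity m₀)) with hQ
  have key : ∀ t : ℝ, 0 < t → t ≤ 1 →
      0 ≤ vlasovReal V A w a β ρ' m - vlasovReal V A w a β ρ' m₀ - (1 - t) * Q := by
    intro t h0 h1
    have hadm' := hadm.convex hadm₀ h0.le h1
    rw [show t * r + (1 - t) * r = r by ring] at hadm'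
    have e1 := hmin _ hadm' (H.finiteEnergy_convex hm hm₀ h0.le h1)
    have e2 := H.vlasovReal_convex_comb_le hm hm₀ hβ ρ' h0.le h1
    have e3 : 0 ≤ t * (vlasovReal V A w a β ρ' m - vlasovReal V A w a β ρ' m₀ - (1 - t) * Q) := by
      rw [hQ]; linarith
    exact nonneg_of_mul_nonneg_right e3 h0
  have hlim : 0 ≤ vlasovReal V A w a β ρ' m - vlasovReal V A w a β ρ' m₀ - (1 - 0) * Q := by
    have hc : Continuous fun t : ℝ =>
        vlasovReal V A w a β ρ' m - vlasovReal V A w a β ρ' m₀ - (1 - t) * Q := by fun_prop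
    refine ge_of_tendsto ((hc.tendsto 0).mono_left
      (nhdsWithin_le_nhds (s := Ioi (0 : ℝ)))) ?_
    filter_upwards [Ioc_mem_nhdsGT one_pos] with t ht
    exact key t ht.1 ht.2
  have l1 := H.linearizedEnergy_eq hm₀ hm β ρ'
  have l2 := H.linearizedEnergy_eq hm₀ hm₀ β ρ'
  rw [← interactionIntegral_eq_form] at l2
  have hκ := semiclassical_pos d
  refine le_of_mul_le_mul_left ?_ hκ
  rw [l1, l2]
  rw [hQ, mul_inv] at hlim
  simp only [vlasovReal, mul_inv] at hlim ⊢
  linarith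

theorem meanField_lower_bound (H : VlasovAssumptions β₀ V A w a)
    (hm₀ : FiniteEnergy V A a m₀) :
    ∃ D, ∀ᵐ x, -D ≤ meanField w a (spatialDensity m₀) x := by
  obtain ⟨D, hD⟩ := (H.goodDensity hm₀).bounded
  refine ⟨D, ?_⟩
  filter_upwards [hm₀.pauli.spatialDensity_nonneg] with x hx
  have h1 := (abs_integral_le_integral_abs).trans (hD x).2
  have h2 := mul_nonneg H.a_nonneg hx
  unfold meanField
  linarith [(abs_le.1 h1).1]

/-- Where the negative part of the potential is bounded, the Fermi-Dirac distribution of the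
effective energy decays like the Boltzmann factor of the confinement. -/
theorem fermiDirac_bound (H : VlasovAssumptions β₀ V A w a) {β ρ' : ℝ} (hβ : β₀ < β)
    (hρ' : 0 < ρ') (hm₀ : FiniteEnergy V A a m₀) (N : ℝ) (μ : ℝ) :
    ∃ C, ∀ᵐ z : Phase d, max (-V z.1) 0 ≤ N →
      fermiDirac β (effectiveEnergy V A w a ρ' m₀ z - μ)
        ≤ C * Real.exp (-β * confinement V A z) := by
  obtain ⟨D, hD⟩ := H.meanField_lower_bound hm₀
  have hβp : 0 < β := H.beta_pos.trans hβ
  refine ⟨Real.exp (β * (N + ρ'⁻¹ * D + μ)), ?_⟩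
  filter_upwards [ae_fst hD] with z hz hN
  refine (fermiDirac_le_exp _ _).trans ?_
  rw [← Real.exp_add]
  refine Real.exp_le_exp.2 ?_
  have h1 := mul_le_mul_of_nonneg_left hz (inv_pos.2 hρ').le
  have h2 : confinement V A z - (N + ρ'⁻¹ * D + μ) ≤ effectiveEnergy V A w a ρ' m₀ z - μ := by
    rw [effectiveEnergy, energy_eq]
    linarith
  have := mul_le_mul_of_nonneg_left h2 hβp.le
  linarith

/-- A minimizer is a Fermi-Dirac distribution wherever the negative part of the potential is
bounded and some of the mass is present. The bound makes the Fermi-Dirac distribution of the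
same mass an admissible competitor, and Gibbs' principle compares the two pointwise. -/
theorem eq_fermiDirac_on (H : VlasovAssumptions β₀ V A w a) {β ρ' r : ℝ} (hβ : β₀ < β)
    (hρ' : 0 < ρ') (hm₀ : FiniteEnergy V A a m₀) (hadm₀ : IsAdmissible r m₀)
    (hmin : ∀ m' : Phase d → ℝ, IsAdmissible r m' → FiniteEnergy V A a m' →
        vlasovReal V A w a β ρ' m₀ ≤ vlasovReal V A w a β ρ' m')
    {B : Set (Pos d)} (hB : MeasurableSet B) {N : ℝ} (hN : ∀ᵐ x, x ∈ B → max (-V x) 0 ≤ N)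
    (hpos : 0 < ∫ z in Prod.fst ⁻¹' B, m₀ z) :
    ∃ μ, ∀ᵐ z : Phase d, z.1 ∈ B →
      m₀ z = fermiDirac β (effectiveEnergy V A w a ρ' m₀ z - μ) := by
  have hb := H.beta_pos
  have hβp : 0 < β := hb.trans hβ
  set S : Set (Phase d) := Prod.fst ⁻¹' B with hS
  have hSm : MeasurableSet S := measurable_fst hB
  have hNS : ∀ᵐ z : Phase d, z ∈ S → max (-V z.1) 0 ≤ N := ae_fst hN
  have hhm := H.aestronglyMeasurable_effectiveEnergy hm₀.pauli ρ'
  have hfm : ∀ μ, AEStronglyMeasurable fun z => fermiDirac β (effectiveEnergy V A w a ρ' m₀ z - μ) :=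
    fun μ => (continuous_fermiDirac β).comp_aestronglyMeasurable (hhm.sub aestronglyMeasurable_const)
  have hdom : ∀ z, Real.exp (-β * confinement V A z) ≤ Real.exp (-β₀ * confinement V A z) :=
    fun z => Real.exp_le_exp.2 (by nlinarith [confinement_nonneg V A z])
  have hfi : ∀ μ, IntegrableOn (fun z => fermiDirac β (effectiveEnergy V A w a ρ' m₀ z - μ)) S := by
    intro μ
    obtain ⟨C, hC⟩ := H.fermiDirac_bound hβ hρ' hm₀ N μ
    refine ((H.integrable_exp_confinement.const_mul |C|).integrableOn).mono' (hfm μ).restrict ?_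
    rw [ae_restrict_iff' hSm]
    filter_upwards [hC, hNS] with z h1 h2 hz
    rw [Real.norm_of_nonneg (fermiDirac_pos _ _).le]
    refine (h1 (h2 hz)).trans ?_
    exact mul_le_mul (le_abs_self C) (hdom z) (Real.exp_pos _).le (abs_nonneg C)
  have hvol : (volume : Measure (Phase d)).restrict S univ = ⊤ := by
    have hd := H.dim_pos
    have : Nonempty (Fin d) := ⟨⟨0, hd⟩⟩
    rw [Measure.restrict_apply_univ, hS, ← prod_univ, Measure.volume_eq_prod, Measure.prod_prod]
    have hB0 : volume B ≠ 0 := by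
      intro h0
      have : volume S = 0 := by
        rw [hS, ← prod_univ, Measure.volume_eq_prod, Measure.prod_prod, h0, zero_mul]
      rw [setIntegral_measure_zero _ this] at hpos
      exact lt_irrefl _ hpos
    rw [measure_univ_of_isAddLeftInvariant, ENNReal.mul_top hB0]
  obtain ⟨μ, hμ⟩ := exists_chemicalPotential hβp hfi hvol hpos
  refine ⟨μ, ?_⟩
  set f : Phase d → ℝ := fun z => fermiDirac β (effectiveEnergy V A w a ρ' m₀ z - μ) with hf
  -- the competitor: Fermi-Dirac over `B`, the given density elsewhere
  classical
  set m₁ : Phase d → ℝ := S.piecewise f m₀ with hm₁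
  obtain ⟨C, hC⟩ := H.fermiDirac_bound hβ hρ' hm₀ N μ
  have hm₁i : Integrable m₁ := Integrable.piecewise hSm (hfi μ) hm₀.pauli.1.integrableOn
  have hm₁p : IsPauliDensity m₁ := by
    refine ⟨hm₁i, ?_⟩
    filter_upwards [hm₀.pauli.2] with z hz
    by_cases hzS : z ∈ S
    · rw [hm₁, piecewise_eq_of_mem _ _ _ hzS]
      exact ⟨(fermiDirac_pos _ _).le, (fermiDirac_lt_one _ _).le⟩
    · rw [hm₁, piecewise_eq_of_notMem _ _ _ hzS]
      exact hz
  have hm₁mass : ∫ z, m₁ z = ∫ z, m₀ z := by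
    rw [← integral_add_compl hSm hm₁i, ← integral_add_compl hSm hm₀.pauli.1, ← hμ]
    congr 1
    · exact setIntegral_congr_fun hSm fun z hz => piecewise_eq_of_mem _ _ _ hz
    · exact setIntegral_congr_fun hSm.compl fun z hz => piecewise_eq_of_notMem _ _ _ hz
  have hadm₁ : IsAdmissible r m₁ := ⟨hm₁p, by rw [hm₁mass]; exact hadm₀.2⟩
  have hC0 : ∀ z, C * Real.exp (-β * confinement V A z)
      ≤ |C| * Real.exp (-β * confinement V A z) := fun z => by
    gcongr; exact le_abs_self C
  have hfin₁ : FiniteEnergy V A a m₁ := by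
    refine ⟨⟨hm₁p, ?_⟩, ?_⟩
    · refine ((H.integrable_exp_confinement.const_mul (|C| * (β - β₀)⁻¹)).add hm₀.conf).mono'
        (H.aestronglyMeasurable_confinement.mul hm₁i.1) ?_
      filter_upwards [hC, hNS, hm₁p.2, hm₀.pauli.2] with z h1 h2 h3 h4
      have hT := confinement_nonneg V A z
      rw [Real.norm_of_nonneg (mul_nonneg hT h3.1)]
      simp only [Pi.add_apply]
      by_cases hzS : z ∈ S
      · rw [hm₁, piecewise_eq_of_mem _ _ _ hzS]
        have hβd : 0 < β - β₀ := by linarith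
        -- `T e^{-(β - β₀) T}` is bounded
        have g1 : confinement V A z * Real.exp (-β * confinement V A z)
            ≤ (β - β₀)⁻¹ * Real.exp (-β₀ * confinement V A z) := by
          have e1 : Real.exp (-β * confinement V A z)
              = Real.exp (-β₀ * confinement V A z)
                * Real.exp (-((β - β₀) * confinement V A z)) := by
            rw [← Real.exp_add]; congr 1; ring
          have e2 : confinement V A z * Real.exp (-((β - β₀) * confinement V A z))
              ≤ (β - β₀)⁻¹ := by
            rw [Real.exp_neg, ← div_eq_mul_inv, div_le_iff₀ (Real.exp_pos _)]
            have := Real.add_one_le_exp ((β - β₀) * confinement V A z)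
            calc confinement V A z = (β - β₀)⁻¹ * ((β - β₀) * confinement V A z) := by field_simp
              _ ≤ (β - β₀)⁻¹ * Real.exp ((β - β₀) * confinement V A z) := by gcongr; linarith
          rw [e1]
          have := mul_le_mul_of_nonneg_left e2 (Real.exp_pos (-β₀ * confinement V A z)).le
          linarith
        calc confinement V A z * f z
            ≤ confinement V A z * (|C| * Real.exp (-β * confinement V A z)) :=
              mul_le_mul_of_nonneg_left ((h1 (h2 hzS)).trans (hC0 z)) hT
          _ = |C| * (confinement V A z * Real.exp (-β * confinement V A z)) := by ring
          _ ≤ |C| * ((β - β₀)⁻¹ * Real.exp (-β₀ * confinement V A z)) := by gcongr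
          _ = |C| * (β - β₀)⁻¹ * Real.exp (-β₀ * confinement V A z) := by ring
          _ ≤ _ := le_add_of_nonneg_right (mul_nonneg hT h4.1)
      · rw [hm₁, piecewise_eq_of_notMem _ _ _ hzS]
        have : 0 ≤ |C| * (β - β₀)⁻¹ * Real.exp (-β₀ * confinement V A z) := by
          have : 0 < β - β₀ := by linarith
          positivity
        linarith
    · refine integrable_sq_of_le (A := A) H.a_nonneg hm₁p hm₀.pauli hm₀.sq hβp (C := |C|) ?_
      filter_upwards [hC, hNS, hm₀.pauli.2] with z h1 h2 h4
      by_cases hzS : z ∈ S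
      · rw [hm₁, piecewise_eq_of_mem _ _ _ hzS]
        refine ((h1 (h2 hzS)).trans (hC0 z)).trans ?_
        have : Real.exp (-β * confinement V A z) ≤ Real.exp (-β * ‖z.2 + A z.1‖ ^ 2) := by
          refine Real.exp_le_exp.2 ?_
          have : ‖z.2 + A z.1‖ ^ 2 ≤ confinement V A z := by simp [confinement]
          nlinarith
        have := mul_le_mul_of_nonneg_left this (abs_nonneg C)
        linarith [h4.1]
      · rw [hm₁, piecewise_eq_of_notMem _ _ _ hzS]
        have : 0 ≤ |C| * Real.exp (-β * ‖z.2 + A z.1‖ ^ 2) := by positivity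
        linarith
  have hle := H.linearizedEnergy_le hβp hm₀ hadm₀ hmin hfin₁ hadm₁
  -- the integrand of the difference is nonnegative, so it vanishes
  set h := effectiveEnergy V A w a ρ' m₀ with hh
  have k0 : Integrable fun z => h z * m₀ z + β⁻¹ * fermiEntropy (m₀ z) :=
    (H.integrable_effectiveEnergy_mul hm₀ hm₀ ρ').add
      ((H.integrable_fermiEntropy hm₀.toConfined).const_mul _)
  have k1 : Integrable fun z => h z * m₁ z + β⁻¹ * fermiEntropy (m₁ z) :=
    (H.integrable_effectiveEnergy_mul hm₀ hfin₁ ρ').add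
      ((H.integrable_fermiEntropy hfin₁.toConfined).const_mul _)
  have k0' : Integrable fun z => (h z * m₀ z + β⁻¹ * fermiEntropy (m₀ z)) - μ * m₀ z :=
    k0.sub (hm₀.pauli.1.const_mul μ)
  have k1' : Integrable fun z => (h z * m₁ z + β⁻¹ * fermiEntropy (m₁ z)) - μ * m₁ z :=
    k1.sub (hm₁i.const_mul μ)
  set D : Phase d → ℝ := fun z => ((h z * m₀ z + β⁻¹ * fermiEntropy (m₀ z)) - μ * m₀ z)
    - ((h z * m₁ z + β⁻¹ * fermiEntropy (m₁ z)) - μ * m₁ z) with hD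
  have hDint : ∫ z, D z ≤ 0 := by
    rw [hD, integral_sub k0' k1', integral_sub k0 (hm₀.pauli.1.const_mul μ),
      integral_sub k1 (hm₁i.const_mul μ), integral_const_mul, integral_const_mul, hm₁mass]
    unfold linearizedEnergy at hle
    linarith
  have hD0 : 0 ≤ᵐ[volume] D := by
    filter_upwards [hm₀.pauli.2] with z hz
    simp only [hD, Pi.zero_apply]
    by_cases hzS : z ∈ S
    · rw [hm₁, piecewise_eq_of_mem _ _ _ hzS]
      have := fermiDirac_energy_le hβp (h z - μ) hz.1 hz.2
      simp only [hf]
      linarith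
    · rw [hm₁, piecewise_eq_of_notMem _ _ _ hzS]
      simp
  have hDz := (integral_eq_zero_iff_of_nonneg_ae hD0 (k0'.sub k1')).1
    (le_antisymm hDint (integral_nonneg_of_ae hD0))
  filter_upwards [hDz, hm₀.pauli.2] with z h1 h2 hzS
  refine eq_fermiDirac_of_energy_le hβp _ h2.1 h2.2 ?_
  simp only [hD, Pi.zero_apply] at h1
  rw [hm₁, piecewise_eq_of_mem _ _ _ (show z ∈ S from hzS)] at h1
  simp only [hf] at h1
  linarith

/-- The Euler-Lagrange equation, obtained on an exhaustion of space by sets on which the negative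
part of the potential is bounded; the chemical potentials on these sets agree. -/
theorem exists_solvesFermiDirac (H : VlasovAssumptions β₀ V A w a) {β ρ' r : ℝ} (hβ : β₀ < β)
    (hρ' : 0 < ρ') (hr : 0 < r) (hm₀ : FiniteEnergy V A a m₀) (hadm₀ : IsAdmissible r m₀)
    (hmin : ∀ m' : Phase d → ℝ, IsAdmissible r m' → FiniteEnergy V A a m' →
        vlasovReal V A w a β ρ' m₀ ≤ vlasovReal V A w a β ρ' m') :
    ∃ μ, SolvesFermiDirac V A w a β ρ' μ m₀ := by
  have hβp : 0 < β := H.beta_pos.trans hβ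
  set g := H.memLp_neg.1.mk _ with hg
  have hgm : Measurable g := H.memLp_neg.1.stronglyMeasurable_mk.measurable
  let B : ℕ → Set (Pos d) := fun n => {x | g x ≤ n}
  have hBm : ∀ n, MeasurableSet (B n) := fun n => measurableSet_le hgm measurable_const
  have hBN : ∀ n, ∀ᵐ x, x ∈ B n → max (-V x) 0 ≤ (n : ℝ) := by
    intro n
    filter_upwards [H.memLp_neg.1.ae_eq_mk] with x hx hxB
    rw [hx]
    exact hxB
  have hmono : Monotone B := by
    intro n k hnk x hx
    have hx' : g x ≤ n := hx
    exact hx'.trans (by exact_mod_cast hnk : (n : ℝ) ≤ k)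
  have hU : ⋃ n, (Prod.fst ⁻¹' B n : Set (Phase d)) = univ :=
    eq_univ_of_forall fun z => mem_iUnion.2 (exists_nat_ge (g z.1))
  have hlim : Tendsto (fun n => ∫ z in Prod.fst ⁻¹' B n, m₀ z) atTop (nhds (∫ z, m₀ z)) := by
    have := tendsto_setIntegral_of_monotone (μ := (volume : Measure (Phase d)))
      (s := fun n => Prod.fst ⁻¹' B n) (f := m₀) (fun n => measurable_fst (hBm n))
      (fun n k hnk => preimage_mono (hmono hnk)) (by rw [hU]; exact hm₀.pauli.1.integrableOn)
    rwa [hU, setIntegral_univ] at this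
  have hmass : 0 < ∫ z, m₀ z := by
    have h := hadm₀.2
    have hκ := semiclassical_pos d
    by_contra hn
    have := mul_nonpos_of_nonneg_of_nonpos hκ.le (not_lt.1 hn)
    linarith
  obtain ⟨N, hN⟩ := eventually_atTop.1 (hlim.eventually (lt_mem_nhds hmass))
  have key : ∀ n, N ≤ n → ∃ μ, ∀ᵐ z : Phase d, z.1 ∈ B n →
      m₀ z = fermiDirac β (effectiveEnergy V A w a ρ' m₀ z - μ) := fun n hn =>
    H.eq_fermiDirac_on hβ hρ' hm₀ hadm₀ hmin (hBm n) (hBN n) (hN n hn)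
  obtain ⟨μ, hμ⟩ := key N le_rfl
  have hB0 : volume (Prod.fst ⁻¹' B N : Set (Phase d)) ≠ 0 := by
    intro h0
    have := hN N le_rfl
    rw [setIntegral_measure_zero _ h0] at this
    exact lt_irrefl _ this
  have hall : ∀ n, ∀ᵐ z : Phase d, z.1 ∈ B n →
      m₀ z = fermiDirac β (effectiveEnergy V A w a ρ' m₀ z - μ) := by
    intro n
    obtain ⟨μ', hμ'⟩ := key (max N n) (le_max_left _ _)
    -- both equations hold over the set `B N`, of positive measure, so `μ' = μ`
    have hfreq : ∃ z : Phase d, z.1 ∈ B N ∧ (z.1 ∈ B N →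
        m₀ z = fermiDirac β (effectiveEnergy V A w a ρ' m₀ z - μ)) ∧ (z.1 ∈ B (max N n) →
        m₀ z = fermiDirac β (effectiveEnergy V A w a ρ' m₀ z - μ')) := by
      have : ∃ᵐ z : Phase d, z ∈ (Prod.fst ⁻¹' B N : Set (Phase d)) :=
        frequently_ae_mem_iff.2 hB0
      obtain ⟨z, h1, h2, h3⟩ := (this.and_eventually (hμ.and hμ')).exists
      exact ⟨z, h1, h2, h3⟩
    obtain ⟨z, h1, h2, h3⟩ := hfreq
    have e := (h2 h1).symm.trans (h3 (hmono (le_max_left _ _) h1))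
    have e' := (fermiDirac_anti hβp).injective e
    have hμμ : μ' = μ := by linarith
    rw [hμμ] at hμ'
    filter_upwards [hμ'] with z hz hzn
    exact hz (hmono (le_max_right _ _) hzn)
  refine ⟨μ, Eventually.of_forall fun x => H.integrable_translate_mul hm₀.toConfined x, ?_⟩
  filter_upwards [ae_all_iff.2 hall] with z hz
  obtain ⟨n, hn⟩ := exists_nat_ge (g z.1)
  exact hz n hn

end VlasovAssumptions

/-! ### Positivity of interactions with nonnegative Fourier transform -/

/-- The Fourier transform of the reflection of a real function is the complex conjugate. -/
theorem fourier_reflection {d : ℕ} (g : Pos d → ℝ) (ξ : Pos d) :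
    𝓕 (fun x : Pos d => (g (-x) : ℂ)) ξ = starRingEnd ℂ (𝓕 (fun x : Pos d => (g x : ℂ)) ξ) := by
  rw [Real.fourier_eq', Real.fourier_eq', ← integral_conj,
    ← integral_neg_eq_self (fun x : Pos d => Complex.exp _ • _)]
  refine integral_congr_ae (Eventually.of_forall fun x => ?_)
  simp only [neg_neg, smul_eq_mul, map_mul, Complex.conj_ofReal, ← Complex.exp_conj, inner_neg_left]
  congr 2
  simp

/-- On smooth compactly supported functions, the interaction form is nonnegative: it is the
pairing of the interaction with an autocorrelation, whose inverse Fourier transform is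
a squared modulus. -/
theorem form_nonneg_of_smooth {d : ℕ} {w : Pos d → ℝ} {a : ℝ} (hF : HasNonnegFourier w a)
    (hw : AEStronglyMeasurable w) {g : Pos d → ℝ} (hg : ContDiff ℝ ((⊤ : ℕ∞) : WithTop ℕ∞) g)
    (hc : HasCompactSupport g) (hgood : GoodDensity w a g) : 0 ≤ interactionForm w a g g := by
  have hGs : ContDiff ℝ ((⊤ : ℕ∞) : WithTop ℕ∞) fun x : Pos d => (g x : ℂ) :=
    Complex.ofRealCLM.contDiff.comp hg
  have hGc : HasCompactSupport fun x : Pos d => (g x : ℂ) :=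
    hc.comp_left (g := fun t : ℝ => (t : ℂ)) (by simp)
  have hRs : ContDiff ℝ ((⊤ : ℕ∞) : WithTop ℕ∞) fun x : Pos d => (g (-x) : ℂ) :=
    hGs.comp contDiff_neg
  have hRc : HasCompactSupport fun x : Pos d => (g (-x) : ℂ) :=
    hGc.comp_homeomorph (Homeomorph.neg _)
  set G : 𝓢(Pos d, ℂ) := hGc.toSchwartzMap hGs with hG
  set R : 𝓢(Pos d, ℂ) := hRc.toSchwartzMap hRs with hR
  set h : Pos d → ℝ := fun z => ∫ x, g x * g (x - z) with hh
  set c : 𝓢(Pos d, ℂ) := SchwartzMap.convolution (ContinuousLinearMap.mul ℂ ℂ) G R with hcdef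
  have hcv : ∀ z, c z = (h z : ℂ) := by
    intro z
    rw [hcdef, SchwartzMap.convolution_apply, convolution_def]
    refine Eq.trans ?_ integral_complex_ofReal
    refine integral_congr_ae (Eventually.of_forall fun x => ?_)
    change (g x : ℂ) * (g (-(z - x)) : ℂ) = ((g x * g (x - z) : ℝ) : ℂ)
    rw [neg_sub, Complex.ofReal_mul]
  have hpos : ∀ ξ, 0 ≤ (𝓕⁻ c : 𝓢(Pos d, ℂ)) ξ := by
    intro ξ
    have e : (𝓕⁻ c : 𝓢(Pos d, ℂ)) ξ
        = 𝓕 (fun x : Pos d => (g x : ℂ)) (-ξ) * 𝓕 (fun x : Pos d => (g (-x) : ℂ)) (-ξ) := by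
      rw [SchwartzMap.fourierInv_coe, Real.fourierInv_eq_fourier_neg, ← SchwartzMap.fourier_coe,
        hcdef, SchwartzMap.fourier_convolution]
      rfl
    rw [e, fourier_reflection, Complex.mul_conj]
    exact_mod_cast Complex.normSq_nonneg _
  have key := hF (𝓕⁻ c) hpos
  rw [FourierTransform.fourier_fourierInv_eq] at key
  simp only [hcv] at key
  have key' : 0 ≤ (∫ x, w x * h x) + a * h 0 := by
    have e : (∫ x, (w x : ℂ) * (h x : ℂ)) = ((∫ x, w x * h x : ℝ) : ℂ) := by
      refine Eq.trans ?_ integral_complex_ofReal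
      refine integral_congr_ae (Eventually.of_forall fun x => ?_)
      simp
    rw [e] at key
    exact_mod_cast key
  have hmp : MeasurePreserving (fun z : Pos d × Pos d => (z.1, z.1 - z.2)) volume volume := by
    refine (MeasurePreserving.id (volume : Measure (Pos d))).skew_product
      (g := fun x y => x - y) (by fun_prop) ?_
    exact Eventually.of_forall fun x => (Measure.measurePreserving_sub_left volume x).map_eq
  have hi := hgood.integrable_kernel hw hgood
  have hi2 : Integrable fun z : Pos d × Pos d => w z.2 * (g z.1 * g (z.1 - z.2)) := by
    have := hmp.integrable_comp_of_integrable hi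
    refine this.congr (Eventually.of_forall fun z => ?_)
    simp only [Function.comp_apply, sub_sub_cancel]
    ring
  rw [Measure.volume_eq_prod] at hi hi2
  have e1 : ∫ z : Pos d × Pos d, w (z.1 - z.2) * g z.1 * g z.2 = ∫ x, w x * h x := by
    rw [Measure.volume_eq_prod, integral_prod _ hi]
    calc ∫ x, ∫ y, w (x - y) * g x * g y = ∫ x, ∫ z, w z * (g x * g (x - z)) := by
          refine integral_congr_ae (Eventually.of_forall fun x => ?_)
          beta_reduce
          rw [← integral_sub_left_eq_self _ volume x]
          refine integral_congr_ae (Eventually.of_forall fun z => ?_)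
          simp only [sub_sub_cancel]
          ring
      _ = ∫ z, ∫ x, w z * (g x * g (x - z)) :=
          integral_integral_swap (f := fun x z => w z * (g x * g (x - z))) hi2
      _ = ∫ x, w x * h x := by
          refine integral_congr_ae (Eventually.of_forall fun z => ?_)
          simp only [hh]
          rw [integral_const_mul]
  have e2 : ∫ x, a * (g x * g x) = a * h 0 := by
    rw [integral_const_mul]
    simp [hh]
  rw [interactionForm, e1, e2]
  exact key'

/-- Dominated convergence for the interaction form. -/
theorem form_tendsto {d : ℕ} {w : Pos d → ℝ} {a : ℝ} (ha : 0 ≤ a) (hw : AEStronglyMeasurable w)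
    {b f : Pos d → ℝ} (hb : GoodDensity w a b) {u : ℕ → Pos d → ℝ}
    (hu : ∀ k, AEStronglyMeasurable (u k)) (hle : ∀ k, ∀ᵐ x, |u k x| ≤ |b x|)
    (hlim : ∀ᵐ x, Tendsto (fun k => u k x) atTop (nhds (f x))) :
    Tendsto (fun k => interactionForm w a (u k) (u k)) atTop (nhds (interactionForm w a f f)) := by
  refine Tendsto.add ?_ ?_
  · refine tendsto_integral_of_dominated_convergence
      (fun z : Pos d × Pos d => |w (z.1 - z.2) * b z.1 * b z.2|)
      (fun k => GoodDensity.aestronglyMeasurable_kernel hw (hu k) (hu k))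
      (hb.integrable_kernel hw hb).abs (fun k => ?_) ?_
    · filter_upwards [Measure.quasiMeasurePreserving_fst.ae (hle k),
        Measure.quasiMeasurePreserving_snd.ae (hle k)] with z h1 h2
      rw [Real.norm_eq_abs, abs_mul, abs_mul, abs_mul, abs_mul]
      gcongr
    · filter_upwards [Measure.quasiMeasurePreserving_fst.ae hlim,
        Measure.quasiMeasurePreserving_snd.ae hlim] with z h1 h2
      exact (h1.const_mul _).mul h2
  · refine tendsto_integral_of_dominated_convergence (fun x => a * b x ^ 2)
      (fun k => ((hu k).mul (hu k)).const_mul a) hb.sq (fun k => ?_) ?_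
    · filter_upwards [hle k] with x hx
      rw [norm_mul, Real.norm_eq_abs, abs_of_nonneg ha, Real.norm_eq_abs, abs_mul, ← sq_abs (b x),
        sq]
      gcongr
    · filter_upwards [hlim] with x hx
      exact (hx.mul hx).const_mul a

namespace VlasovAssumptions

variable {d : ℕ} {β₀ : ℝ} {V : Pos d → ℝ} {A : Pos d → Pos d} {w : Pos d → ℝ} {a : ℝ}

theorem goodDensity_of_bounded (H : VlasovAssumptions β₀ V A w a) {f : Pos d → ℝ}
    (hf : AEStronglyMeasurable f) {M R : ℝ}
    (hM : ∀ x, |f x| ≤ (Metric.closedBall (0 : Pos d) R).indicator (fun _ => M) x) :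
    GoodDensity w a f := by
  have hbi : Integrable ((Metric.closedBall (0 : Pos d) R).indicator fun _ => M) :=
    (integrable_indicator_iff measurableSet_closedBall).2
      (integrableOn_const (by exact measure_closedBall_lt_top.ne))
  have hbi2 : Integrable ((Metric.closedBall (0 : Pos d) R).indicator fun _ => a * M ^ 2) :=
    (integrable_indicator_iff measurableSet_closedBall).2
      (integrableOn_const (by exact measure_closedBall_lt_top.ne))
  obtain ⟨w₁, C, hw₁, hC, hle⟩ := H.split_w
  have hq : (1 + (d : ℝ≥0∞) / 2).toReal = 1 + (d : ℝ) / 2 := by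
    rw [ENNReal.toReal_add (by simp) (by finiteness)]; simp
  have hgi : Integrable fun x => |w₁ x| ^ (1 + (d : ℝ) / 2) := by
    have := hw₁.integrable_norm_rpow (by simp) (by finiteness)
    rw [hq] at this
    simpa using this
  have hpow : ∀ t : ℝ, 0 ≤ t → t ≤ 1 + t ^ (1 + (d : ℝ) / 2) := by
    intro t ht
    rcases le_total t 1 with h1 | h1
    · have : 0 ≤ t ^ (1 + (d : ℝ) / 2) := by positivity
      linarith
    · have : t ^ (1 : ℝ) ≤ t ^ (1 + (d : ℝ) / 2) :=
        Real.rpow_le_rpow_of_exponent_le h1 (by linarith [show (0 : ℝ) ≤ d / 2 by positivity])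
      rw [Real.rpow_one] at this
      linarith
  set b : Pos d → ℝ := (Metric.closedBall (0 : Pos d) R).indicator fun _ => M with hb
  have hb0 : ∀ x, 0 ≤ b x := fun x => (abs_nonneg _).trans (hM x)
  have hbM : ∀ x, b x ≤ |M| := fun x => by
    by_cases hx : x ∈ Metric.closedBall (0 : Pos d) R
    · simpa only [hb, indicator_of_mem hx] using le_abs_self M
    · simpa only [hb, indicator_of_notMem hx] using abs_nonneg M
  have hbb : ∀ x y, |w₁ (x - y)| * b y ≤ |M| * |w₁ (x - y)| ^ (1 + (d : ℝ) / 2) + b y := by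
    intro x y
    have hp : 0 ≤ |w₁ (x - y)| ^ (1 + (d : ℝ) / 2) := by positivity
    nlinarith [mul_le_mul_of_nonneg_right (hpow _ (abs_nonneg (w₁ (x - y)))) (hb0 y),
      mul_le_mul_of_nonneg_right (hbM y) hp]
  have hdom : ∀ x, ∀ᵐ y, |w (x - y) * f y|
      ≤ |M| * |w₁ (x - y)| ^ (1 + (d : ℝ) / 2) + (1 + C) * b y := by
    intro x
    filter_upwards [(Measure.measurePreserving_sub_left volume x).quasiMeasurePreserving.ae hle]
      with y hy
    rw [abs_mul]
    have h1 : |w (x - y)| * |f y| ≤ (|w₁ (x - y)| + C) * b y :=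
      mul_le_mul hy (hM y) (abs_nonneg _) (by positivity)
    linarith [hbb x y]
  have hdi : ∀ x, Integrable fun y => |M| * |w₁ (x - y)| ^ (1 + (d : ℝ) / 2) + (1 + C) * b y :=
    fun x => ((hgi.comp_sub_left x).const_mul _).add (hbi.const_mul _)
  have hint : ∀ x, Integrable fun y => w (x - y) * f y := fun x =>
    (hdi x).mono' ((H.aestronglyMeasurable_translate x).mul hf) (hdom x)
  refine ⟨hbi.mono' hf (Eventually.of_forall hM),
    ⟨|M| * (∫ y, |w₁ y| ^ (1 + (d : ℝ) / 2)) + (1 + C) * ∫ y, b y, fun x => ⟨hint x, ?_⟩⟩, ?_⟩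
  · refine (integral_mono_ae (hint x).abs (hdi x) (hdom x)).trans (le_of_eq ?_)
    rw [integral_add ((hgi.comp_sub_left x).const_mul _) (hbi.const_mul _), integral_const_mul,
      integral_const_mul, integral_sub_left_eq_self (fun y => |w₁ y| ^ (1 + (d : ℝ) / 2)) volume x]
  · refine hbi2.mono' ((hf.pow 2).const_mul a) (Eventually.of_forall fun x => ?_)
    have h := hM x
    have ha := H.a_nonneg
    rw [Real.norm_of_nonneg (by positivity)]
    by_cases hx : x ∈ Metric.closedBall (0 : Pos d) R
    · rw [hb, indicator_of_mem hx] at h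
      rw [indicator_of_mem hx, ← sq_abs]
      gcongr
    · rw [hb, indicator_of_notMem hx] at h
      rw [indicator_of_notMem hx, abs_nonpos_iff.1 h]
      simp

/-- Mollification extends the positivity of the interaction form from smooth functions to
bounded functions with bounded support. -/
theorem form_nonneg_of_bounded (H : VlasovAssumptions β₀ V A w a) (hF : HasNonnegFourier w a)
    {f : Pos d → ℝ} (hf : AEStronglyMeasurable f) {M R : ℝ} (hM0 : 0 ≤ M)
    (hM : ∀ x, |f x| ≤ (Metric.closedBall (0 : Pos d) R).indicator (fun _ => M) x) :
    0 ≤ interactionForm w a f f := by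
  let φ : ℕ → ContDiffBump (0 : Pos d) := fun k =>
    { rIn := 1 / (2 * ((k : ℝ) + 1))
      rOut := 1 / ((k : ℝ) + 1)
      rIn_pos := by positivity
      rIn_lt_rOut := by
        refine one_div_lt_one_div_of_lt (by positivity) ?_
        have : (0 : ℝ) ≤ k := k.cast_nonneg
        linarith }
  have hφ1 : ∀ k, (φ k).rOut ≤ 1 := fun k => by
    change 1 / ((k : ℝ) + 1) ≤ 1
    rw [div_le_one (by positivity)]
    have : (0 : ℝ) ≤ k := k.cast_nonneg
    linarith
  have hfi : Integrable f := (H.goodDensity_of_bounded hf hM).integrable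
  have hfM : ∀ x, |f x| ≤ M := fun x => (hM x).trans (indicator_le_self' (fun _ _ => hM0) x)
  let u : ℕ → Pos d → ℝ := fun k x => ∫ t, (φ k).normed volume t * f (x - t)
  have hu : ∀ k, u k = convolution ((φ k).normed volume) f (ContinuousLinearMap.lsmul ℝ ℝ)
      volume := fun k => rfl
  have hus : ∀ k, ContDiff ℝ ((⊤ : ℕ∞) : WithTop ℕ∞) (u k) := fun k => by
    rw [hu]
    exact (φ k).hasCompactSupport_normed.contDiff_convolution_left _ (φ k).contDiff_normed
      hfi.locallyIntegrable
  have hub : ∀ k x, |u k x| ≤ (Metric.closedBall (0 : Pos d) (R + 1)).indicator (fun _ => M) x := by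
    intro k x
    by_cases hx : x ∈ Metric.closedBall (0 : Pos d) (R + 1)
    · rw [indicator_of_mem hx]
      calc |u k x| ≤ ∫ t, |(φ k).normed volume t * f (x - t)| := abs_integral_le_integral_abs
        _ ≤ ∫ t, (φ k).normed volume t * M := by
            refine integral_mono_of_nonneg (Eventually.of_forall fun t => abs_nonneg _)
              ((φ k).integrable_normed.mul_const M) (Eventually.of_forall fun t => ?_)
            beta_reduce
            rw [abs_mul, abs_of_nonneg ((φ k).nonneg_normed t)]
            exact mul_le_mul_of_nonneg_left (hfM _) ((φ k).nonneg_normed t)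
        _ = M := by rw [integral_mul_const, (φ k).integral_normed, one_mul]
    · rw [indicator_of_notMem hx]
      have : u k x = 0 := by
        refine integral_eq_zero_of_ae (Eventually.of_forall fun t => ?_)
        by_cases ht : t ∈ Metric.ball (0 : Pos d) (φ k).rOut
        · have hxt : x - t ∉ Metric.closedBall (0 : Pos d) R := by
            intro hxt
            rw [mem_closedBall_zero_iff] at hx hxt
            rw [mem_ball_zero_iff] at ht
            have := norm_add_le (x - t) t
            rw [sub_add_cancel] at this
            linarith [hφ1 k]
          have h0 := hM (x - t)
          rw [indicator_of_notMem hxt] at h0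
          simp [abs_nonpos_iff.1 h0]
        · rw [← (φ k).support_normed_eq (μ := volume), Function.notMem_support] at ht
          simp [ht]
      rw [this, abs_zero]
  have huc : ∀ k, HasCompactSupport (u k) := fun k => by
    refine HasCompactSupport.of_support_subset_isCompact
      (isCompact_closedBall (0 : Pos d) (R + 1)) fun x hx => ?_
    by_contra hn
    have := hub k x
    rw [indicator_of_notMem hn] at this
    exact hx (abs_nonpos_iff.1 this)
  have hb : GoodDensity w a ((Metric.closedBall (0 : Pos d) (R + 1)).indicator fun _ => M) :=
    H.goodDensity_of_bounded (M := M) (R := R + 1)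
      (aestronglyMeasurable_const.indicator measurableSet_closedBall) fun x => by
        rw [abs_of_nonneg (indicator_nonneg (fun _ _ => hM0) x)]
  have hlim : ∀ᵐ x, Tendsto (fun k => u k x) atTop (nhds (f x)) :=
    ContDiffBump.ae_convolution_tendsto_right_of_locallyIntegrable (K := 2)
      tendsto_one_div_add_atTop_nhds_zero_nat
      (Eventually.of_forall fun k => le_of_eq (by
        change 1 / ((k : ℝ) + 1) = 2 * (1 / (2 * ((k : ℝ) + 1)))
        field_simp)) hfi.locallyIntegrable
  refine ge_of_tendsto (form_tendsto H.a_nonneg H.meas_w hb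
    (fun k => (hus k).continuous.aestronglyMeasurable)
    (fun k => Eventually.of_forall fun x => (hub k x).trans (le_abs_self _)) hlim)
    (Eventually.of_forall fun k => ?_)
  exact form_nonneg_of_smooth hF H.meas_w (hus k) (huc k)
    (H.goodDensity_of_bounded (hus k).continuous.aestronglyMeasurable (hub k))

/-- The interaction form is positive semidefinite if the Fourier transform of the interaction is
nonnegative. -/
theorem form_nonneg (H : VlasovAssumptions β₀ V A w a) (hF : HasNonnegFourier w a)
    {f : Pos d → ℝ} (hf : GoodDensity w a f) : 0 ≤ interactionForm w a f f := by
  let u : ℕ → Pos d → ℝ := fun k => (Metric.closedBall (0 : Pos d) k).indicator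
    fun x => max (-(k : ℝ)) (min (f x) k)
  have hmin : ∀ (k : ℕ) (t : ℝ), |max (-(k : ℝ)) (min t k)| ≤ k ∧
      |max (-(k : ℝ)) (min t k)| ≤ |t| := by
    intro k t
    have hk : (0 : ℝ) ≤ k := k.cast_nonneg
    refine ⟨abs_le.2 ⟨le_max_left _ _, max_le (by linarith) (min_le_right _ _)⟩,
      abs_le.2 ⟨?_, max_le (by linarith [abs_nonneg t]) ((min_le_left _ _).trans (le_abs_self t))⟩⟩
    refine le_trans ?_ (le_max_right _ _)
    exact le_min (neg_abs_le t) (by linarith [abs_nonneg t])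
  have hu : ∀ k, AEStronglyMeasurable (u k) := fun k =>
    (aestronglyMeasurable_const.sup
      (hf.integrable.1.inf aestronglyMeasurable_const)).indicator measurableSet_closedBall
  have hub : ∀ k x, |u k x| ≤ (Metric.closedBall (0 : Pos d) k).indicator (fun _ => (k : ℝ)) x := by
    intro k x
    by_cases hx : x ∈ Metric.closedBall (0 : Pos d) k
    · simp only [u, indicator_of_mem hx]
      exact (hmin k _).1
    · simp only [u, indicator_of_notMem hx, abs_zero, le_refl]
  have huf : ∀ k x, |u k x| ≤ |f x| := by
    intro k x
    by_cases hx : x ∈ Metric.closedBall (0 : Pos d) k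
    · simp only [u, indicator_of_mem hx]
      exact (hmin k _).2
    · simp only [u, indicator_of_notMem hx, abs_zero, abs_nonneg]
  have hlim : ∀ x, Tendsto (fun k => u k x) atTop (nhds (f x)) := by
    intro x
    obtain ⟨N, hN⟩ := exists_nat_ge (max ‖x‖ |f x|)
    refine tendsto_const_nhds.congr' ?_
    filter_upwards [eventually_ge_atTop N] with k hk
    have hk' : max ‖x‖ |f x| ≤ k := hN.trans (by exact_mod_cast hk)
    have hx : x ∈ Metric.closedBall (0 : Pos d) k :=
      mem_closedBall_zero_iff.2 ((le_max_left _ _).trans hk')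
    have hfx := abs_le.1 ((le_max_right _ _).trans hk')
    simp only [u, indicator_of_mem hx]
    rw [min_eq_left hfx.2, max_eq_right hfx.1]
  refine ge_of_tendsto (form_tendsto H.a_nonneg H.meas_w hf hu
    (fun k => Eventually.of_forall (huf k)) (Eventually.of_forall hlim))
    (Eventually.of_forall fun k => ?_)
  exact H.form_nonneg_of_bounded hF (hu k) k.cast_nonneg (hub k)

/-- Convexity of the interaction energy. -/
theorem interactionIntegral_convex (H : VlasovAssumptions β₀ V A w a) (hF : HasNonnegFourier w a)
    {f g : Pos d → ℝ} (hf : GoodDensity w a f) (hg : GoodDensity w a g) :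
    0 ≤ interactionIntegral w a f - 2 * interactionForm w a f g + interactionIntegral w a g := by
  have h1 := hf.form_quadratic H.meas_w H.a_nonneg H.even_w hg 1 (-1)
  have h2 := H.form_nonneg hF (hf.linear H.a_nonneg hg 1 (-1))
  rw [← interactionIntegral_eq_form, h1] at h2
  linarith

end VlasovAssumptions

/-! ### The value of the minimum -/

namespace VlasovAssumptions

variable {d : ℕ} {β₀ : ℝ} {V : Pos d → ℝ} {A : Pos d → Pos d} {w : Pos d → ℝ} {a : ℝ}
  {m m₀ : Phase d → ℝ}

theorem vlasovInf_eq (H : VlasovAssumptions β₀ V A w a) {β ρ' r : ℝ}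
    (hm₀ : FiniteEnergy V A a m₀) (hadm₀ : IsAdmissible r m₀)
    (hmin : ∀ m' : Phase d → ℝ, IsAdmissible r m' → FiniteEnergy V A a m' →
        vlasovReal V A w a β ρ' m₀ ≤ vlasovReal V A w a β ρ' m') :
    vlasovInf V A w a β r ρ' = (vlasovReal V A w a β ρ' m₀ : ℝ) := by
  refine le_antisymm ((iInf₂_le m₀ hadm₀).trans_eq (H.vlasovEnergy_eq hm₀ β ρ'))
    (le_iInf₂ fun m' hm' => ?_)
  by_cases hlt : vlasovEnergy V A w a β ρ' m' < ⊤
  · have hfin := H.finiteEnergy_of_lt_top hm'.1 hlt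
    rw [H.vlasovEnergy_eq hfin]
    exact EReal.coe_le_coe_iff.2 (hmin m' hm' hfin)
  · rw [not_lt_top_iff.1 hlt]
    exact le_top

/-- The infimum is finite, and it bounds the Vlasov functional from below. -/
theorem vlasovInf_finite (H : VlasovAssumptions β₀ V A w a) {β ρ' r : ℝ} (hβ : β₀ < β)
    (hρ' : 0 < ρ') (hr : 0 < r) :
    vlasovInf V A w a β r ρ' = ((vlasovInf V A w a β r ρ').toReal : ℝ) ∧
      ∀ m' : Phase d → ℝ, IsAdmissible r m' → FiniteEnergy V A a m' →
        (vlasovInf V A w a β r ρ').toReal ≤ vlasovReal V A w a β ρ' m' := by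
  obtain ⟨m, hadm, hm, hmin⟩ := H.exists_minimizer hβ hρ' hr
  rw [H.vlasovInf_eq hm hadm hmin, EReal.toReal_coe]
  exact ⟨rfl, hmin⟩

theorem isVlasovMinimizer_iff (H : VlasovAssumptions β₀ V A w a) {β r : ℝ} (hβ : β₀ < β)
    (hr : 0 < r) : IsVlasovMinimizer V A w a β r m ↔
      IsAdmissible r m ∧ FiniteEnergy V A a m ∧
        vlasovReal V A w a β r m = (vlasovInf V A w a β r r).toReal := by
  obtain ⟨hfin, -⟩ := H.vlasovInf_finite hβ hr hr
  refine and_congr_right fun hadm => ?_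
  rw [vlasovMin]
  constructor
  · intro he
    have hlt : vlasovEnergy V A w a β r m < ⊤ := by
      rw [he, hfin]
      exact EReal.coe_lt_top _
    have hm := H.finiteEnergy_of_lt_top hadm.1 hlt
    rw [H.vlasovEnergy_eq hm, hfin] at he
    exact ⟨hm, EReal.coe_injective he⟩
  · rintro ⟨hm, he⟩
    rw [H.vlasovEnergy_eq hm, he]
    exact hfin.symm

/-- At a solution of the Euler-Lagrange equation, the Vlasov functional is the grand potential
plus the chemical energy, corrected for the double counting of the interaction. -/
theorem vlasovReal_eq_grandPotential (H : VlasovAssumptions β₀ V A w a) {β ρ' r μ : ℝ}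
    (hβ : 0 < β) (hm : FiniteEnergy V A a m) (hadm : IsAdmissible r m)
    (hsol : SolvesFermiDirac V A w a β ρ' μ m) :
    Integrable (fun z : Phase d => Real.log (1 + Real.exp (-β *
        (‖z.2‖ ^ 2 + V z.1 + ρ'⁻¹ * meanField w a (spatialDensity m) z.1 - μ)))) ∧
      vlasovReal V A w a β ρ' m = -((2 * Real.pi) ^ d * β)⁻¹ *
            (∫ z : Phase d, Real.log (1 + Real.exp (-β *
              (‖z.2‖ ^ 2 + V z.1 + ρ'⁻¹ * meanField w a (spatialDensity m) z.1 - μ))))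
          + μ * r - (2 * ρ')⁻¹ * interactionIntegral w a (spatialDensity m) := by
  set L : Phase d → ℝ := fun z => Real.log (1 + Real.exp (-β *
    (‖z.2‖ ^ 2 + V z.1 + ρ'⁻¹ * meanField w a (spatialDensity m) z.1 - μ))) with hL
  have i1 := H.integrable_effectiveEnergy_mul hm hm ρ'
  have i2 := H.integrable_fermiEntropy hm.toConfined
  have i12 : Integrable fun z => effectiveEnergy V A w a ρ' m z * m z + β⁻¹ * fermiEntropy (m z) :=
    i1.add (i2.const_mul _)
  have i3 := hm.pauli.1.const_mul μ
  have he : ∀ᵐ z : Phase d, effectiveEnergy V A w a ρ' m z * m z + β⁻¹ * fermiEntropy (m z)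
      - μ * m z = -(β⁻¹ * L (z.1, z.2 + A z.1)) := by
    filter_upwards [hsol.2] with z hz
    have hz' : m z = fermiDirac β (effectiveEnergy V A w a ρ' m z - μ) := hz
    have := fermiDirac_energy hβ (effectiveEnergy V A w a ρ' m z - μ)
    rw [hz']
    simp only [hL]
    change _ = -(β⁻¹ * Real.log (1 + Real.exp (-β * (effectiveEnergy V A w a ρ' m z - μ))))
    linarith
  obtain ⟨g1, g2⟩ := integrable_shear_iff H.meas_A L
  have j : Integrable fun z : Phase d => L (z.1, z.2 + A z.1) := by
    refine ((i12.sub i3).const_mul (-β)).congr ?_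
    filter_upwards [he] with z hz
    simp only [Pi.sub_apply]
    rw [hz]
    field_simp
  refine ⟨g1.1 j, ?_⟩
  have hlin := H.linearizedEnergy_eq hm hm β ρ'
  rw [← interactionIntegral_eq_form] at hlin
  have hint := integral_congr_ae he
  rw [integral_sub i12 i3, integral_neg, integral_const_mul, integral_const_mul, g2] at hint
  rw [linearizedEnergy] at hlin
  have hmass := hadm.2
  rw [vlasovReal, mul_inv, mul_inv]
  rw [mul_inv] at hlin
  linear_combination -hlin + κ[d] * hint + μ * hmass

end VlasovAssumptions

/-! ### Convex functions on the line -/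

theorem tendsto_slope_left {f : ℝ → ℝ} {x y : ℝ} (hf : ContinuousAt f x) (hxy : x ≠ y) :
    Tendsto (fun z => slope f z y) (nhds x) (nhds (slope f x y)) := by
  have : ContinuousAt (fun z => (f y - f z) / (y - z)) x :=
    (continuousAt_const.sub hf).div (by fun_prop) (sub_ne_zero.2 hxy.symm)
  simpa only [ContinuousAt, ← slope_def_field] using this

/-- A differentiable convex function on an open subset of the line is continuously
differentiable. -/
theorem ConvexOn.continuousOn_deriv_of_isOpen {f : ℝ → ℝ} {S : Set ℝ} (hS : IsOpen S)
    (hf : ConvexOn ℝ S f) (hd : ∀ x ∈ S, DifferentiableAt ℝ f x) : ContinuousOn (deriv f) S := by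
  intro x hx
  refine ContinuousAt.continuousWithinAt ?_
  have hs := hasDerivAt_iff_tendsto_slope.1 (hd x hx).hasDerivAt
  refine tendsto_order.2 ⟨fun b hb => ?_, fun b hb => ?_⟩
  · obtain ⟨y, hyb, hyS, hyx⟩ : ∃ y, b < slope f x y ∧ y ∈ S ∧ y < x :=
      (((hs.mono_left (nhdsWithin_mono x (s := Iio x) fun y hy => ne_of_lt hy)).eventually
        (lt_mem_nhds hb)).and ((eventually_nhdsWithin_of_eventually_nhds (hS.mem_nhds hx)).and
          self_mem_nhdsWithin)).exists
    filter_upwards [(tendsto_slope_left (hd x hx).continuousAt hyx.ne').eventually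
      (lt_mem_nhds hyb), hS.mem_nhds hx, lt_mem_nhds hyx] with z h1 h2 h3
    rw [slope_comm] at h1
    exact h1.trans_le (hf.slope_le_deriv hyS h2 h3 (hd z h2))
  · obtain ⟨y, hyb, hyS, hyx⟩ : ∃ y, slope f x y < b ∧ y ∈ S ∧ x < y :=
      (((hs.mono_left (nhdsWithin_mono x (s := Ioi x) fun y hy => ne_of_gt hy)).eventually
        (gt_mem_nhds hb)).and ((eventually_nhdsWithin_of_eventually_nhds (hS.mem_nhds hx)).and
          self_mem_nhdsWithin)).exists
    filter_upwards [(tendsto_slope_left (hd x hx).continuousAt hyx.ne).eventually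
      (gt_mem_nhds hyb), hS.mem_nhds hx, gt_mem_nhds hyx] with z h1 h2 h3
    exact (hf.deriv_le_slope h2 hyS h3 (hd z h2)).trans_lt h1

/-- A convex function touched from above by a parabola is differentiable at the point of
contact. -/
theorem ConvexOn.hasDerivAt_of_le_parabola {F : ℝ → ℝ} {S : Set ℝ} (hF : ConvexOn ℝ S F)
    {r μ C δ : ℝ} (hδ : 0 < δ) (hS : ∀ s, |s| < δ → r + s ∈ S)
    (hle : ∀ s, |s| < δ → F (r + s) ≤ F r + μ * s + C * s ^ 2) : HasDerivAt F μ r := by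
  rw [hasDerivAt_iff_isLittleO_nhds_zero]
  refine Asymptotics.IsBigO.trans_isLittleO (g := fun s : ℝ => s ^ 2) ?_
    (Asymptotics.isLittleO_pow_id one_lt_two)
  refine Asymptotics.IsBigO.of_bound |C| ?_
  filter_upwards [Metric.ball_mem_nhds (0 : ℝ) hδ] with s hs
  rw [mem_ball_zero_iff, Real.norm_eq_abs] at hs
  have hs' : |-s| < δ := by rwa [abs_neg]
  have h1 := hle s hs
  have h2 := hle (-s) hs'
  have h3 := hF.2 (hS s hs) (hS (-s) hs') (show (0 : ℝ) ≤ 1 / 2 by norm_num)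
    (show (0 : ℝ) ≤ 1 / 2 by norm_num) (by norm_num)
  have e : (1 / 2 : ℝ) • (r + s) + (1 / 2 : ℝ) • (r + -s) = r := by
    simp only [smul_eq_mul]; ring
  rw [e] at h3
  simp only [smul_eq_mul] at h3
  have h4 : C * s ^ 2 ≤ |C| * s ^ 2 := by gcongr; exact le_abs_self C
  rw [Real.norm_eq_abs, Real.norm_eq_abs, abs_of_nonneg (sq_nonneg s), smul_eq_mul, abs_le]
  constructor <;> nlinarith

/-! ### Strict convexity and the chemical potential -/

namespace VlasovAssumptions

variable {d : ℕ} {β₀ : ℝ} {V : Pos d → ℝ} {A : Pos d → Pos d} {w : Pos d → ℝ} {a : ℝ}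
  {m m₀ m₁ m₂ : Phase d → ℝ}

theorem integral_fermiEntropy_convex_comb_lt (H : VlasovAssumptions β₀ V A w a)
    (hm : FiniteEnergy V A a m) (hm₀ : FiniteEnergy V A a m₀) (hne : ¬ m =ᵐ[volume] m₀) {t : ℝ}
    (h0 : 0 < t) (h1 : t < 1) :
    ∫ z, fermiEntropy (t * m z + (1 - t) * m₀ z)
      < t * (∫ z, fermiEntropy (m z)) + (1 - t) * ∫ z, fermiEntropy (m₀ z) := by
  refine lt_of_le_of_ne (H.integral_fermiEntropy_convex_comb_le hm hm₀ h0.le h1.le)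
    fun heq => hne ?_
  have j := H.integrable_fermiEntropy (H.finiteEnergy_convex hm hm₀ h0.le h1.le).toConfined
  have j1 := (H.integrable_fermiEntropy hm.toConfined).const_mul t
  have j2 := (H.integrable_fermiEntropy hm₀.toConfined).const_mul (1 - t)
  have j12 : Integrable fun z => t * fermiEntropy (m z) + (1 - t) * fermiEntropy (m₀ z) :=
    j1.add j2
  have hz : ∫ z, (t * fermiEntropy (m z) + (1 - t) * fermiEntropy (m₀ z)
      - fermiEntropy (t * m z + (1 - t) * m₀ z)) = 0 := by
    rw [integral_sub j12 j, integral_add j1 j2, integral_const_mul, integral_const_mul, heq,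
      sub_self]
  have hnn : 0 ≤ᵐ[volume] fun z => t * fermiEntropy (m z) + (1 - t) * fermiEntropy (m₀ z)
      - fermiEntropy (t * m z + (1 - t) * m₀ z) := by
    filter_upwards [hm.pauli.2, hm₀.pauli.2] with z a1 a2
    exact sub_nonneg.2 (strictConvexOn_fermiEntropy.convexOn.2 ⟨a1.1, a1.2⟩ ⟨a2.1, a2.2⟩ h0.le
      (by linarith) (by ring))
  filter_upwards [(integral_eq_zero_iff_of_nonneg_ae hnn (j12.sub j)).1 hz, hm.pauli.2,
    hm₀.pauli.2] with z hz a1 a2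
  by_contra hn
  have := strictConvexOn_fermiEntropy.2 ⟨a1.1, a1.2⟩ ⟨a2.1, a2.2⟩ hn h0 (sub_pos.2 h1) (by ring)
  simp only [smul_eq_mul] at this
  simp only [Pi.zero_apply] at hz
  linarith

theorem vlasovReal_convex_le (H : VlasovAssumptions β₀ V A w a) (hF : HasNonnegFourier w a)
    (hm : FiniteEnergy V A a m) (hm₀ : FiniteEnergy V A a m₀) {β ρ' : ℝ} (hβ : 0 < β)
    (hρ' : 0 < ρ') {t : ℝ} (h0 : 0 ≤ t) (h1 : t ≤ 1) :
    vlasovReal V A w a β ρ' (fun z => t * m z + (1 - t) * m₀ z)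
      ≤ t * vlasovReal V A w a β ρ' m + (1 - t) * vlasovReal V A w a β ρ' m₀ := by
  refine (H.vlasovReal_convex_comb_le hm hm₀ hβ ρ' h0 h1).trans (sub_le_self _ ?_)
  have := H.interactionIntegral_convex hF (H.goodDensity hm) (H.goodDensity hm₀)
  have h1' : 0 ≤ 1 - t := sub_nonneg.2 h1
  positivity

theorem vlasovReal_convex_lt (H : VlasovAssumptions β₀ V A w a) (hF : HasNonnegFourier w a)
    (hm : FiniteEnergy V A a m) (hm₀ : FiniteEnergy V A a m₀) (hne : ¬ m =ᵐ[volume] m₀)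
    {β ρ' : ℝ} (hβ : 0 < β) (hρ' : 0 < ρ') {t : ℝ} (h0 : 0 < t) (h1 : t < 1) :
    vlasovReal V A w a β ρ' (fun z => t * m z + (1 - t) * m₀ z)
      < t * vlasovReal V A w a β ρ' m + (1 - t) * vlasovReal V A w a β ρ' m₀ := by
  have hQ := H.interactionIntegral_convex hF (H.goodDensity hm) (H.goodDensity hm₀)
  have h1' : 0 < 1 - t := sub_pos.2 h1
  have hQ' : 0 ≤ t * (1 - t) * (2 * ρ')⁻¹ * (interactionIntegral w a (spatialDensity m)
          - 2 * interactionForm w a (spatialDensity m) (spatialDensity m₀)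
          + interactionIntegral w a (spatialDensity m₀)) := by positivity
  have hS := mul_pos (show 0 < ((2 * Real.pi) ^ d * β)⁻¹ by positivity)
    (sub_pos.2 (H.integral_fermiEntropy_convex_comb_lt hm hm₀ hne h0 h1))
  rw [H.vlasovReal_convex_comb hm hm₀]
  linarith

theorem convexOn_vlasovInf (H : VlasovAssumptions β₀ V A w a) (hF : HasNonnegFourier w a)
    {β ρ' : ℝ} (hβ : β₀ < β) (hρ' : 0 < ρ') :
    ConvexOn ℝ (Ioi 0) fun r => (vlasovInf V A w a β r ρ').toReal := by
  refine ⟨convex_Ioi 0, fun r₁ hr₁ r₂ hr₂ s t hs ht hst => ?_⟩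
  obtain ⟨m₁, hadm₁, hm₁, hmin₁⟩ := H.exists_minimizer hβ hρ' hr₁
  obtain ⟨m₂, hadm₂, hm₂, hmin₂⟩ := H.exists_minimizer hβ hρ' hr₂
  have hr : 0 < s * r₁ + t * r₂ := convex_Ioi (0 : ℝ) hr₁ hr₂ hs ht hst
  obtain rfl : t = 1 - s := by linarith
  have hs1 : s ≤ 1 := by linarith
  have h1 := (H.vlasovInf_finite hβ hρ' hr).2 _ (hadm₁.convex hadm₂ hs hs1)
    (H.finiteEnergy_convex hm₁ hm₂ hs hs1)
  have h2 := H.vlasovReal_convex_le hF hm₁ hm₂ (H.beta_pos.trans hβ) hρ' hs hs1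
  simp only [smul_eq_mul]
  rw [H.vlasovInf_eq hm₁ hadm₁ hmin₁, H.vlasovInf_eq hm₂ hadm₂ hmin₂, EReal.toReal_coe,
    EReal.toReal_coe]
  exact h1.trans h2

theorem finiteEnergy_linear (H : VlasovAssumptions β₀ V A w a) (h₁ : FiniteEnergy V A a m₁)
    (h₂ : FiniteEnergy V A a m₂) {s t : ℝ} (hp : IsPauliDensity fun z => s * m₁ z + t * m₂ z) :
    FiniteEnergy V A a fun z => s * m₁ z + t * m₂ z := by
  refine ⟨⟨hp, ?_⟩, ?_⟩
  · refine ((h₁.conf.const_mul s).add (h₂.conf.const_mul t)).congr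
      (Eventually.of_forall fun z => ?_)
    simp only [Pi.add_apply]; ring
  · refine ((H.goodDensity h₁).linear H.a_nonneg (H.goodDensity h₂) s t).sq.congr ?_
    filter_upwards [spatialDensity_linear h₁.pauli.1 h₂.pauli.1 s t] with x hx
    rw [hx]

theorem finiteEnergy_of_le (H : VlasovAssumptions β₀ V A w a) (h₁ : FiniteEnergy V A a m₁)
    (hp : IsPauliDensity m) (hle : ∀ᵐ z, m z ≤ m₁ z) : FiniteEnergy V A a m := by
  refine ⟨⟨hp, ?_⟩, integrable_sq_of_le (A := A) (b := 1) (C := 0) H.a_nonneg hp h₁.pauli h₁.sq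
    one_pos (by simpa using hle)⟩
  refine h₁.conf.mono' (H.aestronglyMeasurable_confinement.mul hp.1.1) ?_
  filter_upwards [hle, hp.2] with z h2 h3
  have hT := confinement_nonneg V A z
  rw [Real.norm_of_nonneg (mul_nonneg hT h3.1)]
  exact mul_le_mul_of_nonneg_left h2 hT

/-- Second order upper bound for the Vlasov functional around a solution of the Euler-Lagrange
equation, in the direction `m₀ (1 - m₀)`, in which one can move both ways. -/
theorem exists_quadratic_bound (H : VlasovAssumptions β₀ V A w a) {β ρ' r μ : ℝ}
    (hβ : 0 < β) (hm₀ : FiniteEnergy V A a m₀) (hadm₀ : IsAdmissible r m₀)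
    (hsol : SolvesFermiDirac V A w a β ρ' μ m₀) :
    ∃ q C : ℝ, 0 < q ∧ ∀ t, |t| ≤ 1 / 2 → ∃ m, IsAdmissible (r + t * q) m ∧
      FiniteEnergy V A a m ∧
      vlasovReal V A w a β ρ' m ≤ vlasovReal V A w a β ρ' m₀ + μ * (t * q) + C * t ^ 2 := by
  set h := effectiveEnergy V A w a ρ' m₀ with hh
  have hfd : ∀ᵐ z, m₀ z = fermiDirac β (h z - μ) := hsol.2
  set η : Phase d → ℝ := fun z => m₀ z * (1 - m₀ z) with hη
  have hηp : IsPauliDensity η := by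
    refine ⟨hm₀.pauli.1.mono (hm₀.pauli.1.1.mul (aestronglyMeasurable_const.sub hm₀.pauli.1.1)) ?_,
      ?_⟩
    · filter_upwards [hm₀.pauli.2] with z hz
      rw [hη, norm_mul]
      refine mul_le_of_le_one_right (norm_nonneg _) ?_
      rw [Real.norm_of_nonneg (by linarith)]
      linarith
    · filter_upwards [hm₀.pauli.2] with z hz
      constructor <;> simp only [hη] <;> nlinarith
  have hηf : FiniteEnergy V A a η := by
    refine H.finiteEnergy_of_le hm₀ hηp ?_
    filter_upwards [hm₀.pauli.2] with z hz
    simp only [hη]; nlinarith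
  have hκ := semiclassical_pos d
  have hq : 0 < κ[d] * ∫ z, η z := by
    refine mul_pos hκ ?_
    have hpos : ∀ᵐ z, 0 < η z := by
      filter_upwards [hfd] with z hz
      rw [hη]
      beta_reduce
      rw [hz]
      exact mul_pos (fermiDirac_pos _ _) (sub_pos.2 (fermiDirac_lt_one _ _))
    rw [integral_pos_iff_support_of_nonneg_ae (hpos.mono fun z hz => hz.le) hηp.1]
    have : Function.support η =ᵐ[volume] (univ : Set (Phase d)) :=
      eventuallyEq_univ.2 (hpos.mono fun z hz => hz.ne')
    rw [measure_congr this]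
    exact Measure.measure_univ_pos.2 (NeZero.ne _)
  have i1 := H.integrable_potential hm₀.toConfined
  have i2 := H.integrable_potential hηf.toConfined
  obtain ⟨k1, k2⟩ := H.integral_meanField_mul hm₀ hηf
  set P := ∫ z : Phase d, (‖z.2 + A z.1‖ ^ 2 + V z.1) * η z with hP
  set M := ∫ z, m₀ z with hM
  refine ⟨κ[d] * ∫ z, η z, (2 * ρ')⁻¹ * interactionIntegral w a (spatialDensity η)
    + κ[d] * β⁻¹ * (2 * M), hq, fun t ht => ?_⟩
  obtain ⟨ht1, ht2⟩ := abs_le.1 ht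
  have hmp : IsPauliDensity fun z => 1 * m₀ z + t * η z := by
    refine ⟨(hm₀.pauli.1.const_mul 1).add (hηp.1.const_mul t), ?_⟩
    filter_upwards [hm₀.pauli.2] with z hz
    have e1 : 1 * m₀ z + t * η z = m₀ z * (1 + t * (1 - m₀ z)) := by simp only [hη]; ring
    have e2 : 1 - (1 * m₀ z + t * η z) = (1 - m₀ z) * (1 - t * m₀ z) := by simp only [hη]; ring
    constructor
    · rw [e1]
      exact mul_nonneg hz.1 (by nlinarith)
    · rw [← sub_nonneg, e2]
      exact mul_nonneg (by linarith) (by nlinarith)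
  have hmf := H.finiteEnergy_linear hm₀ hηf hmp
  refine ⟨fun z => 1 * m₀ z + t * η z, ⟨hmp, ?_⟩, hmf, ?_⟩
  · rw [integral_add (hm₀.pauli.1.const_mul 1) (hηp.1.const_mul t), integral_const_mul,
      integral_const_mul]
    linear_combination hadm₀.2
  have e1 : ∫ z : Phase d, (‖z.2 + A z.1‖ ^ 2 + V z.1) * (1 * m₀ z + t * η z)
      = (∫ z : Phase d, (‖z.2 + A z.1‖ ^ 2 + V z.1) * m₀ z) + t * P := by
    rw [hP, ← integral_const_mul, ← integral_add i1 (i2.const_mul t)]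
    refine integral_congr_ae (Eventually.of_forall fun z => ?_)
    beta_reduce; ring
  have e2 : interactionIntegral w a (spatialDensity fun z => 1 * m₀ z + t * η z)
      = interactionIntegral w a (spatialDensity m₀)
        + 2 * t * interactionForm w a (spatialDensity η) (spatialDensity m₀)
        + t ^ 2 * interactionIntegral w a (spatialDensity η) := by
    have he := spatialDensity_linear hm₀.pauli.1 hηp.1 1 t
    have := (H.goodDensity hm₀).form_quadratic H.meas_w H.a_nonneg H.even_w (H.goodDensity hηf) 1 t
    rw [GoodDensity.form_comm H.even_w (spatialDensity m₀)] at this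
    rw [interactionIntegral_eq_form, interactionForm_congr w a he he,
      ← interactionIntegral_eq_form, this]
    ring
  have l1 := H.integrable_fermiEntropy hm₀.toConfined
  have l2 := H.integrable_effectiveEnergy_mul hm₀ hηf ρ'
  have l2' : Integrable fun z => h z * η z - μ * η z := l2.sub (hηp.1.const_mul μ)
  have l3 : Integrable fun z => fermiEntropy (m₀ z) - t * β * (h z * η z - μ * η z) :=
    l1.sub (l2'.const_mul (t * β))
  have e3 : ∫ z, fermiEntropy (1 * m₀ z + t * η z)
      ≤ (∫ z, fermiEntropy (m₀ z)) - t * β * ((∫ z, h z * η z) - μ * ∫ z, η z)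
        + 2 * t ^ 2 * M := by
    rw [hM, ← integral_const_mul μ, ← integral_sub l2 (hηp.1.const_mul μ), ← integral_const_mul,
      ← integral_const_mul, ← integral_sub l1 (l2'.const_mul (t * β)),
      ← integral_add l3 (hm₀.pauli.1.const_mul _)]
    refine integral_mono_ae (H.integrable_fermiEntropy hmf.toConfined)
      (l3.add (hm₀.pauli.1.const_mul _)) ?_
    filter_upwards [hfd] with z hz
    have := fermiEntropy_variation_le β (h z - μ) ht
    rw [← hz] at this
    simp only [hη, one_mul]
    linarith
  have e4 : ∫ z, h z * η z = P + ρ'⁻¹ * ∫ z : Phase d, meanField w a (spatialDensity m₀) z.1 * η z := by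
    rw [hP, ← integral_const_mul, ← integral_add i2 (k1.const_mul _)]
    refine integral_congr_ae (Eventually.of_forall fun z => ?_)
    simp only [hh, effectiveEnergy]; ring
  rw [e4] at e3
  have e5 := mul_le_mul_of_nonneg_left e3 (show 0 ≤ ((2 * Real.pi) ^ d * β)⁻¹ by positivity)
  rw [vlasovReal, vlasovReal, e1, e2, ← k2]
  refine (add_le_add_right e5 _).trans (le_of_eq ?_)
  rw [mul_inv]
  field_simp
  ring

/-- The chemical potential is the derivative of the minimal free energy in the mass. -/
theorem hasDerivAt_vlasovInf (H : VlasovAssumptions β₀ V A w a) (hF : HasNonnegFourier w a)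
    {β ρ' r μ : ℝ} (hβ : β₀ < β) (hρ' : 0 < ρ') (hr : 0 < r) (hm₀ : FiniteEnergy V A a m₀)
    (hadm₀ : IsAdmissible r m₀)
    (hval : vlasovReal V A w a β ρ' m₀ = (vlasovInf V A w a β r ρ').toReal)
    (hsol : SolvesFermiDirac V A w a β ρ' μ m₀) :
    HasDerivAt (fun r => (vlasovInf V A w a β r ρ').toReal) μ r := by
  obtain ⟨q, C, hq, hC⟩ := H.exists_quadratic_bound (H.beta_pos.trans hβ) hm₀ hadm₀ hsol
  have hmem : ∀ s, |s| < min r (q / 2) → 0 < r + s := fun s hs => by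
    have := neg_abs_le s
    have := hs.trans_le (min_le_left _ _)
    linarith
  refine (H.convexOn_vlasovInf hF hβ hρ').hasDerivAt_of_le_parabola (C := C / q ^ 2)
    (δ := min r (q / 2)) (by positivity) hmem fun s hs => ?_
  have ht : |s / q| ≤ 1 / 2 := by
    rw [abs_div, abs_of_pos hq, div_le_iff₀ hq]
    linarith [hs.trans_le (min_le_right r (q / 2))]
  obtain ⟨m, hadm, hm, hle⟩ := hC (s / q) ht
  rw [div_mul_cancel₀ s hq.ne'] at hadm hle
  have h1 := (H.vlasovInf_finite hβ hρ' (hmem s hs)).2 m hadm hm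
  rw [hval] at hle
  refine (h1.trans hle).trans (le_of_eq ?_)
  rw [div_pow]
  ring

theorem contDiffOn_vlasovInf (H : VlasovAssumptions β₀ V A w a) (hF : HasNonnegFourier w a)
    {β ρ' : ℝ} (hβ : β₀ < β) (hρ' : 0 < ρ') :
    ContDiffOn ℝ 1 (fun r => (vlasovInf V A w a β r ρ').toReal) (Ioi 0) := by
  have hd : ∀ r ∈ Ioi (0 : ℝ), DifferentiableAt ℝ
      (fun r => (vlasovInf V A w a β r ρ').toReal) r := by
    intro r hr
    obtain ⟨m, hadm, hm, hmin⟩ := H.exists_minimizer hβ hρ' hr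
    obtain ⟨μ, hμ⟩ := H.exists_solvesFermiDirac hβ hρ' hr hm hadm hmin
    exact (H.hasDerivAt_vlasovInf hF hβ hρ' hr hm hadm
      (by rw [H.vlasovInf_eq hm hadm hmin, EReal.toReal_coe]) hμ).differentiableAt
  have := (contDiffOn_succ_iff_deriv_of_isOpen (𝕜 := ℝ) (n := 0)
    (f := fun r => (vlasovInf V A w a β r ρ').toReal) (isOpen_Ioi (a := (0 : ℝ)))).2
    ⟨fun r hr => (hd r hr).differentiableWithinAt, by simp, contDiffOn_zero.2
      ((H.convexOn_vlasovInf hF hβ hρ').continuousOn_deriv_of_isOpen isOpen_Ioi hd)⟩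
  simpa using this

end VlasovAssumptions

theorem mainTheorem3 {d : ℕ} (hd : 0 < d) (ρ β₀ : ℝ) (hρ : 0 < ρ) (hβ₀ : 0 < β₀)
    (V : Pos d → ℝ) (A : Pos d → Pos d) (w : Pos d → ℝ) (a : ℝ)
    (hVneg : MemLp (fun x => max (-V x) 0) ((d : ℝ≥0∞) / 2))
    (hVneg' : MemLp (fun x => max (-V x) 0) (1 + (d : ℝ≥0∞) / 2))
    (hA : LocallyIntegrable A)
    (hVpos : LocallyIntegrable fun x => max (V x) 0)
    (hVexp : Integrable fun x => Real.exp (-β₀ * max (V x) 0))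
    (hw : InLpPlusLinftyEps (1 + (d : ℝ≥0∞) / 2) w)
    (hweven : ∀ᵐ x : Pos d, w (-x) = w x)
    (ha : 0 ≤ a)
    (β : ℝ) (hβ : β₀ < β) :
    -- existence of minimizers
    (∃ m₀ : Phase d → ℝ, IsVlasovMinimizer V A w a β ρ m₀) ∧
    -- every minimizer solves the nonlinear equation
    (∀ m₀ : Phase d → ℝ, IsVlasovMinimizer V A w a β ρ m₀ →
      ∃ μ : ℝ, SolvesFermiDirac V A w a β ρ μ m₀) ∧
    -- the value of the minimum
    (∀ (m₀ : Phase d → ℝ) (μ : ℝ), IsVlasovMinimizer V A w a β ρ m₀ →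
      SolvesFermiDirac V A w a β ρ μ m₀ →
      Integrable (fun z : Phase d => Real.log (1 + Real.exp (-β *
        (‖z.2‖ ^ 2 + V z.1 + ρ⁻¹ * meanField w a (spatialDensity m₀) z.1 - μ)))) ∧
      HasFiniteTerms V A w a m₀ ∧
      vlasovMin V A w a β ρ =
        ((-((2 * Real.pi) ^ d * β)⁻¹ *
            (∫ z : Phase d, Real.log (1 + Real.exp (-β *
              (‖z.2‖ ^ 2 + V z.1 + ρ⁻¹ * meanField w a (spatialDensity m₀) z.1 - μ))))
          + μ * ρ
          - (2 * ρ)⁻¹ * interactionIntegral w a (spatialDensity m₀) : ℝ) : EReal)) ∧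
    -- interactions with nonnegative Fourier transform
    (HasNonnegFourier w a →
      -- strict convexity
      (∀ m₁ m₂ : Phase d → ℝ, IsPauliDensity m₁ → IsPauliDensity m₂ →
        vlasovEnergy V A w a β ρ m₁ < ⊤ → vlasovEnergy V A w a β ρ m₂ < ⊤ →
        ¬ (m₁ =ᵐ[volume] m₂) → ∀ t : ℝ, 0 < t → t < 1 →
        vlasovEnergy V A w a β ρ (fun z => t * m₁ z + (1 - t) * m₂ z) <
          (t : EReal) * vlasovEnergy V A w a β ρ m₁
            + ((1 - t : ℝ) : EReal) * vlasovEnergy V A w a β ρ m₂) ∧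
      -- uniqueness of the minimizer
      (∀ m₁ m₂ : Phase d → ℝ, IsVlasovMinimizer V A w a β ρ m₁ →
        IsVlasovMinimizer V A w a β ρ m₂ → m₁ =ᵐ[volume] m₂) ∧
      -- regularity of `F(·, ρ')`
      (∀ ρ' : ℝ, 0 < ρ' →
        (∀ r : ℝ, 0 < r → vlasovInf V A w a β r ρ' ≠ ⊤ ∧ vlasovInf V A w a β r ρ' ≠ ⊥) ∧
        ContDiffOn ℝ 1 (fun r => (vlasovInf V A w a β r ρ').toReal) (Ioi 0)) ∧
      -- the multiplier is the derivative of `F(·, ρ)` at `ρ`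
      (∀ (m₀ : Phase d → ℝ) (μ : ℝ), IsVlasovMinimizer V A w a β ρ m₀ →
        SolvesFermiDirac V A w a β ρ μ m₀ →
        HasDerivAt (fun r => (vlasovInf V A w a β r ρ).toReal) μ ρ)) := by
  obtain ⟨w₁, w₂, hw₁, hw₂, hw₂le, hwe⟩ := hw 1 one_pos
  have H : VlasovAssumptions β₀ V A w a :=
    { dim_pos := hd
      beta_pos := hβ₀
      memLp_neg := hVneg'
      meas_pos := hVpos.aestronglyMeasurable
      meas_A := hA.aestronglyMeasurable
      integrable_exp := hVexp
      meas_w := (hw₁.1.add hw₂).congr hwe.symm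
      split_w := by
        refine ⟨w₁, 1, hw₁, zero_le_one, ?_⟩
        rw [eLpNorm_exponent_top] at hw₂le
        filter_upwards [hwe, enorm_ae_le_eLpNormEssSup w₂ volume] with x h1 h2
        have h3 : |w₂ x| ≤ 1 := by
          have := h2.trans hw₂le
          rwa [Real.enorm_eq_ofReal_abs, ENNReal.ofReal_le_ofReal_iff zero_le_one] at this
        rw [h1]
        exact (abs_add_le _ _).trans (by linarith)
      even_w := hweven
      a_nonneg := ha }
  have hβp : 0 < β := hβ₀.trans hβ
  have hinf := H.vlasovInf_finite hβ hρ hρ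
  have hval : ∀ {m₀ : Phase d → ℝ}, FiniteEnergy V A a m₀ →
      vlasovReal V A w a β ρ m₀ = (vlasovInf V A w a β ρ ρ).toReal →
      ∀ m', IsAdmissible ρ m' → FiniteEnergy V A a m' →
        vlasovReal V A w a β ρ m₀ ≤ vlasovReal V A w a β ρ m' := fun _ he m' h1 h2 => by
    rw [he]
    exact hinf.2 m' h1 h2
  refine ⟨?_, fun m₀ hm₀ => ?_, fun m₀ μ hm₀ hsol => ?_, fun hF => ⟨?_, ?_, ?_, ?_⟩⟩
  · obtain ⟨m, hadm, hm, hmin⟩ := H.exists_minimizer hβ hρ hρ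
    refine ⟨m, (H.isVlasovMinimizer_iff hβ hρ).2 ⟨hadm, hm, ?_⟩⟩
    rw [H.vlasovInf_eq hm hadm hmin, EReal.toReal_coe]
  · obtain ⟨hadm, hm, he⟩ := (H.isVlasovMinimizer_iff hβ hρ).1 hm₀
    exact H.exists_solvesFermiDirac hβ hρ hρ hm hadm (hval hm he)
  · obtain ⟨hadm, hm, he⟩ := (H.isVlasovMinimizer_iff hβ hρ).1 hm₀
    obtain ⟨hi, hv⟩ := H.vlasovReal_eq_grandPotential hβp hm hadm hsol
    refine ⟨hi, (H.hasFiniteTerms_iff hm.pauli).2 hm, ?_⟩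
    rw [vlasovMin, hinf.1, ← he, hv]
  · intro m₁ m₂ hp₁ hp₂ hlt₁ hlt₂ hne t h0 h1
    have h₁ := H.finiteEnergy_of_lt_top hp₁ hlt₁
    have h₂ := H.finiteEnergy_of_lt_top hp₂ hlt₂
    rw [H.vlasovEnergy_eq h₁, H.vlasovEnergy_eq h₂,
      H.vlasovEnergy_eq (H.finiteEnergy_convex h₁ h₂ h0.le h1.le)]
    exact_mod_cast H.vlasovReal_convex_lt hF h₁ h₂ hne hβp hρ h0 h1
  · intro m₁ m₂ hmin₁ hmin₂
    obtain ⟨hadm₁, h₁, e₁⟩ := (H.isVlasovMinimizer_iff hβ hρ).1 hmin₁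
    obtain ⟨hadm₂, h₂, e₂⟩ := (H.isVlasovMinimizer_iff hβ hρ).1 hmin₂
    by_contra hne
    have hlt := H.vlasovReal_convex_lt hF h₁ h₂ hne hβp hρ (t := 1 / 2) (by norm_num) (by norm_num)
    have hadm := hadm₁.convex hadm₂ (t := 1 / 2) (by norm_num) (by norm_num)
    rw [show 1 / 2 * ρ + (1 - 1 / 2) * ρ = ρ by ring] at hadm
    have hle := hinf.2 _ hadm
      (H.finiteEnergy_convex h₁ h₂ (by norm_num) (by norm_num))
    linarith
  · intro ρ' hρ'
    refine ⟨fun r hr => ?_, H.contDiffOn_vlasovInf hF hβ hρ'⟩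
    rw [(H.vlasovInf_finite hβ hρ' hr).1]
    exact ⟨EReal.coe_ne_top _, EReal.coe_ne_bot _⟩
  · intro m₀ μ hm₀ hsol
    obtain ⟨hadm, hm, he⟩ := (H.isVlasovMinimizer_iff hβ hρ).1 hm₀
    exact H.hasDerivAt_vlasovInf hF hβ hρ hρ hm hadm he hsol
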